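/- Let $k$ be an algebraically closed field and let $Q$ be a finite quiver which is an orientation of a simply laced Dynkin diagram ($A_n$, $D_n$, $E_6$, $E_7$, $E_8$, or a disjoint union of these). Let $\operatorname{rep} Q$ be the category of finite-dimensional representations of $Q$ over $k$. A torsion class is a full subcategory of $\operatorname{rep} Q$ that contains $0$ and is closed under quotients and extensions. Write $\operatorname{Ind}(\mathcal T)\subset\mathbb R^{Q_0}$ for the set of dimension vectors of the indecomposable objects of $\mathcal T$. On $V=\mathbb R^{Q_0}$, with standard basis $(e_i)$, let $(\alpha,\beta)=\langle\alpha,\beta\rangle+\langle\beta,\alpha\rangle$, where $\langle\alpha,\beta\rangle=\sum_i\alpha_i\beta_i-\sum_{i\to j}\alpha_i\beta_j$. The positive roots $\Phi^+$ are the $v\in\mathbb Z_{\ge0}^{Q_0}$ with $(v,v)=2$; the group $W$ is generated by the reflections $s_v(x)=x-(v,x)v$, $v\in\Phi^+$, and $s_i=s_{e_i}$ are the simple reflections, with length function $\ell$. For $w\in W$ the inversion set is $I(w)=\{\alpha\in\Phi^+ : -w^{-1}(\alpha)\in\Phi^+\}$. Let $\operatorname{cox}(Q)$ be the product of all the $s_i$,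 each taken once, from left to right in an order consistent with the arrows ($s_i$ is to the left of $s_j$ if there is an arrow $i\to j$). For a Coxeter element $c$ of a subgroup generated by simple reflections, $c$-sortable elements are defined inductively: the identity is $c$-sortable; and for a simple reflection $s$ initial in $c$ (some reduced word of $c$ begins with $s$), if $\ell(sw)>\ell(w)$, then $w$ is $c$-sortable iff $w$ lies in the subgroup generated by the simple reflections other than $s$ and is $sc$-sortable, and if $\ell(sw)<\ell(w)$, then $w$ is $c$-sortable iff $sw$ is $scs$-sortable. **Theorem.** For each torsion class $\mathcal T$ of $\operatorname{rep} Q$ there is exactly one $w_{\mathcal T}\in W$ with $I(w_{\mathcal T})=\operatorname{Ind}(\mathcal T)$, and $\mathcal T\mapsto w_{\mathcal T}$ is a bijection from the torsion classes of $\operatorname{rep} Q$ to the $\operatorname{cox}(Q)$-sortable elements of $W$. It is an isomorphism of posets from the torsion classes, ordered by inclusion, to the Cambrian lattice of $Q$, that is, the $\operatorname{cox}(Q)$-sortable elements ordered by inclusion of inversion sets; and both of these posets are lattices. -/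

import Mathlib

open CategoryTheory CategoryTheory.Limits

universe u v w

noncomputable section

namespace DynkinQuiver

/-! ### Simply laced Dynkin quivers -/

/-- The graph on `0, …, n - 1` made of the path `0 — 1 — ⋯ — n - 2` and of the vertex `n - 1`,
which is joined to the vertex `b` of the path. -/
def branchGraph (n b : ℕ) : SimpleGraph (Fin n) :=
  SimpleGraph.fromRel fun i j =>
    (i.val + 1 = j.val ∧ j.val + 1 < n) ∨ (i.val = b ∧ j.val + 1 = n)

/-- The simply laced Dynkin diagrams `Aₙ` (`n ≥ 1`), `Dₙ` (`n ≥ 4`), `E₆`, `E₇`, `E₈`. -/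
inductive IsDynkinDiagram {V : Type v} (G : SimpleGraph V) : Prop
  | A (n : ℕ) (hn : 1 ≤ n) (e : G ≃g SimpleGraph.pathGraph n) : IsDynkinDiagram G
  | D (n : ℕ) (hn : 4 ≤ n) (e : G ≃g branchGraph n (n - 3)) : IsDynkinDiagram G
  | E (n : ℕ) (hn : n = 6 ∨ n = 7 ∨ n = 8) (e : G ≃g branchGraph n 2) : IsDynkinDiagram G

/-- The underlying graph of a quiver (orientation and multiplicities of arrows are forgotten). -/
def underlyingGraph (Q : Type v) [Quiver.{w} Q] : SimpleGraph Q :=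
  SimpleGraph.fromRel fun i j => Nonempty (i ⟶ j)

/-- `Q` is an orientation of a disjoint union of simply laced Dynkin diagrams. -/
class IsSimplyLacedDynkin (Q : Type v) [Quiver.{w} Q] : Prop where
  no_loop : ∀ i : Q, IsEmpty (i ⟶ i)
  simply_laced : ∀ i j : Q, Subsingleton (i ⟶ j)
  no_two_cycle : ∀ i j : Q, Nonempty (i ⟶ j) → IsEmpty (j ⟶ i)
  component : ∀ C : (underlyingGraph Q).ConnectedComponent, IsDynkinDiagram C.toSimpleGraph

/-! ### Representations and torsion classes -/

/-- The category of finite dimensional `k`-linear representations of the quiver `Q`: functors from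
the free category on `Q` to finite dimensional vector spaces. -/
abbrev Rep (k : Type u) [Field k] (Q : Type v) [Quiver.{w} Q] :=
  Paths Q ⥤ FGModuleCat.{u} k

/-- Torsion classes of `rep Q`: full subcategories that contain `0` and are closed under quotients
and extensions. (So they are closed under isomorphisms, finite direct sums, direct summands.) -/
structure IsTorsionClass {k : Type u} [Field k] {Q : Type v} [Quiver.{w} Q]
    (T : ObjectProperty (Rep k Q)) : Prop where
  containsZero : T.ContainsZero
  closedUnderQuotients : T.IsClosedUnderQuotients
  closedUnderExtensions : T.IsClosedUnderExtensions

/-- The poset of torsion classes of `rep Q`, ordered by inclusion. -/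
abbrev TorsionClass (k : Type u) [Field k] (Q : Type v) [Quiver.{w} Q] :=
  {T : ObjectProperty (Rep k Q) // IsTorsionClass T}

/-- The dimension vector of a representation, as an element of `K₀ ⊗ ℝ = ℝ^{Q₀}`. -/
def dimVector {k : Type u} [Field k] {Q : Type v} [Quiver.{w} Q] (M : Rep k Q) : Q → ℝ :=
  fun i => (Module.finrank k (M.obj ((Paths.of Q).obj i)) : ℝ)

/-- The set of the dimension vectors of the indecomposable objects of a full subcategory. -/
def Ind {k : Type u} [Field k] {Q : Type v} [Quiver.{w} Q] (T : ObjectProperty (Rep k Q)) :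
    Set (Q → ℝ) :=
  {α | ∃ M : Rep k Q, T M ∧ Indecomposable M ∧ dimVector M = α}

/-! ### The root system and the Weyl group -/

section Weyl

variable (Q : Type v) [Quiver.{w} Q] [Fintype Q] [DecidableEq Q]

/-- The matrix of the Euler form `⟨x, y⟩ = ∑ᵢ xᵢ yᵢ - ∑_{i → j} xᵢ yⱼ`. -/
def eulerMatrix : Matrix Q Q ℝ :=
  1 - Matrix.of fun i j => (Nat.card (i ⟶ j) : ℝ)

/-- The symmetrized Euler form `(x, y) = ⟨x, y⟩ + ⟨y, x⟩` on `ℝ^{Q₀}`. -/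
def symForm : LinearMap.BilinForm ℝ (Q → ℝ) :=
  Matrix.toBilin' (eulerMatrix Q + (eulerMatrix Q).transpose)

/-- The positive roots: the nonnegative integral vectors `v` with `(v, v) = 2`. -/
def posRoots : Set (Q → ℝ) :=
  {v | (∃ n : Q → ℕ, v = fun i => (n i : ℝ)) ∧ symForm Q v v = 2}

/-- The group `W` of linear transformations generated by the reflections
`s_v(x) = x - (v, x) v` in the positive roots `v`. -/
def weylGroup : Subgroup ((Q → ℝ) ≃ₗ[ℝ] (Q → ℝ)) :=
  Subgroup.closure
    {g | ∃ (v : Q → ℝ) (hv : v ∈ posRoots Q), g = Module.reflection (f := symForm Q v) hv.2}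

variable {Q}

/-- The inversion set `I(w)`: the positive roots `α` such that `w⁻¹(α)` is a negative root. -/
def inversionSet (w : (Q → ℝ) ≃ₗ[ℝ] (Q → ℝ)) : Set (Q → ℝ) :=
  {α | α ∈ posRoots Q ∧ -(w⁻¹ α) ∈ posRoots Q}

variable [IsSimplyLacedDynkin Q]

/-- The simple root `e_i` satisfies `(e_i, e_i) = 2`, since `Q` has no loops. -/
theorem symForm_single (i : Q) : symForm Q (Pi.single i 1) (Pi.single i 1) = 2 := by
  have h := IsSimplyLacedDynkin.no_loop i
  rw [symForm, Matrix.toBilin'_single]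
  simp [eulerMatrix]
  norm_num

/-- The simple reflection `s_i = s_{e_i}`. -/
def simpleReflection (i : Q) : (Q → ℝ) ≃ₗ[ℝ] (Q → ℝ) :=
  Module.reflection (f := symForm Q (Pi.single i 1)) (symForm_single i)

/-- The product of the word `s_{i₁} ⋯ s_{iᵣ}` in the simple reflections. -/
def wordProd (l : List Q) : (Q → ℝ) ≃ₗ[ℝ] (Q → ℝ) :=
  (l.map simpleReflection).prod

/-- The length `ℓ_S(w)`: the least length of a word in the simple reflections with product `w`
(the simple reflections generate `W`, so there is such a word for each `w` in `W`). -/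
def length (w : (Q → ℝ) ≃ₗ[ℝ] (Q → ℝ)) : ℕ :=
  sInf {n | ∃ l : List Q, wordProd l = w ∧ l.length = n}

/-- `s_i` is initial in `c`: some reduced word for `c` begins with `s_i`. -/
def IsInitial (i : Q) (c : (Q → ℝ) ≃ₗ[ℝ] (Q → ℝ)) : Prop :=
  ∃ l : List Q, wordProd (i :: l) = c ∧ length c = (i :: l).length

/-- `c` is the Coxeter element `cox(Q)`: the product of all the simple reflections, each taken once,
from left to right in an order consistent with the arrows
(if there is an arrow `i ⟶ j`, then `s_i` stands to the left of `s_j`). -/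
def IsCox (c : (Q → ℝ) ≃ₗ[ℝ] (Q → ℝ)) : Prop :=
  ∃ l : List Q, l.Nodup ∧ (∀ i, i ∈ l) ∧ l.Pairwise (fun i j => IsEmpty (j ⟶ i)) ∧ c = wordProd l

/-- `w` is `c`-sortable, for `c` a Coxeter element of the subgroup generated by a set of simple
reflections: the inductive definition. The identity is `c`-sortable; for `s` initial in `c`,
if `ℓ(sw) > ℓ(w)`, then `w` is `c`-sortable when it lies in the subgroup generated by
the simple reflections other than `s` and is `sc`-sortable, and if `ℓ(sw) < ℓ(w)`, then `w` is
`c`-sortable when `sw` is `scs`-sortable. -/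
inductive IsSortable : ((Q → ℝ) ≃ₗ[ℝ] (Q → ℝ)) → ((Q → ℝ) ≃ₗ[ℝ] (Q → ℝ)) → Prop
  | one (c : (Q → ℝ) ≃ₗ[ℝ] (Q → ℝ)) : IsSortable c 1
  | ascent (c w : (Q → ℝ) ≃ₗ[ℝ] (Q → ℝ)) (i : Q) (hi : IsInitial i c)
      (hl : length w < length (simpleReflection i * w))
      (hw : w ∈ Subgroup.closure {g | ∃ j : Q, j ≠ i ∧ g = simpleReflection j})
      (h : IsSortable (simpleReflection i * c) w) : IsSortable c w
  | descent (c w : (Q → ℝ) ≃ₗ[ℝ] (Q → ℝ)) (i : Q) (hi : IsInitial i c)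
      (hl : length (simpleReflection i * w) < length w)
      (h : IsSortable (simpleReflection i * c * simpleReflection i) (simpleReflection i * w)) :
      IsSortable c w

/-- The underlying set of the Cambrian lattice: the `c`-sortable elements of `W`. -/
def Cambrian (c : (Q → ℝ) ≃ₗ[ℝ] (Q → ℝ)) :=
  {w : weylGroup Q // IsSortable c w}

/-- The order of the Cambrian lattice: inclusion of inversion sets. -/
instance (c : (Q → ℝ) ≃ₗ[ℝ] (Q → ℝ)) : Preorder (Cambrian c) :=
  Preorder.lift fun x => inversionSet (x.1 : (Q → ℝ) ≃ₗ[ℝ] (Q → ℝ))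

end Weyl

/-- A preorder that is (the order of) a lattice. -/
def IsLatticeOrder (α : Type*) [Preorder α] : Prop :=
  (∀ x y : α, x ≤ y → y ≤ x → x = y) ∧
  ∀ x y : α, (∃ m, IsGLB {x, y} m) ∧ (∃ j, IsLUB {x, y} j)

end DynkinQuiver

end

/-!
A representation is encoded as a family `GRep` of finite-dimensional spaces and of linear maps
between any two of them; the maps that do not belong to an arrow of the orientation vanish
(`GRep.IsRep`). In this form the orientation and the support are parameters, so that they can vary
along an induction over a fixed set of vertices.

Let `i` be a source, the first vertex of an ordering `l` that is consistent with the arrows. The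
maps into the space at `i` vanish, so an object of a torsion class `T` that is nonzero at `i` has
the simple object at `i` as a quotient. Hence either `T` is supported off `i`, or `T` contains this
simple object (`GRep.IsTors.simple_mem_or`). In the second case the reflection functor at `i` takes
`T` to a torsion class `T'` of the quiver with the arrows at `i` reversed. This sets up a
correspondence with the torsion classes `T'` that do not contain the simple object at `i`
(`GRep.IsTors.reflDown`, `GRep.IsTors.reflUp`), and `Ind T = {e_i} ∪ s_i (Ind T')`
(`GRep.IsTors.indSet_reflDown`, `GRep.IsTors.indSet_reflUp`). If `e_i` is not an inversion of `x`,
then the inversion set of `s_i x` is `{e_i} ∪ s_i (I(x))` (`inversionSet_mul_of_notMem`), and the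
length of `x` is its number of inversions (`length_wordProd`). So the two cases for `T` are the two
clauses in the definition of sortable elements. The rotated ordering, where `i` comes last, belongs
to the Coxeter element `s_i c s_i`, and it is consistent with the reversed arrows. By induction,
the sets `Ind T` are the inversion sets of the sortable elements (`GRep.IsTors.exists_sortable`,
`GRep.exists_isTors_of_isSortable`).

An element of the Weyl group is determined by its inversion set (`wordProd_eq_of_inversionSet_eq`).
A torsion class is determined by `Ind T`, since it is determined by its indecomposable objects, and
these by their dimension vectors, by Gabriel's theorem (`GRep.isRigidRoot`). An indecomposable
object that violates Gabriel's theorem is never simple at a source, so reflection functors can be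
applied to it forever. Its dimension vector `x` would stay nonnegative under all powers of the
inverse of a Coxeter element. It would then have a finite orbit, and the sum over this orbit would
be a nonzero fixed vector, but there is none (`exists_wordProd_inv_pow_not_isNat`). The finiteness
of the orbit, and the fact that each root is positive or negative, come from the positive
definiteness of the Euler form (`exists_pos_mul_sum_sq_le_symForm`), for which an explicit strictly
superharmonic weight is given on each Dynkin diagram.

The torsion classes are closed under intersection, so they form a lattice, and the order
isomorphism carries this over to the sortable elements.
-/

noncomputable section

namespace DynkinQuiver

/-! ### Superharmonic weights on Dynkin diagrams -/

open scoped Classical in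
/-- A weight on the vertices of a graph that is strictly superharmonic: the Cartan matrix `2 - A`
maps it to a positive vector. Its existence characterizes finite (Dynkin) type; here it is what
makes the Tits form positive definite. -/
def IsDominantWeight {V : Type*} [Fintype V] (G : SimpleGraph V) (x : V → ℝ) : Prop :=
  (∀ i, 0 < x i) ∧ ∀ i, ∑ j, (if G.Adj i j then x j else 0) < 2 * x i

theorem IsDominantWeight.comp_iso {V V' : Type*} [Fintype V] [Fintype V'] {G : SimpleGraph V}
    {G' : SimpleGraph V'} (e : G ≃g G') {x : V' → ℝ} (hx : IsDominantWeight G' x) :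
    IsDominantWeight G (x ∘ e) := by
  classical
  refine ⟨fun i => hx.1 _, fun i => ?_⟩
  have h := hx.2 (e i)
  rw [← e.toEquiv.sum_comp] at h
  simpa [e.map_adj_iff] using h

/-- A neighbor sum in a graph on `Fin n` is bounded by the sum over any set of numbers that contains
the neighbors. -/
theorem sum_adj_le_sum {n : ℕ} (G : SimpleGraph (Fin n)) [DecidableRel G.Adj] (f : ℕ → ℝ)
    (i : Fin n) (S : Finset ℕ) (hf : ∀ a ∈ S, 0 ≤ f a) (hS : ∀ j, G.Adj i j → j.val ∈ S) :
    ∑ j, (if G.Adj i j then f j.val else 0) ≤ ∑ a ∈ S, f a := by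
  rw [← Finset.sum_filter]
  refine (Finset.sum_map (Finset.univ.filter (G.Adj i ·)) Fin.valEmbedding f).symm.trans_le ?_
  refine Finset.sum_le_sum_of_subset_of_nonneg ?_ fun a ha _ => hf a ha
  intro a ha
  obtain ⟨j, hj, rfl⟩ := Finset.mem_map.1 ha
  exact hS j (Finset.mem_filter.1 hj).2

theorem exists_dominantWeight_path (n : ℕ) :
    ∃ x, IsDominantWeight (SimpleGraph.pathGraph n) x := by
  classical
  -- The coordinates of the sum of the positive roots of `Aₙ`.
  refine ⟨fun i => (i.val + 1 : ℝ) * (n - i.val), fun i => ?_, fun i => ?_⟩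
  · have : (i.val : ℝ) < n := by exact_mod_cast i.2
    have h0 : (0 : ℝ) ≤ i.val := by positivity
    exact mul_pos (by linarith) (by linarith)
  · have hi : (i.val : ℝ) + 1 ≤ n := by exact_mod_cast i.2
    have nn : ∀ a : ℕ, a ≤ n → (0 : ℝ) ≤ (a + 1 : ℝ) * (n - a) := fun a ha => by
      have : (a : ℝ) ≤ n := by exact_mod_cast ha
      exact mul_nonneg (by positivity) (by linarith)
    rcases Nat.eq_zero_or_pos i.val with h0 | h0
    · refine (sum_adj_le_sum _ (fun a => (a + 1 : ℝ) * (n - a)) i {1} ?_ ?_).trans_lt ?_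
      · intro a ha
        rw [Finset.mem_singleton] at ha
        exact nn a (by have := i.2; omega)
      · intro j hj
        rw [SimpleGraph.pathGraph_adj] at hj
        rw [Finset.mem_singleton]; omega
      · simp [h0]; linarith
    · obtain ⟨m, hm⟩ : ∃ m, i.val = m + 1 := ⟨i.val - 1, by omega⟩
      refine (sum_adj_le_sum _ (fun a => (a + 1 : ℝ) * (n - a)) i {m, m + 2} ?_ ?_).trans_lt ?_
      · intro a ha
        simp only [Finset.mem_insert, Finset.mem_singleton] at ha
        exact nn a (by have := i.2; omega)
      · intro j hj
        rw [SimpleGraph.pathGraph_adj] at hj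
        simp only [Finset.mem_insert, Finset.mem_singleton]; omega
      · rw [Finset.sum_pair (by omega)]
        simp only [hm]
        push_cast
        nlinarith

theorem branchGraph_adj {n b : ℕ} {i j : Fin n} : (branchGraph n b).Adj i j ↔ i ≠ j ∧
    (((i.val + 1 = j.val ∧ j.val + 1 < n) ∨ (i.val = b ∧ j.val + 1 = n)) ∨
      ((j.val + 1 = i.val ∧ i.val + 1 < n) ∨ (j.val = b ∧ i.val + 1 = n))) :=
  Iff.rfl

theorem exists_dominantWeight_D (n : ℕ) (hn : 4 ≤ n) :
    ∃ x, IsDominantWeight (branchGraph n (n - 3)) x := by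
  classical
  obtain ⟨m, rfl⟩ : ∃ m, n = m + 4 := ⟨n - 4, by omega⟩
  have e3 : m + 4 - 3 = m + 1 := by omega
  rw [e3]
  -- The coordinates of the sum of the positive roots of `D_{m+4}`.
  let f : ℕ → ℝ := fun a =>
    if a ≤ m + 1 then (a + 1 : ℝ) * (2 * m + 6 - a) else (m + 4 : ℝ) * (m + 3) / 2
  have f1 : ∀ a, a ≤ m + 1 → f a = (a + 1 : ℝ) * (2 * m + 6 - a) := fun a ha => if_pos ha
  have f2 : ∀ a, m + 2 ≤ a → f a = (m + 4 : ℝ) * (m + 3) / 2 := fun a ha =>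
    if_neg (by omega)
  have pos : ∀ a, 0 < f a := by
    intro a
    rcases Nat.lt_or_ge (m + 1) a with h | h
    · rw [f2 a h]; positivity
    · rw [f1 a h]
      have : (a : ℝ) ≤ m + 1 := by exact_mod_cast h
      have hm : (0 : ℝ) ≤ m := by positivity
      exact mul_pos (by positivity) (by linarith)
  refine ⟨fun i => f i.val, fun i => pos _, fun i => ?_⟩
  have hm : (0 : ℝ) ≤ m := by positivity
  have key : ∀ S : Finset ℕ, (∀ j, (branchGraph (m + 4) (m + 1)).Adj i j → j.val ∈ S) →
      ∑ a ∈ S, f a < 2 * f i.val →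
      ∑ j, (if (branchGraph (m + 4) (m + 1)).Adj i j then f j.val else 0) < 2 * f i.val :=
    fun S hS h => (sum_adj_le_sum _ f i S (fun a _ => (pos a).le) hS).trans_lt h
  have hi := i.2
  rcases Nat.lt_or_ge (m + 1) i.val with h | h
  · refine key {m + 1} (fun j hj => ?_) ?_
    · rw [branchGraph_adj] at hj
      rw [Finset.mem_singleton]; omega
    · rw [Finset.sum_singleton, f1 _ le_rfl, f2 _ h]
      push_cast
      nlinarith
  rcases Nat.eq_or_lt_of_le h with h | h
  · refine key {m, m + 2, m + 3} (fun j hj => ?_) ?_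
    · rw [branchGraph_adj] at hj
      simp only [Finset.mem_insert, Finset.mem_singleton]; omega
    · rw [Finset.sum_insert (by simp), Finset.sum_pair (by omega), h, f1 _ le_rfl, f1 m (by omega),
        f2 _ le_rfl, f2 (m + 3) (by omega)]
      push_cast
      nlinarith
  rcases Nat.eq_zero_or_pos i.val with h0 | h0
  · refine key {1} (fun j hj => ?_) ?_
    · rw [branchGraph_adj] at hj
      rw [Finset.mem_singleton]; omega
    · rw [Finset.sum_singleton, h0, f1 _ (by omega), f1 _ (by omega)]
      push_cast
      nlinarith
  · obtain ⟨p, hp⟩ : ∃ p, i.val = p + 1 := ⟨i.val - 1, by omega⟩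
    refine key {p, p + 2} (fun j hj => ?_) ?_
    · rw [branchGraph_adj] at hj
      simp only [Finset.mem_insert, Finset.mem_singleton]; omega
    · rw [Finset.sum_pair (by omega), hp, f1 _ (by omega), f1 _ (by omega), f1 _ (by omega)]
      push_cast
      nlinarith

/-- A form of the definition, over the natural numbers, that `decide` can check. -/
theorem isDominantWeight_natCast {n b : ℕ} (x : Fin n → ℕ) (h0 : ∀ i, 0 < x i)
    (h : ∀ i : Fin n, ∑ j : Fin n, (if i ≠ j ∧
      (((i.val + 1 = j.val ∧ j.val + 1 < n) ∨ (i.val = b ∧ j.val + 1 = n)) ∨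
      ((j.val + 1 = i.val ∧ i.val + 1 < n) ∨ (j.val = b ∧ i.val + 1 = n)))
      then x j else 0) < 2 * x i) :
    IsDominantWeight (branchGraph n b) fun i => (x i : ℝ) := by
  classical
  refine ⟨fun i => Nat.cast_pos.2 (h0 i), fun i => ?_⟩
  have := h i
  simp only [branchGraph_adj]
  exact_mod_cast this

theorem exists_dominantWeight_E (n : ℕ) (hn : n = 6 ∨ n = 7 ∨ n = 8) :
    ∃ x, IsDominantWeight (branchGraph n 2) x := by
  -- The coordinates of the sum of the positive roots of `E₆`, `E₇`, `E₈`.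
  rcases hn with rfl | rfl | rfl
  · exact ⟨_, isDominantWeight_natCast ![16, 30, 42, 30, 16, 22] (by decide) (by decide)⟩
  · exact ⟨_, isDominantWeight_natCast ![34, 66, 96, 75, 52, 27, 49] (by decide) (by decide)⟩
  · exact ⟨_, isDominantWeight_natCast ![92, 182, 270, 220, 168, 114, 58, 136] (by decide)
      (by decide)⟩

theorem IsDynkinDiagram.exists_dominantWeight {V : Type*} [Fintype V] {G : SimpleGraph V}
    (h : IsDynkinDiagram G) : ∃ x, IsDominantWeight G x := by
  rcases h with ⟨n, _, e⟩ | ⟨n, hn, e⟩ | ⟨n, hn, e⟩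
  · exact (exists_dominantWeight_path n).elim fun _ h => ⟨_, h.comp_iso e⟩
  · exact (exists_dominantWeight_D n hn).elim fun _ h => ⟨_, h.comp_iso e⟩
  · exact (exists_dominantWeight_E n hn).elim fun _ h => ⟨_, h.comp_iso e⟩

theorem exists_dominantWeight_of_components {V : Type*} [Fintype V] (G : SimpleGraph V)
    (h : ∀ C : G.ConnectedComponent, IsDynkinDiagram C.toSimpleGraph) :
    ∃ x, IsDominantWeight G x := by
  classical
  choose x hx using fun C => (h C).exists_dominantWeight
  let y : V → ℝ := fun i => x (G.connectedComponentMk i) ⟨i, rfl⟩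
  have hy : ∀ (C : G.ConnectedComponent) (j : C), y j = x C j := by
    rintro C ⟨j, hj⟩
    obtain rfl : G.connectedComponentMk j = C := hj
    rfl
  refine ⟨y, fun i => (hx _).1 _, fun i => ?_⟩
  have h2 := (hx (G.connectedComponentMk i)).2 ⟨i, rfl⟩
  refine lt_of_eq_of_lt ?_ h2
  rw [← Finset.sum_filter, ← Finset.sum_filter]
  symm
  refine Finset.sum_bij (fun j _ => j.1) ?_ ?_ ?_ ?_
  · intro j hj
    simpa [SimpleGraph.ConnectedComponent.toSimpleGraph] using hj
  · intro a _ b _ hab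
    exact Subtype.ext hab
  · intro j hj
    have hj' : G.Adj i j := by simpa using hj
    have hm : j ∈ G.connectedComponentMk i :=
      (SimpleGraph.ConnectedComponent.connectedComponentMk_eq_of_adj hj').symm
    exact ⟨⟨j, hm⟩, by simpa [SimpleGraph.ConnectedComponent.toSimpleGraph] using hj', rfl⟩
  · intro j _
    exact (hy _ j).symm

/-! ### Positive definiteness of the Euler form -/

/-- A nonnegative integral vector. -/
def IsNat {Q : Type*} (x : Q → ℝ) : Prop := ∃ n : Q → ℕ, x = fun i => (n i : ℝ)

/-- An integral vector. -/
def IsInt {Q : Type*} (x : Q → ℝ) : Prop := ∃ n : Q → ℤ, x = fun i => (n i : ℝ)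

theorem IsNat.isInt {Q : Type*} {x : Q → ℝ} (h : IsNat x) : IsInt x := by
  obtain ⟨n, rfl⟩ := h
  exact ⟨fun i => n i, by simp⟩

theorem underlyingGraph_adj {Q : Type v} [Quiver.{w} Q] [IsSimplyLacedDynkin Q] {i j : Q} :
    (underlyingGraph Q).Adj i j ↔ Nonempty (i ⟶ j) ∨ Nonempty (j ⟶ i) := by
  rw [underlyingGraph, SimpleGraph.fromRel_adj, and_iff_right_iff_imp]
  rintro h rfl
  have := IsSimplyLacedDynkin.no_loop i
  rw [or_self] at h
  exact h.elim this.elim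

section Roots

variable {Q : Type v} [Quiver.{w} Q] [Fintype Q] [DecidableEq Q]

local notation "ε" i:max => (Pi.single i (1 : ℝ) : _ → ℝ)

theorem symForm_comm (x y : Q → ℝ) : symForm Q x y = symForm Q y x := by
  rw [symForm, Matrix.toBilin'_apply, Matrix.toBilin'_apply, Finset.sum_comm]
  refine Finset.sum_congr rfl fun i _ => Finset.sum_congr rfl fun j _ => ?_
  simp only [Matrix.add_apply, Matrix.transpose_apply]
  ring

theorem symForm_eq_sum (x y : Q → ℝ) : symForm Q x y = ∑ i, x i * symForm Q (ε i) y := by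
  conv_lhs => rw [pi_eq_sum_univ' x]
  rw [map_sum, LinearMap.sum_apply]
  refine Finset.sum_congr rfl fun i _ => ?_
  rw [map_smul, LinearMap.smul_apply, smul_eq_mul]

variable [IsSimplyLacedDynkin Q]

open scoped Classical in
theorem symForm_single_left (i : Q) (x : Q → ℝ) :
    symForm Q (ε i) x = 2 * x i - ∑ j, if (underlyingGraph Q).Adj i j then x j else 0 := by
  have key : ∀ j, (eulerMatrix Q + (eulerMatrix Q).transpose) i j * x j =
      (if i = j then 2 * x j else 0) - if (underlyingGraph Q).Adj i j then x j else 0 := by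
    intro j
    rw [underlyingGraph_adj]
    have h1 := IsSimplyLacedDynkin.simply_laced i j
    have h2 := IsSimplyLacedDynkin.simply_laced j i
    have h3 := IsSimplyLacedDynkin.no_two_cycle i j
    have hc : ∀ a b : Q, Subsingleton (a ⟶ b) →
        (Nat.card (a ⟶ b) : ℝ) = if Nonempty (a ⟶ b) then 1 else 0 := by
      intro a b _
      split_ifs with h
      · have := h
        rw [Nat.card_unique]; simp
      · rw [not_nonempty_iff] at h
        simp
    rw [Matrix.add_apply, Matrix.transpose_apply, eulerMatrix, Matrix.sub_apply, Matrix.sub_apply,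
      Matrix.of_apply, Matrix.of_apply, hc _ _ h1, hc _ _ h2, Matrix.one_apply, Matrix.one_apply]
    by_cases hij : i = j
    · subst hij
      have := IsSimplyLacedDynkin.no_loop i
      simp [not_nonempty_iff.2 this, two_mul, one_add_one_eq_two]
    · rw [if_neg hij, if_neg (Ne.symm hij), if_neg hij]
      by_cases ha : Nonempty (i ⟶ j)
      · have := h3 ha
        simp [ha, not_nonempty_iff.2 this]
      · by_cases hb : Nonempty (j ⟶ i) <;> simp [ha, hb]
  rw [symForm, Matrix.toBilin'_apply, Finset.sum_eq_single i]
  · simp only [Pi.single_eq_same, one_mul, key, Finset.sum_sub_distrib]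
    simp
  · intro b _ hb
    simp [Pi.single_eq_of_ne hb]
  · simp

theorem symForm_single_single_of_adj {i j : Q} (h : (underlyingGraph Q).Adj i j) :
    symForm Q (ε i) (ε j) = -1 := by
  classical
  rw [symForm_single_left, Pi.single_eq_of_ne h.ne, Finset.sum_eq_single j]
  · simp [h]
  · intro b _ hb
    simp [Pi.single_eq_of_ne hb]
  · simp

theorem symForm_single_nonpos (i : Q) {x : Q → ℝ} (hx : ∀ j, 0 ≤ x j) (hi : x i = 0) :
    symForm Q (ε i) x ≤ 0 := by
  classical
  rw [symForm_single_left, hi]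
  have : 0 ≤ ∑ j, if (underlyingGraph Q).Adj i j then x j else 0 :=
    Finset.sum_nonneg fun j _ => by split_ifs <;> simp [hx]
  linarith

variable (Q) in
/-- The symmetrized Euler form of a Dynkin quiver is positive definite. If `y` is a dominant weight,
then `x_i x_j ≤ (y_j / y_i) x_i² / 2 + (y_i / y_j) x_j² / 2` for each edge `i — j`, and the sum of
these bounds leaves a positive multiple of each `x_i²`. -/
theorem exists_pos_mul_sum_sq_le_symForm :
    ∃ r : ℝ, 0 < r ∧ ∀ x : Q → ℝ, ∀ i, r * x i ^ 2 ≤ symForm Q x x := by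
  classical
  obtain ⟨y, hy0, hy⟩ := exists_dominantWeight_of_components (underlyingGraph Q)
    IsSimplyLacedDynkin.component
  let N : Q → ℝ := fun i => ∑ j, if (underlyingGraph Q).Adj i j then y j else 0
  have hN : ∀ i, 0 < 2 - N i / y i := fun i => by
    rw [sub_pos, div_lt_iff₀ (hy0 i)]
    exact hy i
  have key : ∀ x : Q → ℝ, ∑ i, (2 - N i / y i) * x i ^ 2 ≤ symForm Q x x := by
    intro x
    rw [symForm_eq_sum]
    simp only [symForm_single_left, sub_mul, mul_sub, Finset.sum_sub_distrib]
    have h1 : ∑ i, x i * ∑ j, (if (underlyingGraph Q).Adj i j then x j else 0) ≤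
        ∑ i, ∑ j, (if (underlyingGraph Q).Adj i j then
          (y j / y i * x i ^ 2 / 2 + y i / y j * x j ^ 2 / 2) else 0) := by
      refine Finset.sum_le_sum fun i _ => ?_
      rw [Finset.mul_sum]
      refine Finset.sum_le_sum fun j _ => ?_
      split_ifs
      · have hi := hy0 i
        have hj := hy0 j
        have : y j / y i * x i ^ 2 / 2 + y i / y j * x j ^ 2 / 2 - x i * x j =
            (y j * x i - y i * x j) ^ 2 / (2 * y i * y j) := by
          field_simp
          ring
        have h2 : 0 ≤ (y j * x i - y i * x j) ^ 2 / (2 * y i * y j) := by positivity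
        linarith
      · simp
    have h2 : ∑ i, ∑ j, (if (underlyingGraph Q).Adj i j then
          (y j / y i * x i ^ 2 / 2 + y i / y j * x j ^ 2 / 2) else 0) =
        ∑ i, N i / y i * x i ^ 2 := by
      have e1 : ∀ i j, (if (underlyingGraph Q).Adj i j then
          (y j / y i * x i ^ 2 / 2 + y i / y j * x j ^ 2 / 2) else 0) =
          (if (underlyingGraph Q).Adj i j then y j / y i * x i ^ 2 / 2 else 0) +
          (if (underlyingGraph Q).Adj j i then y i / y j * x j ^ 2 / 2 else 0) := by
        intro i j
        rw [SimpleGraph.adj_comm _ j i]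
        split_ifs <;> simp
      simp only [e1, Finset.sum_add_distrib]
      rw [Finset.sum_comm (f := fun i j =>
        if (underlyingGraph Q).Adj j i then y i / y j * x j ^ 2 / 2 else 0),
        ← Finset.sum_add_distrib]
      refine Finset.sum_congr rfl fun i _ => ?_
      simp only [N]
      rw [← Finset.sum_add_distrib, Finset.sum_div, Finset.sum_mul]
      refine Finset.sum_congr rfl fun j _ => ?_
      split_ifs
      · ring
      · simp
    have h3 : ∑ i, x i * (2 * x i) = ∑ i, 2 * x i ^ 2 :=
      Finset.sum_congr rfl fun i _ => by ring
    linarith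
  rcases isEmpty_or_nonempty Q with hQ | hQ
  · exact ⟨1, one_pos, fun x i => isEmptyElim i⟩
  obtain ⟨i₀, hi₀⟩ := Finite.exists_min fun i => 2 - N i / y i
  refine ⟨_, hN i₀, fun x i => le_trans ?_ (key x)⟩
  calc (2 - N i₀ / y i₀) * x i ^ 2 ≤ (2 - N i / y i) * x i ^ 2 :=
        mul_le_mul_of_nonneg_right (hi₀ i) (sq_nonneg _)
    _ ≤ _ := Finset.single_le_sum (f := fun i => (2 - N i / y i) * x i ^ 2)
        (fun j _ => mul_nonneg (hN j).le (sq_nonneg _)) (Finset.mem_univ i)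

theorem symForm_self_nonneg (x : Q → ℝ) : 0 ≤ symForm Q x x := by
  obtain ⟨r, hr, h⟩ := exists_pos_mul_sum_sq_le_symForm Q
  rcases isEmpty_or_nonempty Q with hQ | ⟨⟨i⟩⟩
  · rw [Subsingleton.elim x 0]; simp
  · exact (mul_nonneg hr.le (sq_nonneg _)).trans (h x i)

theorem eq_zero_of_symForm_self_eq_zero {x : Q → ℝ} (hx : symForm Q x x = 0) : x = 0 := by
  obtain ⟨r, hr, h⟩ := exists_pos_mul_sum_sq_le_symForm Q
  funext i
  have h1 := h x i
  rw [hx] at h1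
  have : x i ^ 2 ≤ 0 := by
    by_contra! h2
    exact absurd h1 (not_le.2 (mul_pos hr h2))
  exact pow_eq_zero_iff two_ne_zero |>.1 (le_antisymm this (sq_nonneg _))

end Roots

/-! ### Roots -/

section Roots

variable {Q : Type v} [Quiver.{w} Q] [Fintype Q] [DecidableEq Q]

local notation "ε" i:max => (Pi.single i (1 : ℝ) : _ → ℝ)

/-- A root, positive or negative: an integral vector `x` with `(x, x) = 2`. -/
def IsRoot (x : Q → ℝ) : Prop := IsInt x ∧ symForm Q x x = 2

theorem isRoot_of_mem_posRoots {x : Q → ℝ} (h : x ∈ posRoots Q) : IsRoot x :=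
  ⟨IsNat.isInt h.1, h.2⟩

theorem posRoots_nonneg {x : Q → ℝ} (h : x ∈ posRoots Q) (i : Q) : 0 ≤ x i := by
  obtain ⟨⟨n, rfl⟩, _⟩ := h
  positivity

theorem neg_notMem_posRoots {x : Q → ℝ} (h : x ∈ posRoots Q) : -x ∉ posRoots Q := by
  intro h'
  have : x = 0 := by
    funext i
    have h1 := posRoots_nonneg h i
    have h2 := posRoots_nonneg h' i
    rw [Pi.neg_apply] at h2
    exact le_antisymm (neg_nonneg.1 h2) h1
  have h3 := h.2
  rw [this] at h3
  simp at h3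

variable [IsSimplyLacedDynkin Q]

theorem single_mem_posRoots (i : Q) : ε i ∈ posRoots Q := by
  refine ⟨⟨Pi.single i 1, ?_⟩, symForm_single i⟩
  funext j
  by_cases h : j = i
  · subst h; simp
  · simp [Pi.single_eq_of_ne h]

theorem exists_int_symForm_single {x : Q → ℝ} (hx : IsInt x) (i : Q) :
    ∃ m : ℤ, symForm Q (ε i) x = m := by
  classical
  obtain ⟨n, rfl⟩ := hx
  rw [symForm_single_left]
  exact ⟨2 * n i - ∑ j, if (underlyingGraph Q).Adj i j then n j else 0, by push_cast; rfl⟩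

open scoped Classical in
/-- The Euler form takes even values on the diagonal, so a nonzero integral vector has
`(x, x) ≥ 2`. -/
theorem two_le_symForm_self {x : Q → ℝ} (hx : IsInt x) (h0 : x ≠ 0) : 2 ≤ symForm Q x x := by
  have hpos : 0 < symForm Q x x :=
    lt_of_le_of_ne (symForm_self_nonneg x) fun h => h0 (eq_zero_of_symForm_self_eq_zero h.symm)
  obtain ⟨n, rfl⟩ := hx
  -- The cross terms occur in equal pairs, because adjacency is symmetric.
  have heven : ∃ m : ℤ, ∑ i, n i * ∑ j, (if (underlyingGraph Q).Adj i j then n j else 0) =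
      2 * m := by
    have e : ∀ i j : Q, n i * (if (underlyingGraph Q).Adj i j then n j else 0) =
        if s(i, j) ∈ (underlyingGraph Q).edgeSet then n i * n j else 0 := by
      intro i j; simp
    have : ∑ i, n i * ∑ j, (if (underlyingGraph Q).Adj i j then n j else 0) =
        ∑ d : (underlyingGraph Q).Dart, n d.fst * n d.snd := by
      simp only [Finset.mul_sum]
      rw [← Finset.sum_product', Finset.univ_product_univ]
      simp only [mul_ite, mul_zero]
      rw [← Finset.sum_filter]
      symm
      refine Finset.sum_bij (fun d _ => d.toProd) ?_ ?_ ?_ ?_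
      · intro d _; simp [d.adj]
      · intro a _ b _ h; exact SimpleGraph.Dart.ext _ _ h
      · intro b hb
        exact ⟨⟨b, (Finset.mem_filter.1 hb).2⟩, Finset.mem_univ _, rfl⟩
      · intro d _; rfl
    rw [this]
    let g : Sym2 Q → ℤ := Sym2.lift ⟨fun a b => n a * n b, fun a b => mul_comm _ _⟩
    have hg : ∀ d : (underlyingGraph Q).Dart, n d.fst * n d.snd = g d.edge := fun d => rfl
    simp only [hg]
    refine ⟨∑ e ∈ (underlyingGraph Q).edgeFinset, g e, ?_⟩
    rw [← Finset.sum_fiberwise_of_maps_to (s := Finset.univ)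
      (t := (underlyingGraph Q).edgeFinset) (g := fun d : (underlyingGraph Q).Dart => d.edge)
      (fun d _ => by simp), Finset.mul_sum]
    refine Finset.sum_congr rfl fun e he => ?_
    rw [Finset.sum_congr rfl (g := fun _ => g e) (fun d hd => by rw [(Finset.mem_filter.1 hd).2]),
      Finset.sum_const, SimpleGraph.dart_edge_fiber_card _ e (by simpa using he)]
    simp
  obtain ⟨m, hm⟩ := heven
  have : symForm Q (fun i => (n i : ℝ)) (fun i => (n i : ℝ)) =
      ((2 * ((∑ i, n i ^ 2) - m) : ℤ) : ℝ) := by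
    rw [symForm_eq_sum]
    have : (2 * ((∑ i, n i ^ 2) - m) : ℤ) =
        ∑ i, n i * (2 * n i - ∑ j, (if (underlyingGraph Q).Adj i j then n j else 0)) := by
      simp only [mul_sub, Finset.sum_sub_distrib, hm]
      rw [Finset.mul_sum]
      congr 1
      exact Finset.sum_congr rfl fun i _ => by ring
    rw [this]
    simp only [symForm_single_left]
    push_cast
    rfl
  rw [this] at hpos ⊢
  have h1 : (0 : ℤ) < 2 * ((∑ i, n i ^ 2) - m) := by exact_mod_cast hpos
  have h2 : (2 : ℤ) ≤ 2 * ((∑ i, n i ^ 2) - m) := by omega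
  exact_mod_cast h2

theorem symForm_nonpos_of_disjoint {x y : Q → ℝ} (hx : ∀ i, 0 ≤ x i) (hy : ∀ i, 0 ≤ y i)
    (h : ∀ i, x i = 0 ∨ y i = 0) : symForm Q x y ≤ 0 := by
  rw [symForm_eq_sum]
  refine Finset.sum_nonpos fun i _ => ?_
  rcases h i with h | h
  · simp [h]
  · exact mul_nonpos_of_nonneg_of_nonpos (hx i) (symForm_single_nonpos i hy h)

/-- Each root is positive or negative: the positive and the negative part of a vector `x` are
at an obtuse angle, so if both were nonzero, then `(x, x) ≥ 4`. -/
theorem IsRoot.mem_or_neg_mem {x : Q → ℝ} (h : IsRoot x) : x ∈ posRoots Q ∨ -x ∈ posRoots Q := by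
  obtain ⟨⟨n, rfl⟩, h2⟩ := h
  let p : Q → ℝ := fun i => ((n i).toNat : ℝ)
  let q : Q → ℝ := fun i => ((-n i).toNat : ℝ)
  have hpq : (fun i => (n i : ℝ)) = p - q := by
    funext i
    have : n i = ((n i).toNat : ℤ) - ((-n i).toNat : ℤ) := by omega
    simp only [p, q, Pi.sub_apply]
    exact_mod_cast this
  have hp : IsNat p := ⟨_, rfl⟩
  have hq : IsNat q := ⟨_, rfl⟩
  have hneg : symForm Q p q ≤ 0 := by
    refine symForm_nonpos_of_disjoint (fun i => by positivity) (fun i => by positivity)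
      fun i => ?_
    have : (n i).toNat = 0 ∨ (-n i).toNat = 0 := by omega
    simpa [p, q] using this
  rw [hpq] at h2 ⊢
  have hexp : symForm Q (p - q) (p - q) = symForm Q p p + symForm Q q q - 2 * symForm Q p q := by
    rw [map_sub, map_sub, LinearMap.sub_apply, LinearMap.sub_apply, symForm_comm q p]
    ring
  by_cases h0 : q = 0
  · left
    rw [h0, sub_zero] at h2 ⊢
    exact ⟨hp, h2⟩
  by_cases h1 : p = 0
  · right
    rw [h1] at h2 ⊢
    rw [zero_sub] at h2 ⊢
    rw [neg_neg]
    refine ⟨hq, ?_⟩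
    simpa using h2
  · have := two_le_symForm_self hp.isInt h1
    have := two_le_symForm_self hq.isInt h0
    linarith

theorem IsRoot.not_both {x : Q → ℝ} (h : IsRoot x) : x ∉ posRoots Q ↔ -x ∈ posRoots Q :=
  ⟨h.mem_or_neg_mem.resolve_left, fun h1 h2 => neg_notMem_posRoots h2 h1⟩

theorem finite_isNat_symForm (r : ℝ) : {x : Q → ℝ | IsNat x ∧ symForm Q x x = r}.Finite := by
  obtain ⟨d, hd, h⟩ := exists_pos_mul_sum_sq_le_symForm Q
  obtain ⟨N, hN⟩ := exists_nat_ge (r / d)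
  refine ((Set.finite_Iic (fun _ : Q => N)).image fun (n : Q → ℕ) i => (n i : ℝ)).subset ?_
  rintro x ⟨⟨n, rfl⟩, hx⟩
  refine ⟨n, fun i => ?_, rfl⟩
  have h1 := h (fun i => (n i : ℝ)) i
  rw [hx, mul_comm, ← le_div_iff₀ hd] at h1
  have h2 : (n i ^ 2 : ℝ) ≤ N := h1.trans hN
  have h3 : n i ^ 2 ≤ N := by exact_mod_cast h2
  exact (Nat.le_self_pow two_ne_zero _).trans h3

variable (Q) in
theorem finite_posRoots : (posRoots Q).Finite :=
  finite_isNat_symForm 2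

/-! ### Simple reflections -/

theorem simpleReflection_apply (i : Q) (x : Q → ℝ) :
    simpleReflection i x = x - symForm Q (ε i) x • ε i :=
  Module.reflection_apply _ _

theorem simpleReflection_mul_self (i : Q) : simpleReflection i * simpleReflection i = 1 :=
  LinearEquiv.ext fun x => Module.involutive_reflection (symForm_single i) x

theorem simpleReflection_inv (i : Q) : (simpleReflection i)⁻¹ = simpleReflection i :=
  inv_eq_of_mul_eq_one_left (simpleReflection_mul_self i)

@[simp] theorem simpleReflection_simpleReflection (i : Q) (x : Q → ℝ) :
    simpleReflection i (simpleReflection i x) = x :=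
  LinearEquiv.congr_fun (simpleReflection_mul_self i) x

theorem simpleReflection_single (i : Q) : simpleReflection i (ε i) = -ε i := by
  rw [simpleReflection_apply, symForm_single, two_smul]
  abel

theorem simpleReflection_apply_of_ne {i j : Q} (h : j ≠ i) (x : Q → ℝ) :
    simpleReflection i x j = x j := by
  simp [simpleReflection_apply, Pi.single_eq_of_ne h]

theorem simpleReflection_apply_self (i : Q) (x : Q → ℝ) :
    simpleReflection i x i = x i - symForm Q (ε i) x := by
  simp [simpleReflection_apply]

theorem symForm_simpleReflection (i : Q) (x y : Q → ℝ) :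
    symForm Q (simpleReflection i x) (simpleReflection i y) = symForm Q x y := by
  simp only [simpleReflection_apply, map_sub, map_smul, LinearMap.sub_apply, LinearMap.smul_apply,
    smul_eq_mul, symForm_single, symForm_comm x (ε i)]
  ring

theorem isInt_simpleReflection (i : Q) {x : Q → ℝ} (hx : IsInt x) :
    IsInt (simpleReflection i x) := by
  obtain ⟨m, hm⟩ := exists_int_symForm_single hx i
  obtain ⟨n, rfl⟩ := hx
  refine ⟨fun j => n j - m * (Pi.single i 1 : Q → ℤ) j, ?_⟩
  rw [simpleReflection_apply, hm]
  funext j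
  by_cases h : j = i
  · subst h; simp
  · simp [Pi.single_eq_of_ne h]

theorem IsRoot.simpleReflection (i : Q) {x : Q → ℝ} (hx : IsRoot x) :
    IsRoot (simpleReflection i x) :=
  ⟨isInt_simpleReflection i hx.1, by rw [symForm_simpleReflection, hx.2]⟩

/-- The only positive root supported at `i` is `e_i`. -/
theorem eq_single_of_mem_posRoots {i : Q} {x : Q → ℝ} (hx : x ∈ posRoots Q)
    (h : ∀ j, j ≠ i → x j = 0) : x = ε i := by
  have hx' : x = x i • ε i := by
    funext j
    by_cases hj : j = i
    · subst hj; simp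
    · simp [h j hj, Pi.single_eq_of_ne hj]
  have h2 := hx.2
  rw [hx', map_smul, map_smul, LinearMap.smul_apply, symForm_single, smul_eq_mul, smul_eq_mul] at h2
  have h3 := posRoots_nonneg hx i
  have : x i = 1 := by nlinarith
  rw [hx', this, one_smul]

/-- A simple reflection permutes the positive roots other than its own. -/
theorem simpleReflection_mem_posRoots {i : Q} {x : Q → ℝ} (hx : x ∈ posRoots Q) (h : x ≠ ε i) :
    simpleReflection i x ∈ posRoots Q := by
  by_contra hn
  have h1 := ((isRoot_of_mem_posRoots hx).simpleReflection i).not_both.1 hn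
  refine h (eq_single_of_mem_posRoots hx fun j hj => ?_)
  have h2 := posRoots_nonneg h1 j
  rw [Pi.neg_apply, simpleReflection_apply_of_ne hj] at h2
  exact le_antisymm (by linarith) (posRoots_nonneg hx j)

theorem simpleReflection_mem_posRoots_iff {i : Q} {x : Q → ℝ} (h : x ≠ ε i) (h' : x ≠ -ε i) :
    simpleReflection i x ∈ posRoots Q ↔ x ∈ posRoots Q := by
  refine ⟨fun hx => ?_, fun hx => simpleReflection_mem_posRoots hx h⟩
  rw [← simpleReflection_simpleReflection i x]
  refine simpleReflection_mem_posRoots hx fun h2 => h' ?_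
  rw [← simpleReflection_simpleReflection i x, h2, simpleReflection_single]

theorem simpleReflection_commute {i j : Q} (h : ¬(underlyingGraph Q).Adj i j) :
    Commute (simpleReflection i) (simpleReflection j) := by
  by_cases hij : i = j
  · subst hij; exact Commute.refl _
  classical
  have h0 : symForm Q (ε i) (ε j) = 0 := by
    rw [symForm_single_left, Pi.single_eq_of_ne hij, Finset.sum_eq_zero]
    · simp
    · intro b _
      split_ifs with hb
      · rw [Pi.single_eq_of_ne]
        rintro rfl
        exact h hb
      · rfl
  have h1 : symForm Q (ε j) (ε i) = 0 := by rw [symForm_comm, h0]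
  refine LinearEquiv.ext fun x => ?_
  have e : ∀ (a b : Q), symForm Q (ε a) (ε b) = 0 →
      (simpleReflection a * simpleReflection b) x =
        x - symForm Q (ε b) x • ε b - symForm Q (ε a) x • ε a := by
    intro a b hab
    rw [LinearEquiv.mul_apply, simpleReflection_apply b, simpleReflection_apply a, map_sub,
      map_smul, hab, smul_zero, sub_zero]
  rw [e i j h0, e j i h1]
  abel

end Roots

/-! ### Inversion sets and length -/

section Weyl

variable {Q : Type v} [Quiver.{w} Q] [Fintype Q] [DecidableEq Q]

local notation "ε" i:max => (Pi.single i (1 : ℝ) : _ → ℝ)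

theorem mem_inversionSet {w : (Q → ℝ) ≃ₗ[ℝ] (Q → ℝ)} {x : Q → ℝ} :
    x ∈ inversionSet w ↔ x ∈ posRoots Q ∧ -(w⁻¹ x) ∈ posRoots Q :=
  Iff.rfl

theorem inversionSet_one : inversionSet (1 : (Q → ℝ) ≃ₗ[ℝ] (Q → ℝ)) = ∅ :=
  Set.eq_empty_of_forall_notMem fun _ hx => neg_notMem_posRoots hx.1 hx.2

variable [IsSimplyLacedDynkin Q]

@[simp] theorem wordProd_nil : wordProd ([] : List Q) = 1 := rfl

@[simp] theorem wordProd_cons (i : Q) (l : List Q) :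
    wordProd (i :: l) = simpleReflection i * wordProd l := by
  simp [wordProd]

theorem wordProd_append (l m : List Q) : wordProd (l ++ m) = wordProd l * wordProd m := by
  simp [wordProd]

theorem wordProd_inv (l : List Q) : (wordProd l)⁻¹ = wordProd l.reverse := by
  induction l with
  | nil => simp
  | cons i l ih => simp [wordProd_append, ih, mul_inv_rev, simpleReflection_inv]

theorem symForm_wordProd (l : List Q) (x y : Q → ℝ) :
    symForm Q (wordProd l x) (wordProd l y) = symForm Q x y := by
  induction l with
  | nil => rfl
  | cons i l ih =>
    rw [wordProd_cons, LinearEquiv.mul_apply, LinearEquiv.mul_apply, symForm_simpleReflection, ih]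

theorem IsRoot.wordProd (l : List Q) {x : Q → ℝ} (hx : IsRoot x) :
    IsRoot (wordProd l x) := by
  induction l with
  | nil => exact hx
  | cons i l ih =>
    rw [wordProd_cons, LinearEquiv.mul_apply]
    exact ih.simpleReflection i

theorem IsRoot.wordProd_inv (l : List Q) {x : Q → ℝ} (hx : IsRoot x) :
    IsRoot ((DynkinQuiver.wordProd l)⁻¹ x) := by
  rw [DynkinQuiver.wordProd_inv]
  exact hx.wordProd _

theorem wordProd_apply_of_notMem {l : List Q} {i : Q} (h : i ∉ l) (x : Q → ℝ) :
    wordProd l x i = x i := by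
  induction l with
  | nil => rfl
  | cons j l ih =>
    rw [List.mem_cons, not_or] at h
    rw [wordProd_cons, LinearEquiv.mul_apply, simpleReflection_apply_of_ne h.1, ih h.2]

theorem wordProd_inv_apply_of_notMem {l : List Q} {i : Q} (h : i ∉ l) (x : Q → ℝ) :
    (wordProd l)⁻¹ x i = x i := by
  rw [wordProd_inv, wordProd_apply_of_notMem (by simpa using h)]

/-- A product of distinct simple reflections fixes only the vectors that all its factors fix:
each factor changes just its own coordinate. -/
theorem symForm_single_eq_zero_of_wordProd_inv_fixed {l : List Q} (hl : l.Nodup) {x : Q → ℝ}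
    (h : (wordProd l)⁻¹ x = x) : ∀ i ∈ l, symForm Q (ε i) x = 0 := by
  induction l with
  | nil => simp
  | cons i l ih =>
    rw [List.nodup_cons] at hl
    have h1 : symForm Q (ε i) x = 0 := by
      have h2 := congr_fun h i
      rw [wordProd_cons, mul_inv_rev, simpleReflection_inv, LinearEquiv.mul_apply,
        wordProd_inv_apply_of_notMem hl.1, simpleReflection_apply_self] at h2
      linarith
    have h2 : simpleReflection i x = x := by
      rw [simpleReflection_apply, h1, zero_smul, sub_zero]
    rw [wordProd_cons, mul_inv_rev, simpleReflection_inv, LinearEquiv.mul_apply, h2] at h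
    intro j hj
    rcases List.mem_cons.1 hj with rfl | hj
    · exact h1
    · exact ih hl.2 h j hj

/-- A vector supported on the letters of a Coxeter element, and fixed by it, is zero. -/
theorem eq_zero_of_wordProd_inv_fixed {l : List Q} (hl : l.Nodup) {x : Q → ℝ}
    (hx : ∀ i, i ∉ l → x i = 0) (h : (wordProd l)⁻¹ x = x) : x = 0 := by
  refine eq_zero_of_symForm_self_eq_zero ?_
  rw [symForm_eq_sum]
  refine Finset.sum_eq_zero fun i _ => ?_
  by_cases hi : i ∈ l
  · rw [symForm_single_eq_zero_of_wordProd_inv_fixed hl h i hi, mul_zero]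
  · rw [hx i hi, zero_mul]

theorem symForm_wordProd_inv_pow (l : List Q) (n : ℕ) (x : Q → ℝ) :
    symForm Q (((wordProd l)⁻¹ ^ n) x) (((wordProd l)⁻¹ ^ n) x) = symForm Q x x := by
  induction n with
  | zero => rfl
  | succ n ih => rw [pow_succ', LinearEquiv.mul_apply, wordProd_inv, symForm_wordProd,
      ← wordProd_inv, ih]

/-- The powers of a Coxeter element cannot keep a nonzero vector in the positive orthant: the orbit
is finite, and the sum over a period would be a nonzero fixed vector. -/
theorem exists_wordProd_inv_pow_not_isNat {l : List Q} (hl : l.Nodup) {x : Q → ℝ}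
    (hx : ∀ i, i ∉ l → x i = 0) (h0 : x ≠ 0) : ∃ n : ℕ, ¬ IsNat (((wordProd l)⁻¹ ^ n) x) := by
  by_contra! h
  set c := (wordProd l)⁻¹ with hc
  obtain ⟨a, b, hab, he⟩ : ∃ a b : ℕ, a < b ∧ (c ^ a) x = (c ^ b) x := by
    obtain ⟨a, -, b, -, hne, he⟩ := Set.infinite_univ.exists_ne_map_eq_of_mapsTo
      (f := fun n : ℕ => (c ^ n) x) (t := {y | IsNat y ∧ symForm Q y y = symForm Q x x})
      (fun n _ => ⟨h n, symForm_wordProd_inv_pow l n x⟩) (finite_isNat_symForm _)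
    rcases lt_or_gt_of_ne hne with h | h
    · exact ⟨a, b, h, he⟩
    · exact ⟨b, a, h, he.symm⟩
  have hper : (c ^ (b - a)) x = x := by
    have : (c ^ b) x = (c ^ a) ((c ^ (b - a)) x) := by
      rw [← LinearEquiv.mul_apply, ← pow_add, Nat.add_sub_cancel' hab.le]
    rw [this] at he
    exact ((c ^ a).injective he).symm
  have hfix :
      c (∑ n ∈ Finset.range (b - a), (c ^ n) x) = ∑ n ∈ Finset.range (b - a), (c ^ n) x := by
    rw [map_sum]
    have e : ∀ n, c ((c ^ n) x) = (c ^ (n + 1)) x := fun n => by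
      rw [pow_succ', LinearEquiv.mul_apply]
    simp only [e]
    have h1 := Finset.sum_range_succ (fun n => (c ^ n) x) (b - a)
    have h2 := Finset.sum_range_succ' (fun n => (c ^ n) x) (b - a)
    rw [h1, hper, pow_zero] at h2
    exact (add_right_cancel h2).symm
  have hsupp : ∀ n : ℕ, ∀ i, i ∉ l → (c ^ n) x i = 0 := by
    intro n i hi
    induction n with
    | zero => exact hx i hi
    | succ n ih => rw [pow_succ', LinearEquiv.mul_apply, hc, wordProd_inv_apply_of_notMem hi, ← hc,
        ih]
  have hz := eq_zero_of_wordProd_inv_fixed hl (x := ∑ n ∈ Finset.range (b - a), (c ^ n) x)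
    (fun i hi => by rw [Finset.sum_apply]; exact Finset.sum_eq_zero fun n _ => hsupp n i hi) hfix
  have nn : ∀ n i, 0 ≤ (c ^ n) x i := fun n i => by
    obtain ⟨m, hm⟩ := h n
    rw [hm]; positivity
  refine h0 (funext fun i => ?_)
  have hi := congr_fun hz i
  rw [Finset.sum_apply, Pi.zero_apply, Finset.sum_eq_zero_iff_of_nonneg fun n _ => nn n i] at hi
  exact hi 0 (Finset.mem_range.2 (by omega))

theorem mem_inversionSet_mul_iff {i : Q} {w : (Q → ℝ) ≃ₗ[ℝ] (Q → ℝ)} {x : Q → ℝ} (h : x ≠ ε i)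
    (h' : x ≠ -ε i) :
    x ∈ inversionSet (simpleReflection i * w) ↔ simpleReflection i x ∈ inversionSet w := by
  rw [mem_inversionSet, mem_inversionSet, mul_inv_rev, simpleReflection_inv, LinearEquiv.mul_apply,
    simpleReflection_mem_posRoots_iff h h']

theorem single_ne_neg {i : Q} {x : Q → ℝ} (hx : x ∈ posRoots Q) : x ≠ -ε i := by
  rintro rfl
  exact neg_notMem_posRoots (single_mem_posRoots i) hx

theorem single_mem_inversionSet_mul_iff (i : Q) (l : List Q) :
    ε i ∈ inversionSet (simpleReflection i * wordProd l) ↔ ε i ∉ inversionSet (wordProd l) := by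
  have hr : IsRoot ((wordProd l)⁻¹ (ε i)) :=
    (isRoot_of_mem_posRoots (single_mem_posRoots i)).wordProd_inv l
  rw [mem_inversionSet, mem_inversionSet, mul_inv_rev, simpleReflection_inv, LinearEquiv.mul_apply,
    simpleReflection_single, map_neg, neg_neg, ← hr.not_both]
  have := single_mem_posRoots i
  tauto

/-- Left multiplication by a simple reflection that is not an inversion adds one inversion. -/
theorem inversionSet_mul_of_notMem {i : Q} {l : List Q} (h : ε i ∉ inversionSet (wordProd l)) :
    inversionSet (simpleReflection i * wordProd l) =
      insert (ε i) (simpleReflection i '' inversionSet (wordProd l)) := by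
  ext x
  rw [Set.mem_insert_iff]
  by_cases hx : x = ε i
  · subst hx
    simp [single_mem_inversionSet_mul_iff, h]
  · rw [or_iff_right hx]
    constructor
    · intro hm
      rw [mem_inversionSet_mul_iff hx (single_ne_neg hm.1)] at hm
      exact ⟨_, hm, simpleReflection_simpleReflection i x⟩
    · rintro ⟨y, hy, rfl⟩
      rw [mem_inversionSet_mul_iff hx, simpleReflection_simpleReflection]
      · exact hy
      · intro h2
        rw [← simpleReflection_single, (simpleReflection i).injective.eq_iff] at h2
        exact h (h2 ▸ hy)

theorem finite_inversionSet (w : (Q → ℝ) ≃ₗ[ℝ] (Q → ℝ)) : (inversionSet w).Finite :=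
  (finite_posRoots Q).subset fun _ h => h.1

theorem ncard_inversionSet_mul_of_notMem {i : Q} {l : List Q}
    (h : ε i ∉ inversionSet (wordProd l)) :
    (inversionSet (simpleReflection i * wordProd l)).ncard =
      (inversionSet (wordProd l)).ncard + 1 := by
  rw [inversionSet_mul_of_notMem h, Set.ncard_insert_of_notMem _ ((finite_inversionSet _).image _),
    Set.ncard_image_of_injective _ (simpleReflection i).injective]
  rintro ⟨y, hy, h2⟩
  rw [← simpleReflection_simpleReflection i (ε i), (simpleReflection i).injective.eq_iff,
    simpleReflection_single] at h2
  exact single_ne_neg hy.1 h2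

theorem ncard_inversionSet_mul_of_mem {i : Q} {l : List Q} (h : ε i ∈ inversionSet (wordProd l)) :
    (inversionSet (simpleReflection i * wordProd l)).ncard + 1 =
      (inversionSet (wordProd l)).ncard := by
  have h1 : ε i ∉ inversionSet (wordProd (i :: l)) := by
    rw [wordProd_cons, single_mem_inversionSet_mul_iff]
    exact not_not.2 h
  have h2 := ncard_inversionSet_mul_of_notMem h1
  rw [wordProd_cons, ← mul_assoc, simpleReflection_mul_self, one_mul] at h2
  exact h2.symm

/-- If the inverse of a word makes a positive root negative, then some prefix of the word carries
that root to the simple root of the next letter. -/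
theorem exists_prefix_of_neg_mem {l : List Q} {x : Q → ℝ} (hx : x ∈ posRoots Q)
    (h : -((wordProd l)⁻¹ x) ∈ posRoots Q) :
    ∃ a j b, l = a ++ j :: b ∧ (wordProd a)⁻¹ x = ε j := by
  induction l generalizing x with
  | nil => exact absurd h (neg_notMem_posRoots hx)
  | cons j l ih =>
    by_cases hj : x = ε j
    · exact ⟨[], j, l, rfl, by simp [hj]⟩
    · rw [wordProd_cons, mul_inv_rev, simpleReflection_inv, LinearEquiv.mul_apply] at h
      obtain ⟨a, m, b, rfl, h2⟩ := ih (simpleReflection_mem_posRoots hx hj) h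
      refine ⟨j :: a, m, b, rfl, ?_⟩
      rw [wordProd_cons, mul_inv_rev, simpleReflection_inv, LinearEquiv.mul_apply, h2]

theorem simpleReflection_mul_wordProd {i j : Q} {a : List Q} (h : (wordProd a)⁻¹ (ε i) = ε j) :
    simpleReflection i * wordProd a = wordProd a * simpleReflection j := by
  have h' : ε i = wordProd a (ε j) := by
    rw [← h, ← LinearEquiv.mul_apply, mul_inv_cancel]; rfl
  refine LinearEquiv.ext fun x => ?_
  rw [LinearEquiv.mul_apply, LinearEquiv.mul_apply, simpleReflection_apply, simpleReflection_apply,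
    map_sub, map_smul, ← h', h', symForm_wordProd]

/-- The exchange condition. -/
theorem exchange {l : List Q} {i : Q} (h : ε i ∈ inversionSet (wordProd l)) :
    ∃ a j b, l = a ++ j :: b ∧ simpleReflection i * wordProd l = wordProd (a ++ b) := by
  obtain ⟨a, j, b, rfl, h2⟩ := exists_prefix_of_neg_mem h.1 h.2
  refine ⟨a, j, b, rfl, ?_⟩
  rw [wordProd_append, wordProd_cons, ← mul_assoc, simpleReflection_mul_wordProd h2, mul_assoc,
    ← mul_assoc (simpleReflection j), simpleReflection_mul_self, one_mul, wordProd_append]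

/-- If left multiplication by a letter removes an inversion, the exchange condition provides a word
for the product that is shorter by one. -/
theorem exists_reduced_word (l : List Q) :
    ∃ m : List Q, wordProd m = wordProd l ∧ m.length = (inversionSet (wordProd l)).ncard := by
  induction l with
  | nil => exact ⟨[], rfl, by simp [inversionSet_one]⟩
  | cons i l ih =>
    obtain ⟨m, hm, hlen⟩ := ih
    by_cases h : ε i ∈ inversionSet (wordProd l)
    · obtain ⟨a, j, b, rfl, h2⟩ := exchange (hm ▸ h)
      refine ⟨a ++ b, by rw [wordProd_cons, ← hm, h2], ?_⟩
      have := ncard_inversionSet_mul_of_mem h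
      rw [wordProd_cons]
      simp only [List.length_append, List.length_cons] at hlen ⊢
      omega
    · refine ⟨i :: m, by rw [wordProd_cons, wordProd_cons, hm], ?_⟩
      rw [wordProd_cons, ncard_inversionSet_mul_of_notMem h, List.length_cons, hlen]

theorem ncard_inversionSet_wordProd_le (l : List Q) :
    (inversionSet (wordProd l)).ncard ≤ l.length := by
  induction l with
  | nil => simp [inversionSet_one]
  | cons i l ih =>
    rw [wordProd_cons, List.length_cons]
    by_cases h : ε i ∈ inversionSet (wordProd l)
    · have := ncard_inversionSet_mul_of_mem h
      omega
    · rw [ncard_inversionSet_mul_of_notMem h]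
      omega

/-- The length of a product of simple reflections is its number of inversions. -/
theorem length_wordProd (l : List Q) :
    length (wordProd l) = (inversionSet (wordProd l)).ncard := by
  obtain ⟨m, hm, hlen⟩ := exists_reduced_word l
  refine le_antisymm (Nat.sInf_le ⟨m, hm, hlen⟩) ?_
  refine le_csInf ⟨_, m, hm, rfl⟩ ?_
  rintro n ⟨l', h, rfl⟩
  rw [← h]
  exact ncard_inversionSet_wordProd_le l'

theorem length_lt_length_mul_iff (i : Q) (l : List Q) :
    length (wordProd l) < length (simpleReflection i * wordProd l) ↔
      ε i ∉ inversionSet (wordProd l) := by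
  rw [← wordProd_cons, length_wordProd, length_wordProd, wordProd_cons]
  by_cases h : ε i ∈ inversionSet (wordProd l)
  · have := ncard_inversionSet_mul_of_mem h
    simp only [h, not_true, iff_false]; omega
  · have := ncard_inversionSet_mul_of_notMem h
    simp only [h, not_false_iff, iff_true]; omega

theorem length_mul_lt_length_iff (i : Q) (l : List Q) :
    length (simpleReflection i * wordProd l) < length (wordProd l) ↔
      ε i ∈ inversionSet (wordProd l) := by
  rw [← wordProd_cons, length_wordProd, length_wordProd, wordProd_cons]
  by_cases h : ε i ∈ inversionSet (wordProd l)
  · have := ncard_inversionSet_mul_of_mem h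
    simp only [h, iff_true]; omega
  · have := ncard_inversionSet_mul_of_notMem h
    simp only [h, iff_false]; omega

theorem eq_one_of_inversionSet_eq_empty {l : List Q} (h : inversionSet (wordProd l) = ∅) :
    wordProd l = 1 := by
  obtain ⟨m, hm, hlen⟩ := exists_reduced_word l
  rw [h, Set.ncard_empty, List.length_eq_zero_iff] at hlen
  rw [← hm, hlen, wordProd_nil]

/-- A product of simple reflections that is not the identity has a simple inversion. -/
theorem exists_single_mem_inversionSet {l : List Q} (h : inversionSet (wordProd l) ≠ ∅) :
    ∃ i, ε i ∈ inversionSet (wordProd l) := by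
  obtain ⟨m, hm, hlen⟩ := exists_reduced_word l
  rw [← hm] at h hlen ⊢
  cases m with
  | nil => exact absurd inversionSet_one h
  | cons i m =>
    refine ⟨i, ?_⟩
    rw [wordProd_cons, single_mem_inversionSet_mul_iff]
    intro hc
    have h1 := ncard_inversionSet_mul_of_mem hc
    have h2 := ncard_inversionSet_wordProd_le m
    rw [wordProd_cons, List.length_cons] at hlen
    omega

/-- Left multiplication by a simple reflection that is an inversion removes this inversion. -/
theorem inversionSet_mul_eq {i : Q} {l : List Q} (h : ε i ∈ inversionSet (wordProd l)) :
    inversionSet (simpleReflection i * wordProd l) =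
      simpleReflection i '' (inversionSet (wordProd l) \ {ε i}) := by
  ext x
  by_cases hx : x = ε i
  · subst hx
    rw [single_mem_inversionSet_mul_iff]
    simp only [h, not_true, false_iff]
    rintro ⟨y, hy, h2⟩
    rw [← simpleReflection_simpleReflection i (ε i), (simpleReflection i).injective.eq_iff,
      simpleReflection_single] at h2
    exact single_ne_neg hy.1.1 h2
  · constructor
    · intro hm
      have hm' := (mem_inversionSet_mul_iff hx (single_ne_neg hm.1)).1 hm
      refine ⟨_, ⟨hm', fun h2 => ?_⟩, simpleReflection_simpleReflection i x⟩
      rw [Set.mem_singleton_iff] at h2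
      rw [← simpleReflection_simpleReflection i x, h2, simpleReflection_single] at hm
      exact neg_notMem_posRoots (single_mem_posRoots i) hm.1
    · rintro ⟨y, hy, rfl⟩
      rw [mem_inversionSet_mul_iff hx, simpleReflection_simpleReflection]
      · exact hy.1
      · intro h2
        rw [← simpleReflection_single, (simpleReflection i).injective.eq_iff] at h2
        exact hy.2 h2

/-- An element of the Weyl group is determined by its inversion set. -/
theorem wordProd_eq_of_inversionSet_eq {l m : List Q}
    (h : inversionSet (wordProd l) = inversionSet (wordProd m)) : wordProd l = wordProd m := by
  induction hn : (inversionSet (wordProd l)).ncard generalizing l m with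
  | zero =>
    rw [Set.ncard_eq_zero (finite_inversionSet _)] at hn
    rw [eq_one_of_inversionSet_eq_empty hn, eq_one_of_inversionSet_eq_empty (h ▸ hn)]
  | succ n ih =>
    obtain ⟨i, hi⟩ := exists_single_mem_inversionSet (l := l) (fun h0 => by simp [h0] at hn)
    have h1 := inversionSet_mul_eq hi
    have h2 := inversionSet_mul_eq (h ▸ hi)
    have h3 := ncard_inversionSet_mul_of_mem hi
    rw [← wordProd_cons] at h1 h2 h3
    have := ih (l := i :: l) (m := i :: m) (by rw [h1, h2, h]) (by omega)
    rw [wordProd_cons, wordProd_cons] at this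
    exact mul_left_cancel this

/-! ### The Weyl group is generated by the simple reflections -/

theorem symForm_reflection_conj {x y : Q → ℝ} (hx : symForm Q x x = 2) (hy : symForm Q y y = 2)
    (i : Q) (h : y = simpleReflection i x) :
    Module.reflection (f := symForm Q y) hy =
      simpleReflection i * Module.reflection (f := symForm Q x) hx * simpleReflection i := by
  subst h
  refine LinearEquiv.ext fun z => ?_
  rw [LinearEquiv.mul_apply, LinearEquiv.mul_apply, Module.reflection_apply,
    Module.reflection_apply, map_sub, map_smul, simpleReflection_simpleReflection,
    ← symForm_simpleReflection i (simpleReflection i x), simpleReflection_simpleReflection]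

/-- A reflection in a positive root `x` is a product of simple reflections. As `(x, x) > 0`, some
simple root has `(e_i, x) > 0`; if `x ≠ e_i`, then `s_i x` is a smaller positive root. -/
theorem exists_wordProd_eq_reflection {x : Q → ℝ} (hx : x ∈ posRoots Q) :
    ∃ l, wordProd l = Module.reflection (f := symForm Q x) hx.2 := by
  obtain ⟨n, hn⟩ := hx.1
  induction hs : ∑ i, n i using Nat.strong_induction_on generalizing n x with
  | _ s ih =>
    obtain ⟨i, hi⟩ : ∃ i, 0 < symForm Q (ε i) x := by
      by_contra! h
      have h1 : symForm Q x x ≤ 0 := by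
        rw [symForm_eq_sum]
        exact Finset.sum_nonpos fun i _ =>
          mul_nonpos_of_nonneg_of_nonpos (posRoots_nonneg hx i) (h i)
      have := hx.2
      linarith
    by_cases hxi : x = ε i
    · subst hxi
      exact ⟨[i], by simp [simpleReflection]⟩
    · have hy := simpleReflection_mem_posRoots hx hxi
      obtain ⟨m, hm⟩ := hy.1
      have hlt : ∑ j, m j < s := by
        rw [← hs]
        refine Finset.sum_lt_sum (fun j _ => ?_) ⟨i, Finset.mem_univ _, ?_⟩
        · have h1 := congr_fun hm j
          by_cases hj : j = i
          · subst hj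
            rw [simpleReflection_apply_self, hn] at h1
            have : (m j : ℝ) ≤ n j := by rw [hn] at hi; linarith
            exact_mod_cast this
          · rw [simpleReflection_apply_of_ne hj, hn] at h1
            have : (m j : ℝ) = n j := h1.symm
            exact le_of_eq (by exact_mod_cast this)
        · have h1 := congr_fun hm i
          rw [simpleReflection_apply_self, hn] at h1
          have : (m i : ℝ) < n i := by rw [hn] at hi; linarith
          exact_mod_cast this
      obtain ⟨l, hl⟩ := ih _ hlt hy m hm rfl
      refine ⟨i :: (l ++ [i]), ?_⟩
      rw [wordProd_cons, wordProd_append, hl, wordProd_cons, wordProd_nil, mul_one,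
        symForm_reflection_conj hy.2 hx.2 i (simpleReflection_simpleReflection i x).symm, mul_assoc]

theorem wordProd_mem_weylGroup (l : List Q) : wordProd l ∈ weylGroup Q := by
  refine Subgroup.list_prod_mem _ fun g hg => ?_
  obtain ⟨i, _, rfl⟩ := List.mem_map.1 hg
  exact Subgroup.subset_closure ⟨_, single_mem_posRoots i, rfl⟩

theorem mem_weylGroup_iff {g : (Q → ℝ) ≃ₗ[ℝ] (Q → ℝ)} :
    g ∈ weylGroup Q ↔ ∃ l, wordProd l = g := by
  constructor
  · intro h
    induction h using Subgroup.closure_induction with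
    | mem x hx =>
      obtain ⟨y, hy, rfl⟩ := hx
      exact exists_wordProd_eq_reflection hy
    | one => exact ⟨[], rfl⟩
    | mul x y _ _ hx hy =>
      obtain ⟨l, rfl⟩ := hx
      obtain ⟨m, rfl⟩ := hy
      exact ⟨l ++ m, wordProd_append l m⟩
    | inv x _ hx =>
      obtain ⟨l, rfl⟩ := hx
      exact ⟨l.reverse, (wordProd_inv l).symm⟩
  · rintro ⟨l, rfl⟩
    exact wordProd_mem_weylGroup l

/-! ### Coxeter elements -/

theorem length_wordProd_of_nodup {l : List Q} (hl : l.Nodup) :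
    length (wordProd l) = l.length := by
  rw [length_wordProd]
  induction l with
  | nil => simp [inversionSet_one]
  | cons i l ih =>
    rw [List.nodup_cons] at hl
    rw [wordProd_cons, ncard_inversionSet_mul_of_notMem, ih hl.2, List.length_cons]
    intro h
    have h1 := posRoots_nonneg h.2 i
    rw [Pi.neg_apply, wordProd_inv_apply_of_notMem hl.1, Pi.single_eq_same] at h1
    linarith

theorem isInitial_wordProd_cons {i : Q} {l : List Q} (hl : (i :: l).Nodup) :
    IsInitial i (wordProd (i :: l)) :=
  ⟨l, rfl, length_wordProd_of_nodup hl⟩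

/-- An initial letter of a Coxeter element is not adjacent to any of the letters before it in a word
for this element, so it can be moved to the front of that word. -/
theorem IsInitial.exists_eq_append {i : Q} {l : List Q} (hl : l.Nodup)
    (h : IsInitial i (wordProd l)) :
    ∃ a b, l = a ++ i :: b ∧ ∀ j ∈ a, ¬ (underlyingGraph Q).Adj i j := by
  obtain ⟨m, hm, hlen⟩ := h
  have hi : ε i ∈ inversionSet (wordProd l) := by
    rw [← length_mul_lt_length_iff]
    have : simpleReflection i * wordProd l = wordProd m := by
      rw [← hm, wordProd_cons, ← mul_assoc, simpleReflection_mul_self, one_mul]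
    rw [this, hlen, List.length_cons, length_wordProd]
    exact Nat.lt_succ_of_le (ncard_inversionSet_wordProd_le m)
  obtain ⟨a, j, b, rfl, h2⟩ := exists_prefix_of_neg_mem hi.1 hi.2
  have hnd := List.nodup_append.1 hl
  have hja : j ∉ a := fun hj => hnd.2.2 j hj j (by simp) rfl
  have hij : j = i := by
    by_contra hne
    have h3 := congr_fun h2 j
    rw [wordProd_inv_apply_of_notMem hja, Pi.single_eq_same, Pi.single_eq_of_ne hne] at h3
    exact zero_ne_one h3
  subst hij
  refine ⟨a, b, rfl, fun m hm hadj => ?_⟩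
  have h3 := symForm_single_eq_zero_of_wordProd_inv_fixed hnd.1 h2 m hm
  rw [symForm_single_single_of_adj hadj.symm] at h3
  norm_num at h3

theorem wordProd_append_cons_comm {i : Q} {a b : List Q}
    (h : ∀ j ∈ a, ¬ (underlyingGraph Q).Adj i j) :
    wordProd (a ++ i :: b) = wordProd (i :: (a ++ b)) := by
  have hc : Commute (simpleReflection i) (wordProd a) := by
    refine Commute.list_prod_right _ _ fun x hx => ?_
    obtain ⟨j, hj, rfl⟩ := List.mem_map.1 hx
    exact simpleReflection_commute (h j hj)
  rw [wordProd_append, wordProd_cons, wordProd_cons, wordProd_append, ← mul_assoc, ← mul_assoc,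
    hc.eq]

end Weyl

/-! ### Representations as families of linear maps -/

/-- A family of finite dimensional vector spaces indexed by the vertices, with a linear map for each
ordered pair of vertices. A representation of an orientation `E` is such a family in which the maps
of the pairs that are not arrows vanish (`IsRep`); so the vertices, and the type of the objects,
stay the same when the orientation is changed. -/
structure GRep (k : Type u) [Field k] (V : Type v) where
  /-- the spaces -/
  X : V → Type u
  [acg : ∀ a, AddCommGroup (X a)]
  [mod : ∀ a, Module k (X a)]
  [fin : ∀ a, Module.Finite k (X a)]
  /-- the maps -/
  f : ∀ a b, X a →ₗ[k] X b

attribute [instance] GRep.acg GRep.mod GRep.fin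

namespace GRep

variable {k : Type u} [Field k] {V : Type v}

/-- Morphisms of families: linear maps at the vertices that commute with the structure maps. -/
structure Hom (M N : GRep k V) where
  /-- the components -/
  φ : ∀ a, M.X a →ₗ[k] N.X a
  comm : ∀ a b x, φ b (M.f a b x) = N.f a b (φ a x)

/-- The identity morphism. -/
def Hom.id (M : GRep k V) : Hom M M := ⟨fun _ => LinearMap.id, fun _ _ _ => rfl⟩

/-- The composition of morphisms, first `F` and then `G`. -/
def Hom.comp {M N L : GRep k V} (F : Hom M N) (G : Hom N L) : Hom M L :=
  ⟨fun a => (G.φ a).comp (F.φ a), fun a b x => by simp [F.comm, G.comm]⟩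

/-- The complement `1 - F` of an endomorphism. -/
def Hom.compl {M : GRep k V} (F : Hom M M) : Hom M M :=
  ⟨fun a => LinearMap.id - F.φ a, fun a b x => by simp [F.comm]⟩

/-- All components are surjective. -/
def Hom.Surj {M N : GRep k V} (F : Hom M N) : Prop := ∀ a, Function.Surjective (F.φ a)

/-- Exactness of `M ⟶ N ⟶ L` at `N`. -/
def Hom.Exact {M N L : GRep k V} (F : Hom M N) (G : Hom N L) : Prop :=
  ∀ a y, G.φ a y = 0 ↔ ∃ x, F.φ a x = y

/-- Isomorphy of families. -/
def Iso (M N : GRep k V) : Prop :=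
  ∃ (F : Hom M N) (G : Hom N M), (∀ a x, G.φ a (F.φ a x) = x) ∧ ∀ a x, F.φ a (G.φ a x) = x

theorem Iso.symm {M N : GRep k V} : Iso M N → Iso N M :=
  fun ⟨F, G, h1, h2⟩ => ⟨G, F, h2, h1⟩

/-- All spaces vanish. -/
def IsZero (M : GRep k V) : Prop := ∀ a (x : M.X a), x = 0

/-- `M` is nonzero and has no idempotent endomorphisms other than `0` and `1`. Since idempotents
split, this is indecomposability. -/
def IsIndec (M : GRep k V) : Prop :=
  ¬ M.IsZero ∧ ∀ e : Hom M M, (∀ a x, e.φ a (e.φ a x) = e.φ a x) →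
    (∀ a x, e.φ a x = 0) ∨ ∀ a x, e.φ a x = x

/-- `M` is a representation of the quiver with arrows `E`, supported on the vertices in `l`. -/
def IsRep (E : V → V → Prop) (l : List V) (M : GRep k V) : Prop :=
  (∀ a b, ¬ E a b → ∀ x, M.f a b x = 0) ∧ ∀ a, a ∉ l → ∀ x : M.X a, x = 0

/-- The dimension vector. -/
def dim (M : GRep k V) (a : V) : ℕ := Module.finrank k (M.X a)

theorem dim_eq_zero_iff {M : GRep k V} {a : V} : M.dim a = 0 ↔ ∀ x : M.X a, x = 0 := by
  rw [dim, Module.finrank_zero_iff]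
  exact ⟨fun h x => Subsingleton.elim _ _, fun h => ⟨fun x y => by rw [h x, h y]⟩⟩

theorem Iso.dim_eq {M N : GRep k V} (h : Iso M N) : M.dim = N.dim := by
  obtain ⟨F, G, h1, h2⟩ := h
  funext a
  exact (LinearEquiv.ofLinearMap (F.φ a) (G.φ a) (LinearMap.ext (h2 a))
    (LinearMap.ext (h1 a))).finrank_eq

theorem dim_le_of_surj {M N : GRep k V} {F : Hom M N} (h : F.Surj) (a : V) : N.dim a ≤ M.dim a :=
  LinearMap.finrank_le_finrank_of_surjective (h a)

/-- The cokernel of a morphism. -/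
def coker {M N : GRep k V} (F : Hom M N) : GRep k V where
  X a := N.X a ⧸ LinearMap.range (F.φ a)
  f a b := Submodule.mapQ _ _ (N.f a b) (by
    rintro _ ⟨x, rfl⟩
    exact ⟨M.f a b x, F.comm a b x⟩)

/-- The projection to the cokernel. -/
def toCoker {M N : GRep k V} (F : Hom M N) : Hom N (coker F) where
  φ _ := Submodule.mkQ _
  comm _ _ _ := rfl

theorem toCoker_surj {M N : GRep k V} (F : Hom M N) : (toCoker F).Surj :=
  fun _ => Submodule.mkQ_surjective _

theorem exact_toCoker {M N : GRep k V} (F : Hom M N) : F.Exact (toCoker F) :=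
  fun _ _ => Submodule.Quotient.mk_eq_zero _

/-- A morphism out of the cokernel. -/
def cokerDesc {M N L : GRep k V} (F : Hom M N) (G : Hom N L) (h : ∀ a x, G.φ a (F.φ a x) = 0) :
    Hom (coker F) L where
  φ a := Submodule.liftQ _ (G.φ a) (by rintro _ ⟨x, rfl⟩; exact h a x)
  comm a b x := by
    obtain ⟨y, rfl⟩ := Submodule.mkQ_surjective _ x
    exact G.comm a b y

theorem IsRep.of_surj {E : V → V → Prop} {l : List V} {M N : GRep k V} (h : IsRep E l M)
    {F : Hom M N} (hF : F.Surj) : IsRep E l N := by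
  refine ⟨fun a b hab x => ?_, fun a ha x => ?_⟩
  · obtain ⟨y, rfl⟩ := hF a x
    rw [← F.comm, h.1 a b hab, map_zero]
  · obtain ⟨y, rfl⟩ := hF a x
    rw [h.2 a ha y, map_zero]

theorem IsZero.isRep {M : GRep k V} (h : M.IsZero) (E : V → V → Prop) (l : List V) :
    IsRep E l M :=
  ⟨fun _ _ _ _ => h _ _, fun _ _ _ => h _ _⟩

variable [DecidableEq V]

/-- The simple representation at the vertex `i`. -/
def simple (k : Type u) [Field k] (i : V) : GRep k V where
  X a := Fin (if a = i then 1 else 0) → k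
  f _ _ := 0

theorem simple_isRep (E : V → V → Prop) {l : List V} {i : V} (hi : i ∈ l) :
    IsRep E l (simple k i) := by
  refine ⟨fun _ _ _ _ => rfl, fun a ha x => funext fun m => ?_⟩
  have : a ≠ i := fun h => ha (h ▸ hi)
  exact absurd m.2 (by simp [this])

theorem dim_simple (i : V) : (simple k i).dim = Pi.single i 1 := by
  funext a
  rw [Pi.single_apply]
  exact Module.finrank_fin_fun k

/-- A vector at `i` that all structure maps kill is the image of a morphism from the simple
representation. -/
theorem exists_hom_simple {M : GRep k V} {i : V} {x : M.X i} (hx : ∀ b, M.f i b x = 0) :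
    ∃ F : Hom (simple k i) M, ∃ s, F.φ i s = x := by
  have : ∀ a, ∃ g : (Fin (if a = i then 1 else 0) → k) →ₗ[k] M.X a,
      (∀ b t, M.f a b (g t) = 0) ∧ (∀ h : a = i, ∃ s, g s = h ▸ x) := by
    intro a
    by_cases h : a = i
    · subst h
      exact ⟨(LinearMap.toSpanSingleton k _ x).comp
        (LinearMap.proj (⟨0, by simp⟩ : Fin (if a = a then 1 else 0))), fun b t => by simp [hx],
        fun _ => ⟨fun _ => 1, by simp⟩⟩
    · exact ⟨0, fun b t => by simp, fun h' => absurd h' h⟩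
  choose g hg1 hg2 using this
  exact ⟨⟨g, fun a b t => (map_zero (g b)).trans (hg1 a b t).symm⟩, hg2 i rfl⟩

/-! ### Reflection functors -/

/-- `M'` is the image of `M` under the reflection functor at the source `i`, where the arrows from
`i` go to the vertices in `A`: the two agree away from `i` (through `u` and `v`), and
`M_i ⟶ ⨁_{j ∈ A} M_j ⟶ M'_i ⟶ 0` is exact. The sums are over all `j`; the terms with
`j ∉ A` vanish. -/
structure Refl [Fintype V] (A : V → Prop) (i : V) (M M' : GRep k V) where
  /-- the identification of `M` with `M'`, away from `i` -/
  u : ∀ a, M.X a →ₗ[k] M'.X a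
  /-- the inverse of the identification, away from `i` -/
  v : ∀ a, M'.X a →ₗ[k] M.X a
  vu : ∀ a, a ≠ i → ∀ x, v a (u a x) = x
  uv : ∀ a, a ≠ i → ∀ x, u a (v a x) = x
  comm : ∀ a b, a ≠ i → b ≠ i → ∀ x, u b (M.f a b x) = M'.f a b (u a x)
  into_zero : ∀ a x, M.f a i x = 0
  out_zero : ∀ b, ¬ A b → ∀ x, M.f i b x = 0
  into_zero' : ∀ a, ¬ A a → ∀ x, M'.f a i x = 0
  out_zero' : ∀ b x, M'.f i b x = 0
  comp_zero : ∀ x, ∑ j, M'.f j i (u j (M.f i j x)) = 0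
  exact : ∀ y : ∀ j, M.X j, ∑ j, M'.f j i (u j (y j)) = 0 → ∃ x, ∀ j, A j → M.f i j x = y j
  surj : ∀ z, ∃ y : ∀ j, M.X j, ∑ j, M'.f j i (u j (y j)) = z

/-- `M_i ⟶ ⨁ M_j` is injective: `M` has no summand that is simple at the source `i`. -/
def InjAt (M : GRep k V) (i : V) : Prop := ∀ x : M.X i, (∀ j, M.f i j x = 0) → x = 0

/-- `⨁ M_j ⟶ M_i` is surjective: `M` has no summand that is simple at the sink `i`. -/
def SurjAt [Fintype V] (M : GRep k V) (i : V) : Prop :=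
  ∀ z : M.X i, ∃ y : ∀ j, M.X j, ∑ j, M.f j i (y j) = z

/-- The orientation with the arrows at `i` reversed. -/
def reflectAt (E : V → V → Prop) (i a b : V) : Prop :=
  if a = i ∨ b = i then E b a else E a b

theorem reflectAt_left {E : V → V → Prop} {i b : V} : reflectAt E i i b ↔ E b i := by
  simp [reflectAt]

theorem reflectAt_right {E : V → V → Prop} {i a : V} : reflectAt E i a i ↔ E i a := by
  simp [reflectAt]

theorem reflectAt_of_ne {E : V → V → Prop} {i a b : V} (ha : a ≠ i) (hb : b ≠ i) :
    reflectAt E i a b ↔ E a b := by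
  simp [reflectAt, ha, hb]

end GRep

theorem exists_surjective_ker_eq {k : Type u} [Field k] {B : Type*} [AddCommGroup B] [Module k B]
    [Module.Finite k B] (K : Submodule k B) :
    ∃ (n : ℕ) (π : B →ₗ[k] (Fin n → k)), Function.Surjective π ∧ LinearMap.ker π = K := by
  let e := (Module.finBasis k (B ⧸ K)).equivFun
  refine ⟨_, e.toLinearMap.comp K.mkQ, e.surjective.comp K.mkQ_surjective, ?_⟩
  rw [LinearEquiv.ker_comp, Submodule.ker_mkQ]

theorem exists_injective_range_eq {k : Type u} [Field k] {B : Type*} [AddCommGroup B] [Module k B]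
    [Module.Finite k B] (K : Submodule k B) :
    ∃ (n : ℕ) (ι : (Fin n → k) →ₗ[k] B), Function.Injective ι ∧ LinearMap.range ι = K := by
  let e := (Module.finBasis k K).equivFun.symm
  refine ⟨_, K.subtype.comp e.toLinearMap, Subtype.val_injective.comp e.injective, ?_⟩
  rw [LinearMap.range_comp, LinearEquiv.range, Submodule.map_top, Submodule.range_subtype]

theorem exists_factor_of_surjective {k : Type*} [Field k] {B C D : Type*} [AddCommGroup B]
    [Module k B] [AddCommGroup C] [Module k C] [AddCommGroup D] [Module k D] {p : B →ₗ[k] C}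
    (hp : Function.Surjective p) (q : B →ₗ[k] D) (h : ∀ x, p x = 0 → q x = 0) :
    ∃ g : C →ₗ[k] D, ∀ x, g (p x) = q x := by
  obtain ⟨s, hs⟩ := p.exists_rightInverse_of_surjective (LinearMap.range_eq_top.2 hp)
  refine ⟨q.comp s, fun x => ?_⟩
  have h1 : p (s (p x) - x) = 0 := by
    rw [map_sub, sub_eq_zero]
    exact LinearMap.congr_fun hs (p x)
  have h2 := h _ h1
  rw [map_sub, sub_eq_zero] at h2
  exact h2

theorem exists_factor_of_injective {k : Type*} [Field k] {B C D : Type*} [AddCommGroup B]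
    [Module k B] [AddCommGroup C] [Module k C] [AddCommGroup D] [Module k D] {p : B →ₗ[k] C}
    (hp : Function.Injective p) (q : D →ₗ[k] C) (h : ∀ x, ∃ y, p y = q x) :
    ∃ g : D →ₗ[k] B, ∀ x, p (g x) = q x := by
  obtain ⟨s, hs⟩ := p.exists_leftInverse_of_injective (LinearMap.ker_eq_bot.2 hp)
  refine ⟨s.comp q, fun x => ?_⟩
  obtain ⟨y, hy⟩ := h x
  have : s (p y) = y := LinearMap.congr_fun hs y
  rw [LinearMap.comp_apply, ← hy, this]

/-! ### Admissible orderings and the existence of reflections -/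

namespace GRep

variable {k : Type u} [Field k] {V : Type v}

/-- The list `l` is an ordering of its vertices that is consistent with the orientation `E`. -/
structure Adm (E : V → V → Prop) (l : List V) : Prop where
  nodup : l.Nodup
  pairwise : l.Pairwise fun a b => ¬ E b a
  loopless : ∀ a, ¬ E a a

theorem Adm.tail {E : V → V → Prop} {i : V} {l : List V} (h : Adm E (i :: l)) : Adm E l :=
  ⟨(List.nodup_cons.1 h.nodup).2, (List.pairwise_cons.1 h.pairwise).2, h.loopless⟩

theorem Adm.source {E : V → V → Prop} {i : V} {l : List V} (h : Adm E (i :: l)) :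
    ∀ a ∈ i :: l, ¬ E a i := by
  intro a ha
  rcases List.mem_cons.1 ha with rfl | ha
  · exact h.loopless a
  · exact (List.pairwise_cons.1 h.pairwise).1 a ha

theorem mem_rotate_iff {i a : V} {l : List V} : a ∈ l ++ [i] ↔ a ∈ i :: l := by
  simp [or_comm]

variable [DecidableEq V]

/-- Reversing the arrows at the first vertex, a source, makes it a sink, and so the last vertex. -/
theorem Adm.reflect {E : V → V → Prop} {i : V} {l : List V} (h : Adm E (i :: l)) :
    Adm (reflectAt E i) (l ++ [i]) := by
  obtain ⟨hi, hl⟩ := List.nodup_cons.1 h.nodup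
  refine ⟨List.nodup_append.2 ⟨hl, List.nodup_singleton i, ?_⟩,
    List.pairwise_append.2 ⟨?_, List.pairwise_singleton _ _, ?_⟩, fun a => ?_⟩
  · rintro a ha b hb rfl
    exact hi (List.mem_singleton.1 hb ▸ ha)
  · refine (List.pairwise_cons.1 h.pairwise).2.imp_of_mem fun {a b} ha hb hab => ?_
    rwa [reflectAt_of_ne (ne_of_mem_of_not_mem hb hi) (ne_of_mem_of_not_mem ha hi)]
  · intro a ha b hb
    rw [List.mem_singleton.1 hb, reflectAt_left]
    exact h.source a (List.mem_cons_of_mem _ ha)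
  · unfold reflectAt
    split_ifs <;> exact h.loopless a

section exists_reflection

variable {E : V → V → Prop} {i : V} {l : List V}

theorem IsRep.source_into_zero (h : Adm E (i :: l)) {M : GRep k V} (hM : IsRep E (i :: l) M)
    (a : V) (x : M.X a) : M.f a i x = 0 := by
  by_cases ha : a ∈ i :: l
  · exact hM.1 a i (h.source a ha) x
  · rw [hM.2 a ha x, map_zero]

theorem IsRep.sink_out_zero (h : Adm E (i :: l)) {M : GRep k V}
    (hM : IsRep (reflectAt E i) (l ++ [i]) M) (b : V) (x : M.X i) : M.f i b x = 0 := by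
  by_cases hb : b ∈ i :: l
  · exact hM.1 i b (by rw [reflectAt_left]; exact h.source b hb) x
  · exact hM.2 b (by rwa [mem_rotate_iff]) _

variable [Fintype V]

/-- The reflection functor at a source is defined on all objects. -/
theorem exists_refl_of_source (h : Adm E (i :: l)) {M : GRep k V} (hM : IsRep E (i :: l) M) :
    ∃ M' : GRep k V, IsRep (reflectAt E i) (l ++ [i]) M' ∧ Nonempty (Refl (E i) i M M') := by
  classical
  -- The spaces of `M'` are quotients of the product of the spaces of `M`.
  let A : Submodule k (∀ j, M.X j) :=
    { carrier := {y | ∃ x, ∀ j, E i j → M.f i j x = y j}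
      add_mem' := by
        rintro y z ⟨x, hx⟩ ⟨x', hx'⟩
        exact ⟨x + x', fun j hj => by rw [map_add, hx j hj, hx' j hj]; rfl⟩
      zero_mem' := ⟨0, fun j _ => map_zero _⟩
      smul_mem' := by
        rintro c y ⟨x, hx⟩
        exact ⟨c • x, fun j hj => by rw [map_smul, hx j hj]; rfl⟩ }
  have h1 : ∀ a, ∃ (n : ℕ) (π : (∀ j, M.X j) →ₗ[k] (Fin n → k)), Function.Surjective π ∧
      LinearMap.ker π = if a = i then A else LinearMap.ker (LinearMap.proj a) :=
    fun a => exists_surjective_ker_eq _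
  choose n π hπ hker using h1
  have hkeri : ∀ y, π i y = 0 ↔ ∃ x, ∀ j, E i j → M.f i j x = y j := fun y => by
    rw [← LinearMap.mem_ker, hker, if_pos rfl]; rfl
  have hkera : ∀ a, a ≠ i → ∀ y, π a y = 0 ↔ y a = 0 := fun a ha y => by
    rw [← LinearMap.mem_ker, hker, if_neg ha]; rfl
  have h2 : ∀ a, ∃ v : (Fin (n a) → k) →ₗ[k] M.X a, a ≠ i → ∀ y, v (π a y) = y a := by
    intro a
    by_cases ha : a = i
    · exact ⟨0, fun h => absurd ha h⟩
    · obtain ⟨v, hv⟩ := exists_factor_of_surjective (hπ a) (LinearMap.proj a)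
        (fun y hy => (hkera a ha y).1 hy)
      exact ⟨v, fun _ => hv⟩
  choose v hv using h2
  let u : ∀ a, M.X a →ₗ[k] (Fin (n a) → k) := fun a => (π a).comp (LinearMap.single k M.X a)
  have hvu : ∀ a, a ≠ i → ∀ x, v a (u a x) = x := fun a ha x => by
    rw [LinearMap.comp_apply, hv a ha, LinearMap.single_apply, Pi.single_eq_same]
  have huv : ∀ a, a ≠ i → ∀ x, u a (v a x) = x := fun a ha x => by
    obtain ⟨y, rfl⟩ := hπ a x
    rw [hv a ha, LinearMap.comp_apply, ← sub_eq_zero, ← map_sub, hkera a ha]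
    simp
  let M' : GRep k V :=
    { X := fun a => Fin (n a) → k
      f := fun a b => if a = i then 0 else if b = i then
        (if E i a then (π b).comp ((LinearMap.single k M.X a).comp (v a)) else 0) else
        (u b).comp ((M.f a b).comp (v a)) }
  have hf1 : ∀ b x, M'.f i b x = 0 := fun b x => by simp [M']
  have hf2 : ∀ a, a ≠ i → E i a → ∀ x, M'.f a i x = π i (Pi.single a (v a x)) := fun a ha h x => by
    simp [M', ha, h]
  have hf3 : ∀ a, ¬ E i a → ∀ x, M'.f a i x = 0 := fun a h x => by
    by_cases ha : a = i
    · subst ha; exact hf1 _ x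
    · simp [M', ha, h]
  have hf4 : ∀ a b, a ≠ i → b ≠ i → ∀ x, M'.f a b x = u b (M.f a b (v a x)) :=
    fun a b ha hb x => by simp [M', ha, hb]
  have hsum : ∀ y : ∀ j, M.X j, ∑ j, M'.f j i (u j (y j)) = π i y := by
    intro y
    have e : ∀ j, M'.f j i (u j (y j)) = π i (Pi.single j (y j)) := by
      intro j
      by_cases hj : E i j
      · have hji : j ≠ i := fun h' => h.loopless i (h' ▸ hj)
        rw [hf2 j hji hj, hvu j hji]
      · rw [hf3 j hj]
        refine ((hkeri _).2 ⟨0, fun b hb => ?_⟩).symm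
        rw [map_zero, Pi.single_eq_of_ne]
        rintro rfl
        exact hj hb
    simp only [e]
    exact (map_sum (π i) _ _).symm.trans (congrArg _ (Finset.univ_sum_single y))
  refine ⟨M', ⟨fun a b hab x => ?_, fun a ha x => ?_⟩, ⟨⟨u, v, hvu, huv, ?_,
    hM.source_into_zero h, fun b hb => hM.1 i b hb, hf3, hf1, ?_, ?_, ?_⟩⟩⟩
  · by_cases ha : a = i
    · subst ha; exact hf1 b x
    by_cases hb : b = i
    · subst hb
      rw [reflectAt_right] at hab
      exact hf3 a hab x
    · rw [reflectAt_of_ne ha hb] at hab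
      rw [hf4 a b ha hb, hM.1 a b hab, map_zero]
  · rw [mem_rotate_iff] at ha
    have hai : a ≠ i := fun h => ha (h ▸ List.mem_cons_self)
    rw [← huv a hai x, hM.2 a ha (v a x), map_zero]
  · intro a b ha hb x
    rw [hf4 a b ha hb, hvu a ha]
  · intro x
    rw [hsum, hkeri]
    exact ⟨x, fun _ _ => rfl⟩
  · intro y hy
    rw [hsum, hkeri] at hy
    exact hy
  · intro z
    obtain ⟨y, rfl⟩ := hπ i z
    exact ⟨y, hsum y⟩

/-- Each representation without simple summands at the sink `i` is the reflection of a
representation without simple summands at the source `i`. -/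
theorem exists_refl_of_sink (h : Adm E (i :: l)) {M' : GRep k V}
    (hM : IsRep (reflectAt E i) (l ++ [i]) M') (hs : M'.SurjAt i) :
    ∃ M : GRep k V, IsRep E (i :: l) M ∧ M.InjAt i ∧ Nonempty (Refl (E i) i M M') := by
  classical
  -- The spaces of `M` are subspaces of the product of the spaces of `M'`.
  let p : (∀ j, M'.X j) →ₗ[k] M'.X i := ∑ j, (M'.f j i).comp (LinearMap.proj j)
  have hp : ∀ y, p y = ∑ j, M'.f j i (y j) := fun y => by simp [p]
  have hzero : ∀ j, ¬ E i j → ∀ x, M'.f j i x = 0 := fun j hj x =>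
    hM.1 j i (by rwa [reflectAt_right]) x
  let A : Submodule k (∀ j, M'.X j) := LinearMap.ker p ⊓
    { carrier := {y | ∀ j, ¬ E i j → y j = 0}
      add_mem' := fun {y z} hy hz j hj => by rw [Pi.add_apply, hy j hj, hz j hj, add_zero]
      zero_mem' := fun j _ => rfl
      smul_mem' := fun c y hy j hj => by rw [Pi.smul_apply, hy j hj, smul_zero] }
  have h1 : ∀ a, ∃ (n : ℕ) (ι : (Fin n → k) →ₗ[k] (∀ j, M'.X j)), Function.Injective ι ∧
      LinearMap.range ι = if a = i then A else LinearMap.range (LinearMap.single k M'.X a) :=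
    fun a => exists_injective_range_eq _
  choose n ι hι hran using h1
  have hrani : ∀ y, (∃ x, ι i x = y) ↔ p y = 0 ∧ ∀ j, ¬ E i j → y j = 0 := fun y => by
    rw [← LinearMap.mem_range, hran, if_pos rfl]; rfl
  have hrana : ∀ a, a ≠ i → ∀ y, (∃ x, ι a x = y) ↔ ∃ z, Pi.single a z = y := fun a ha y => by
    rw [← LinearMap.mem_range, hran, if_neg ha]; rfl
  have h2 : ∀ a, ∃ v : M'.X a →ₗ[k] (Fin (n a) → k), a ≠ i → ∀ y, ι a (v y) = Pi.single a y := by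
    intro a
    by_cases ha : a = i
    · exact ⟨0, fun h => absurd ha h⟩
    · obtain ⟨v, hv⟩ := exists_factor_of_injective (hι a) (LinearMap.single k M'.X a)
        (fun y => (hrana a ha _).2 ⟨y, rfl⟩)
      exact ⟨v, fun _ => hv⟩
  choose v hv using h2
  let u : ∀ a, (Fin (n a) → k) →ₗ[k] M'.X a := fun a => (LinearMap.proj a).comp (ι a)
  have huv : ∀ a, a ≠ i → ∀ x, u a (v a x) = x := fun a ha x => by
    rw [LinearMap.comp_apply, hv a ha, LinearMap.proj_apply, Pi.single_eq_same]
  have hvu : ∀ a, a ≠ i → ∀ x, v a (u a x) = x := fun a ha x => by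
    obtain ⟨z, hz⟩ := (hrana a ha _).1 ⟨x, rfl⟩
    apply hι a
    rw [hv a ha, LinearMap.comp_apply, LinearMap.proj_apply, ← hz, Pi.single_eq_same]
  let M : GRep k V :=
    { X := fun a => Fin (n a) → k
      f := fun a b => if b = i then 0 else if a = i then
        (if E i b then (v b).comp ((LinearMap.proj b).comp (ι a)) else 0) else
        (v b).comp ((M'.f a b).comp (u a)) }
  have hf1 : ∀ a x, M.f a i x = 0 := fun b x => by simp [M]
  have hf2 : ∀ b, b ≠ i → E i b → ∀ x, M.f i b x = v b (ι i x b) := fun a ha h x => by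
    simp [M, ha, h]
  have hf3 : ∀ b, ¬ E i b → ∀ x, M.f i b x = 0 := fun a h x => by
    by_cases ha : a = i
    · subst ha; exact hf1 _ x
    · simp [M, ha, h]
  have hf4 : ∀ a b, a ≠ i → b ≠ i → ∀ x, M.f a b x = v b (M'.f a b (u a x)) :=
    fun a b ha hb x => by simp [M, ha, hb]
  have hne : ∀ j, E i j → j ≠ i := fun j hj h' => h.loopless i (h' ▸ hj)
  have huf : ∀ x j, u j (M.f i j x) = if E i j then ι i x j else 0 := by
    intro x j
    split_ifs with hj
    · rw [hf2 j (hne j hj) hj, huv j (hne j hj)]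
    · rw [hf3 j hj, map_zero]
  refine ⟨M, ⟨fun a b hab x => ?_, fun a ha x => ?_⟩, ?_, ⟨⟨u, v, hvu, huv, ?_,
    hf1, hf3, hzero, hM.sink_out_zero h, ?_, ?_, ?_⟩⟩⟩
  · by_cases hb : b = i
    · subst hb; exact hf1 a x
    by_cases ha : a = i
    · subst ha
      exact hf3 b hab x
    · rw [hf4 a b ha hb, hM.1 a b (by rwa [reflectAt_of_ne ha hb]), map_zero]
  · have hai : a ≠ i := fun h => ha (h ▸ List.mem_cons_self)
    rw [← hvu a hai x, hM.2 a (by rwa [mem_rotate_iff]) (u a x), map_zero]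
  · intro x hx
    apply hι i
    rw [map_zero]
    funext j
    by_cases hj : E i j
    · have h3 := huf x j
      rw [hx, map_zero, if_pos hj] at h3
      exact h3.symm
    · exact ((hrani _).1 ⟨x, rfl⟩).2 j hj
  · intro a b ha hb x
    rw [hf4 a b ha hb, huv b hb]
  · intro x
    rw [← ((hrani _).1 ⟨x, rfl⟩).1, hp]
    refine Finset.sum_congr rfl fun j _ => ?_
    rw [huf]
    split_ifs with hj
    · rfl
    · rw [map_zero, hzero j hj]
  · intro y hy
    have h3 : ∃ x, ι i x = fun j => if E i j then u j (y j) else 0 := by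
      refine (hrani _).2 ⟨?_, fun j hj => if_neg hj⟩
      rw [hp, ← hy]
      refine Finset.sum_congr rfl fun j _ => ?_
      split_ifs with hj
      · rfl
      · rw [map_zero, hzero j hj]
    obtain ⟨x, hx⟩ := h3
    refine ⟨x, fun j hj => ?_⟩
    rw [hf2 j (hne j hj) hj, hx]
    simp only [hj, if_true]
    exact hvu j (hne j hj) _
  · intro z
    obtain ⟨y, rfl⟩ := hs z
    refine ⟨fun j => v j (y j), Finset.sum_congr rfl fun j _ => ?_⟩
    by_cases hj : j = i
    · subst hj
      rw [hM.sink_out_zero h, hM.sink_out_zero h]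
    · rw [huv j hj]

end exists_reflection

end GRep

/-! ### Reflection of morphisms -/

namespace GRep

variable {k : Type u} [Field k] {V : Type v}

namespace Refl

variable {A : V → Prop} {i : V} {M M' N N' L L' : GRep k V}

/-- A morphism into an object without simple summands at the source is determined by its components
away from the source. -/
theorem ext_of_injAt (hN : N.InjAt i) (hi : ∀ x, N.f i i x = 0) {F G : Hom M N}
    (h : ∀ a, a ≠ i → ∀ x, F.φ a x = G.φ a x) (a : V) (x : M.X a) : F.φ a x = G.φ a x := by
  by_cases ha : a = i
  · subst ha
    rw [← sub_eq_zero]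
    refine hN _ fun j => ?_
    rw [map_sub, ← F.comm, ← G.comm, sub_eq_zero]
    by_cases hj : j = a
    · subst hj
      rw [F.comm, G.comm, hi, hi]
    · rw [h j hj]
  · exact h a ha x

variable [Fintype V]

/-- `F` and `F'` agree away from the vertex `i`, through the identifications of the objects with
their reflections. -/
def Agree (R : Refl A i M M') (S : Refl A i N N') (F : Hom M N) (F' : Hom M' N') : Prop :=
  ∀ a, a ≠ i → ∀ x, F'.φ a (R.u a x) = S.u a (F.φ a x)

theorem Agree.sum {R : Refl A i M M'} {S : Refl A i N N'} {F : Hom M N} {F' : Hom M' N'}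
    (h : Agree R S F F') (y : ∀ j, M.X j) :
    F'.φ i (∑ j, M'.f j i (R.u j (y j))) = ∑ j, N'.f j i (S.u j (F.φ j (y j))) := by
  rw [map_sum]
  refine Finset.sum_congr rfl fun j _ => ?_
  rw [F'.comm]
  by_cases hj : j = i
  · subst hj
    rw [S.out_zero', S.out_zero']
  · rw [h j hj]

theorem Agree.v {R : Refl A i M M'} {S : Refl A i N N'} {F : Hom M N} {F' : Hom M' N'}
    (h : Agree R S F F') (a : V) (ha : a ≠ i) (x : M'.X a) :
    F.φ a (R.v a x) = S.v a (F'.φ a x) := by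
  conv_rhs => rw [← R.uv a ha x, h a ha, S.vu a ha]

/-- Morphisms extend to the reflected objects. -/
theorem exists_lift (R : Refl A i M M') (S : Refl A i N N') (F : Hom M N) :
    ∃ F' : Hom M' N', Agree R S F F' := by
  classical
  let p : (∀ j, M.X j) →ₗ[k] M'.X i :=
    ∑ j, (M'.f j i).comp ((R.u j).comp (LinearMap.proj j))
  let q : (∀ j, M.X j) →ₗ[k] N'.X i :=
    ∑ j, (N'.f j i).comp ((S.u j).comp ((F.φ j).comp (LinearMap.proj j)))
  have hp : ∀ y, p y = ∑ j, M'.f j i (R.u j (y j)) := fun y => by simp [p]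
  have hq : ∀ y, q y = ∑ j, N'.f j i (S.u j (F.φ j (y j))) := fun y => by simp [q]
  obtain ⟨g, hg⟩ : ∃ g : M'.X i →ₗ[k] N'.X i, ∀ y, g (p y) = q y := by
    refine exists_factor_of_surjective (fun z => ?_) q fun y hy => ?_
    · obtain ⟨y, hy⟩ := R.surj z
      exact ⟨y, by rw [hp, hy]⟩
    · rw [hp] at hy
      obtain ⟨x, hx⟩ := R.exact y hy
      rw [hq, ← S.comp_zero (F.φ i x)]
      refine Finset.sum_congr rfl fun j _ => ?_
      by_cases hj : A j
      · rw [← hx j hj, F.comm]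
      · rw [S.into_zero' j hj, S.into_zero' j hj]
  have h : ∀ a, ∃ g : M'.X a →ₗ[k] N'.X a, (a ≠ i → ∀ x, g (R.u a x) = S.u a (F.φ a x)) ∧
      (a = i → ∀ y : ∀ j, M.X j,
        g (∑ j, M'.f j a (R.u j (y j))) = ∑ j, N'.f j a (S.u j (F.φ j (y j)))) := by
    intro a
    by_cases ha : a = i
    · subst ha
      exact ⟨g, fun h => absurd rfl h, fun _ y => by rw [← hp, ← hq, hg]⟩
    · exact ⟨(S.u a).comp ((F.φ a).comp (R.v a)), fun _ x => by simp [R.vu a ha],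
        fun h => absurd h ha⟩
  choose G hG1 hG2 using h
  refine ⟨⟨G, fun a b x => ?_⟩, hG1⟩
  by_cases ha : a = i
  · subst ha
    rw [R.out_zero', S.out_zero', map_zero]
  by_cases hb : b = i
  · subst hb
    have h1 := hG2 b rfl (Pi.single a (R.v a x))
    rw [Finset.sum_eq_single a, Finset.sum_eq_single a, Pi.single_eq_same, R.uv a ha,
      ← hG1 a ha, R.uv a ha] at h1
    · exact h1
    · intro j _ hj; rw [Pi.single_eq_of_ne hj, map_zero, map_zero, map_zero]
    · simp
    · intro j _ hj; rw [Pi.single_eq_of_ne hj, map_zero, map_zero]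
    · simp
  · rw [← R.uv a ha x, ← R.comm a b ha hb, hG1 b hb, hG1 a ha, F.comm, S.comm a b ha hb]

/-- Morphisms between the reflected objects restrict to the original objects, if the target has no
simple summand at the source. -/
theorem exists_restrict (R : Refl A i M M') (S : Refl A i N N') (hN : N.InjAt i)
    (F' : Hom M' N') : ∃ F : Hom M N, Agree R S F F' := by
  classical
  let p : N.X i →ₗ[k] ∀ j, N.X j := LinearMap.pi fun j => N.f i j
  let q : M.X i →ₗ[k] ∀ j, N.X j :=
    LinearMap.pi fun j => if j = i then 0 else
      (S.v j).comp ((F'.φ j).comp ((R.u j).comp (M.f i j)))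
  have hq : ∀ x j, j ≠ i → q x j = S.v j (F'.φ j (R.u j (M.f i j x))) := fun x j hj => by
    simp [q, hj]
  have hq' : ∀ x, q x i = 0 := fun x => by simp [q]
  obtain ⟨g, hg⟩ : ∃ g : M.X i →ₗ[k] N.X i, ∀ x, p (g x) = q x := by
    refine exists_factor_of_injective (fun z z' h => ?_) q fun x => ?_
    · rw [← sub_eq_zero]
      refine hN _ fun j => ?_
      rw [map_sub, sub_eq_zero]
      exact congr_fun h j
    · have h1 : ∑ j, N'.f j i (S.u j (q x j)) = 0 := by
        rw [← map_zero (F'.φ i), ← R.comp_zero x, map_sum]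
        refine Finset.sum_congr rfl fun j _ => ?_
        rw [F'.comm]
        by_cases hj : j = i
        · subst hj; rw [S.out_zero', S.out_zero']
        · rw [hq x j hj, S.uv j hj]
      obtain ⟨z, hz⟩ := S.exact _ h1
      refine ⟨z, funext fun j => ?_⟩
      by_cases hj : A j
      · exact hz j hj
      · refine (S.out_zero j hj z).trans ?_
        by_cases hji : j = i
        · subst hji; exact (hq' x).symm
        · rw [hq x j hji, R.out_zero j hj, map_zero, map_zero, map_zero]
  have h : ∀ a, ∃ g : M.X a →ₗ[k] N.X a,
      (a ≠ i → ∀ x, F'.φ a (R.u a x) = S.u a (g x)) ∧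
      (a = i → ∀ j, j ≠ i → ∀ x, N.f a j (g x) = S.v j (F'.φ j (R.u j (M.f a j x)))) := by
    intro a
    by_cases ha : a = i
    · subst ha
      exact ⟨g, fun h => absurd rfl h, fun _ j hj x => by
        rw [← hq x j hj, ← hg]; rfl⟩
    · exact ⟨(S.v a).comp ((F'.φ a).comp (R.u a)), fun _ x => by simp [S.uv a ha],
        fun h => absurd h ha⟩
  choose G hG1 hG2 using h
  refine ⟨⟨G, fun a b x => ?_⟩, hG1⟩
  by_cases hb : b = i
  · subst hb
    rw [R.into_zero, S.into_zero, map_zero]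
  by_cases ha : a = i
  · subst ha
    rw [hG2 a rfl b hb, hG1 b hb, S.vu b hb]
  · rw [← S.vu b hb (G b _), ← hG1 b hb, R.comm a b ha hb, F'.comm, hG1 a ha,
      ← S.comm a b ha hb, S.vu b hb]

/-- A morphism of reflected objects is determined by its components away from the sink. -/
theorem ext_of_agree (R : Refl A i M M') {F G : Hom M' N'}
    (h : ∀ a, a ≠ i → ∀ x, F.φ a x = G.φ a x) (a : V) (x : M'.X a) : F.φ a x = G.φ a x := by
  by_cases ha : a = i
  · subst ha
    obtain ⟨y, rfl⟩ := R.surj x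
    rw [map_sum, map_sum]
    refine Finset.sum_congr rfl fun j _ => ?_
    by_cases hj : j = a
    · subst hj
      rw [R.out_zero', map_zero, map_zero]
    · rw [F.comm, G.comm, h j hj]
  · exact h a ha x

theorem isZero_iff (R : Refl A i M M') (hM : M.InjAt i) : M.IsZero ↔ M'.IsZero := by
  constructor
  · intro h a x
    by_cases ha : a = i
    · subst ha
      obtain ⟨y, rfl⟩ := R.surj x
      exact Finset.sum_eq_zero fun j _ => by rw [h j (y j), map_zero, map_zero]
    · rw [← R.uv a ha x, h a (R.v a x), map_zero]
  · intro h a x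
    by_cases ha : a = i
    · subst ha
      refine hM x fun j => ?_
      by_cases hj : j = a
      · subst hj; exact R.into_zero _ _
      · rw [← R.vu j hj (M.f a j x), h j (R.u j _), map_zero]
    · rw [← R.vu a ha x, h a (R.u a x), map_zero]

/-- The reflection functor is fully faithful on the objects without simple summands at the source,
so it preserves and reflects indecomposability. -/
theorem isIndec_iff (R : Refl A i M M') (hM : M.InjAt i) : M.IsIndec ↔ M'.IsIndec := by
  refine and_congr (not_congr (R.isZero_iff hM)) ⟨fun h e' he' => ?_, fun h e he => ?_⟩
  · obtain ⟨e, ha⟩ := R.exists_restrict R hM e'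
    have hi := R.into_zero i
    have h1 : ∀ a, a ≠ i → ∀ x, e.φ a x = R.v a (e'.φ a (R.u a x)) := fun a hai x => by
      rw [ha a hai, R.vu a hai]
    have h2 : ∀ a x, e.φ a (e.φ a x) = e.φ a x :=
      ext_of_injAt (F := e.comp e) hM hi fun a hai x => by
        change e.φ a (e.φ a x) = _
        rw [h1 a hai (e.φ a x), ← ha a hai, he', ← h1 a hai]
    refine (h e h2).imp (fun h0 => ?_) fun h0 => ?_
    · exact R.ext_of_agree (G := ⟨fun _ => 0, fun _ _ _ => by simp⟩) fun a hai x => by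
        change _ = (0 : M'.X a)
        rw [← R.uv a hai x, ha a hai, h0, map_zero]
    · exact R.ext_of_agree (G := Hom.id M') fun a hai x => by
        change _ = x
        rw [← R.uv a hai x, ha a hai, h0]
  · obtain ⟨e', ha⟩ := R.exists_lift R e
    have hi := R.into_zero i
    have h2 : ∀ a x, e'.φ a (e'.φ a x) = e'.φ a x :=
      R.ext_of_agree (F := e'.comp e') fun a hai x => by
        change e'.φ a (e'.φ a x) = _
        rw [← R.uv a hai x, ha a hai, ha a hai, he]
    refine (h e' h2).imp (fun h0 => ?_) fun h0 => ?_
    · exact ext_of_injAt (G := ⟨fun _ => 0, fun _ _ _ => by simp⟩) hM hi fun a hai x => by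
        change _ = (0 : M.X a)
        rw [← R.vu a hai (e.φ a x), ← ha a hai, h0, map_zero]
    · exact ext_of_injAt (G := Hom.id M) hM hi fun a hai x => by
        change _ = x
        rw [← R.vu a hai (e.φ a x), ← ha a hai, h0, R.vu a hai]

/-- Objects without simple summands at the source are isomorphic if their reflections are. -/
theorem iso_of_iso (R : Refl A i M M') (S : Refl A i N N') (hM : M.InjAt i) (hN : N.InjAt i)
    (h : Iso M' N') : Iso M N := by
  obtain ⟨F', G', h1, h2⟩ := h
  obtain ⟨F, hF⟩ := R.exists_restrict S hN F'
  obtain ⟨G, hG⟩ := S.exists_restrict R hM G'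
  refine ⟨F, G, ext_of_injAt (F := F.comp G) (G := Hom.id M) hM (R.into_zero i) fun a ha x => ?_,
    ext_of_injAt (F := G.comp F) (G := Hom.id N) hN (S.into_zero i) fun a ha x => ?_⟩
  · change G.φ a (F.φ a x) = x
    rw [← R.vu a ha (G.φ a _), ← hG a ha, ← hF a ha, h1, R.vu a ha]
  · change F.φ a (G.φ a x) = x
    rw [← S.vu a ha (F.φ a _), ← hF a ha, ← hG a ha, h2, S.vu a ha]

theorem dim_of_ne (R : Refl A i M M') {a : V} (ha : a ≠ i) : M'.dim a = M.dim a :=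
  (LinearEquiv.ofLinearMap (R.v a) (R.u a) (LinearMap.ext (R.vu a ha))
    (LinearMap.ext (R.uv a ha))).finrank_eq

open scoped Classical in
/-- The dimension count for the exact sequence `0 ⟶ M_i ⟶ ⨁_{j ∈ A} M_j ⟶ M'_i ⟶ 0`. -/
theorem dim_add_dim (R : Refl A i M M') (hM : M.InjAt i) :
    M'.dim i + M.dim i = ∑ j, if A j then M.dim j else 0 := by
  let p : (∀ j : {j // A j}, M.X j) →ₗ[k] M'.X i :=
    ∑ j : {j // A j}, (M'.f j i).comp ((R.u j).comp (LinearMap.proj j))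
  have hp : ∀ y : ∀ j, M.X j, p (fun j => y j) = ∑ j, M'.f j i (R.u j (y j)) := by
    intro y
    simp only [p, LinearMap.sum_apply, LinearMap.comp_apply, LinearMap.proj_apply]
    rw [← Finset.sum_subtype (p := A) (Finset.univ.filter A) (by simp)
      (fun j => M'.f j i (R.u j (y j))), Finset.sum_filter]
    refine Finset.sum_congr rfl fun j _ => ?_
    split_ifs with hj
    · rfl
    · rw [R.into_zero' j hj]
  have hext : ∀ z : ∀ j : {j // A j}, M.X j, ∃ y : ∀ j, M.X j, z = fun j : {j // A j} => y j :=
    fun z => ⟨fun j => if hj : A j then z ⟨j, hj⟩ else 0, by funext j; simp [j.2]⟩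
  let ι : M.X i →ₗ[k] ∀ j : {j // A j}, M.X j := LinearMap.pi fun j => M.f i j
  have hι : Function.Injective ι := by
    intro z z' h
    rw [← sub_eq_zero]
    refine hM _ fun j => ?_
    by_cases hj : A j
    · rw [map_sub, sub_eq_zero]
      exact congr_fun h ⟨j, hj⟩
    · exact R.out_zero j hj _
  have hps : LinearMap.range p = ⊤ := LinearMap.range_eq_top.2 fun z => by
    obtain ⟨y, hy⟩ := R.surj z
    exact ⟨_, (hp y).trans hy⟩
  have hker : LinearMap.ker p = LinearMap.range ι := by
    ext z
    obtain ⟨y, rfl⟩ := hext z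
    rw [LinearMap.mem_ker, hp, LinearMap.mem_range]
    constructor
    · intro h
      obtain ⟨x, hx⟩ := R.exact y h
      exact ⟨x, funext fun j => hx j j.2⟩
    · rintro ⟨x, hx⟩
      rw [← R.comp_zero x]
      refine Finset.sum_congr rfl fun j _ => ?_
      by_cases hj : A j
      · rw [← congr_fun hx ⟨j, hj⟩]; rfl
      · rw [R.into_zero' j hj, R.into_zero' j hj]
  have h1 := LinearMap.finrank_range_add_finrank_ker p
  rw [hps, finrank_top, hker, LinearMap.finrank_range_of_inj hι, Module.finrank_pi_fintype] at h1
  refine h1.trans ?_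
  rw [← Finset.sum_filter]
  exact (Finset.sum_subtype (p := A) _ (by simp) fun j => M.dim j).symm

end Refl
end GRep

namespace GRep

/-! ### Indecomposable representations and roots -/

section simples

variable {k : Type u} [Field k] {V : Type v}

theorem iso_of_dim_eq_of_zero {M N : GRep k V} (hM : ∀ a b x, M.f a b x = 0)
    (hN : ∀ a b x, N.f a b x = 0) (h : M.dim = N.dim) : Iso M N := by
  have h' : ∀ a, Nonempty (M.X a ≃ₗ[k] N.X a) := fun a =>
    ⟨LinearEquiv.ofFinrankEq _ _ (congr_fun h a)⟩
  let e := fun a => (h' a).some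
  exact ⟨⟨fun a => (e a).toLinearMap, fun a b x => by
      rw [hM, hN, map_zero]⟩, ⟨fun a => (e a).symm.toLinearMap, fun a b x => by
      rw [hM, hN, map_zero]⟩, fun a x => (e a).symm_apply_apply x,
    fun a x => (e a).apply_symm_apply x⟩

/-- The dimension vector as a real vector. -/
def rdim (M : GRep k V) : V → ℝ := fun a => (M.dim a : ℝ)

theorem isNat_rdim (M : GRep k V) : IsNat M.rdim := ⟨M.dim, rfl⟩

theorem rdim_eq_iff {M N : GRep k V} : M.rdim = N.rdim ↔ M.dim = N.dim := by
  simp [rdim, funext_iff]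

theorem rdim_ne_zero {M : GRep k V} (h : ¬ M.IsZero) : M.rdim ≠ 0 := fun h0 =>
  h fun a => dim_eq_zero_iff.1 (Nat.cast_eq_zero.1 (congr_fun h0 a))

theorem Refl.surjAt [Fintype V] {A : V → Prop} {i : V} {M M' : GRep k V} (R : Refl A i M M') :
    M'.SurjAt i := fun z => by
  obtain ⟨y, hy⟩ := R.surj z
  exact ⟨fun j => R.u j (y j), hy⟩

variable [DecidableEq V]

theorem rdim_eq_single_iff {M : GRep k V} {i : V} :
    M.rdim = Pi.single i 1 ↔ M.dim = Pi.single i 1 := by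
  simp only [rdim, funext_iff, Pi.single_apply]
  refine forall_congr' fun a => ?_
  split_ifs <;> norm_cast

theorem dim_single_map_zero {E : V → V → Prop} {l : List V} (hE : ∀ a, ¬ E a a) {M : GRep k V}
    (hM : IsRep E l M) {i : V} (h : M.dim = Pi.single i 1) (a b : V) (x : M.X a) :
    M.f a b x = 0 := by
  have h0 : ∀ a, a ≠ i → ∀ x : M.X a, x = 0 := fun a ha =>
    dim_eq_zero_iff.1 (by rw [h, Pi.single_eq_of_ne ha])
  by_cases ha : a = i
  · by_cases hb : b = i
    · subst ha hb
      exact hM.1 _ _ (hE _) x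
    · exact h0 b hb _
  · rw [h0 a ha x, map_zero]

theorem isIndec_of_dim_eq_single {M : GRep k V} {i : V} (h : M.dim = Pi.single i 1) :
    M.IsIndec := by
  have h0 : ∀ a, a ≠ i → ∀ x : M.X a, x = 0 := fun a ha =>
    dim_eq_zero_iff.1 (by rw [h, Pi.single_eq_of_ne ha])
  have h1 : Module.finrank k (M.X i) = 1 := by
    have := congr_fun h i
    rwa [Pi.single_eq_same] at this
  obtain ⟨s, hs, hs'⟩ := finrank_eq_one_iff'.1 h1
  refine ⟨fun hz => hs (hz i s), fun e he => ?_⟩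
  obtain ⟨c, hc⟩ := hs' (e.φ i s)
  have h2 : (c * c - c) • s = 0 := by
    have h3 := he i s
    rw [← hc, map_smul, ← hc, smul_smul] at h3
    rw [sub_smul, h3, sub_self]
  have h4 : c = 0 ∨ c = 1 := by
    have := (smul_eq_zero.1 h2).resolve_right hs
    have h5 : c * (c - 1) = 0 := by linear_combination this
    exact (mul_eq_zero.1 h5).imp_right sub_eq_zero.1
  refine h4.imp (fun hc0 => ?_) fun hc1 => ?_
  all_goals
    intro a x
    by_cases ha : a = i
    · subst ha
      obtain ⟨d, rfl⟩ := hs' x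
      rw [map_smul, ← hc]
      simp [*]
    · rw [h0 a ha x, map_zero]

/-- An indecomposable representation is simple at the source `i`, or it has no summand that is
simple at the source `i`. -/
theorem IsIndec.dim_eq_single_or_injAt {M : GRep k V} (hM : M.IsIndec) {i : V}
    (hi : ∀ a x, M.f a i x = 0) : M.dim = Pi.single i 1 ∨ M.InjAt i := by
  rw [or_iff_not_imp_right]
  intro hn
  obtain ⟨x, hx, hx0⟩ : ∃ x : M.X i, (∀ j, M.f i j x = 0) ∧ x ≠ 0 := by
    rw [InjAt] at hn
    push Not at hn
    exact hn
  -- The projection to the line of `x` is an idempotent endomorphism of `M`.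
  obtain ⟨t, ht⟩ := Module.Projective.exists_dual_eq_one k hx0
  have hg : ∀ a, ∃ g : M.X a →ₗ[k] M.X a, (a ≠ i → g = 0) ∧ (∀ b y, M.f a b (g y) = 0) ∧
      (∀ y, g (g y) = g y) ∧ ∀ h : a = i, (∀ y, g y = t (h ▸ y) • h ▸ x) := by
    intro a
    by_cases ha : a = i
    · subst ha
      refine ⟨t.smulRight x, fun h => absurd rfl h, fun b y => ?_, fun y => ?_, fun _ y => rfl⟩
      · rw [LinearMap.smulRight_apply, map_smul, hx, smul_zero]
      · simp only [LinearMap.smulRight_apply, map_smul, ht, one_smul]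
    · exact ⟨0, fun _ => rfl, fun b y => by simp, fun y => rfl, fun h => absurd h ha⟩
  choose g hg1 hg2 hg3 hg4 using hg
  have hgi : ∀ y, g i y = t y • x := hg4 i rfl
  have hcomm : ∀ a b y, g b (M.f a b y) = M.f a b (g a y) := fun a b y => by
    rw [hg2]
    by_cases hb : b = i
    · subst hb; rw [hi, map_zero]
    · rw [hg1 b hb, LinearMap.zero_apply]
  have h1 := (hM.2 ⟨g, hcomm⟩ fun a y => hg3 a y).resolve_left fun h => hx0 (by
    have := h i x
    change g i x = 0 at this
    rwa [hgi, ht, one_smul] at this)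
  funext a
  by_cases ha : a = i
  · subst ha
    rw [Pi.single_eq_same]
    exact finrank_eq_one_iff'.2 ⟨x, hx0, fun y => ⟨t y, (hgi y).symm.trans (h1 a y)⟩⟩
  · rw [Pi.single_eq_of_ne ha]
    refine dim_eq_zero_iff.2 fun y => (h1 a y).symm.trans ?_
    change g a y = 0
    rw [hg1 a ha, LinearMap.zero_apply]

theorem InjAt.dim_ne_single {i : V} {M : GRep k V} (h : M.InjAt i) (hi : ∀ a x, M.f a i x = 0) :
    M.dim ≠ Pi.single i 1 := by
  intro hd
  have h0 : M.dim i = 0 := by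
    refine dim_eq_zero_iff.2 fun x => h x fun j => ?_
    by_cases hj : j = i
    · subst hj; exact hi _ x
    · exact dim_eq_zero_iff.1 (by rw [hd, Pi.single_eq_of_ne hj]) _
  rw [hd, Pi.single_eq_same] at h0
  exact one_ne_zero h0

end simples

/-- `E` is an orientation of the underlying graph of `Q`. -/
def IsOrientation {Q : Type v} [Quiver.{w} Q] (E : Q → Q → Prop) : Prop :=
  ∀ a b, (underlyingGraph Q).Adj a b ↔ E a b ∨ E b a

theorem IsOrientation.reflect {Q : Type v} [Quiver.{w} Q] [DecidableEq Q] {E : Q → Q → Prop}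
    (h : IsOrientation E) (i : Q) :
    IsOrientation (reflectAt E i) := by
  intro a b
  rw [h a b]
  unfold reflectAt
  by_cases ha : a = i <;> by_cases hb : b = i <;> simp [ha, hb, or_comm]

variable {k : Type u} [Field k] {Q : Type v} [Quiver.{w} Q] [Fintype Q] [DecidableEq Q]
  [IsSimplyLacedDynkin Q]

local notation "ε" i:max => (Pi.single i (1 : ℝ) : _ → ℝ)

variable {E : Q → Q → Prop} {i : Q} {l : List Q}

/-- The reflection functor acts on dimension vectors as the simple reflection. -/
theorem Refl.rdim_eq {M M' : GRep k Q} (hE : IsOrientation E) (h : Adm E (i :: l))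
    (hM : IsRep E (i :: l) M) (hi : M.InjAt i) (R : Refl (E i) i M M') :
    M'.rdim = simpleReflection i M.rdim := by
  classical
  funext a
  by_cases ha : a = i
  · subst ha
    rw [simpleReflection_apply_self, symForm_single_left]
    have h1 := R.dim_add_dim hi
    have h2 : (M'.dim a : ℝ) + M.dim a = ∑ j, if E a j then (M.dim j : ℝ) else 0 := by
      exact_mod_cast h1
    have h3 : ∑ j, (if (underlyingGraph Q).Adj a j then M.rdim j else 0) =
        ∑ j, if E a j then (M.dim j : ℝ) else 0 := by
      refine Finset.sum_congr rfl fun j _ => ?_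
      rw [hE a j]
      by_cases hj : E a j
      · simp [hj, rdim]
      by_cases hj' : E j a
      · have : j ∉ a :: l := fun hm => h.source j hm hj'
        have : M.dim j = 0 := dim_eq_zero_iff.2 (hM.2 j this)
        simp [hj, hj', rdim, this]
      · simp [hj, hj']
    rw [h3, ← h2]
    simp only [rdim]
    ring
  · rw [simpleReflection_apply_of_ne ha]
    exact congrArg _ (R.dim_of_ne ha)

/-- The conclusion of Gabriel's theorem for the representation `M`. -/
def IsRigidRoot (E : Q → Q → Prop) (l : List Q) (M : GRep k Q) : Prop :=
  M.rdim ∈ posRoots Q ∧ ∀ N, IsRep E l N → N.IsIndec → N.dim = M.dim → Iso M N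

/-- A counterexample to Gabriel's theorem is not simple at the source, so it has a reflection, which
is again a counterexample. -/
theorem exists_refl_of_not_isRigidRoot (hE : IsOrientation E) (h : Adm E (i :: l)) {M : GRep k Q}
    (hM : IsRep E (i :: l) M) (hI : M.IsIndec) (hn : ¬ IsRigidRoot E (i :: l) M) :
    ∃ M' : GRep k Q, IsRep (reflectAt E i) (l ++ [i]) M' ∧ M'.IsIndec ∧
      ¬ IsRigidRoot (reflectAt E i) (l ++ [i]) M' ∧ M'.rdim = simpleReflection i M.rdim := by
  rcases hI.dim_eq_single_or_injAt (hM.source_into_zero h) with hd | hi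
  · refine absurd ⟨?_, fun N hN _ hNd => ?_⟩ hn
    · rw [rdim_eq_single_iff.2 hd]
      exact single_mem_posRoots i
    · exact iso_of_dim_eq_of_zero (dim_single_map_zero h.loopless hM hd)
        (dim_single_map_zero h.loopless hN (hNd.trans hd)) hNd.symm
  · obtain ⟨M', hM', ⟨R⟩⟩ := exists_refl_of_source h hM
    have hr := R.rdim_eq hE h hM hi
    refine ⟨M', hM', (R.isIndec_iff hi).1 hI, fun ⟨h1, h2⟩ => hn ⟨⟨isNat_rdim M, ?_⟩, ?_⟩, hr⟩
    · rw [← symForm_simpleReflection i, ← hr]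
      exact h1.2
    · intro N hN hNI hNd
      have hi' : N.InjAt i := (hNI.dim_eq_single_or_injAt (hN.source_into_zero h)).resolve_left
        fun h' => hi.dim_ne_single (hM.source_into_zero h) (hNd.symm.trans h')
      obtain ⟨N', hN', ⟨S⟩⟩ := exists_refl_of_source h hN
      refine R.iso_of_iso S hi hi' (h2 N' hN' ((S.isIndec_iff hi').1 hNI) ?_)
      rw [← rdim_eq_iff, hr, S.rdim_eq hE h hN hi', rdim_eq_iff.2 hNd]

/-- A counterexample to Gabriel's theorem can be reflected successively at the vertices in `a`. -/
theorem exists_of_not_isRigidRoot (a b : List Q) (hE : IsOrientation E) (h : Adm E (a ++ b))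
    {M : GRep k Q} (hM : IsRep E (a ++ b) M) (hI : M.IsIndec) (hn : ¬ IsRigidRoot E (a ++ b) M) :
    ∃ (E' : Q → Q → Prop) (M' : GRep k Q), IsOrientation E' ∧ Adm E' (b ++ a) ∧
      IsRep E' (b ++ a) M' ∧ M'.IsIndec ∧ ¬ IsRigidRoot E' (b ++ a) M' ∧
      M'.rdim = (wordProd a)⁻¹ M.rdim := by
  induction a generalizing E M b with
  | nil => exact ⟨E, M, hE, by simpa using h, by simpa using hM, hI, by simpa using hn, by simp⟩
  | cons i a ih =>
    obtain ⟨M', hM', hI', hn', hr⟩ := exists_refl_of_not_isRigidRoot hE h hM hI hn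
    have e : a ++ b ++ [i] = a ++ (b ++ [i]) := List.append_assoc ..
    have hA := h.reflect
    rw [List.append_eq] at *
    rw [e] at hM' hn' hA
    obtain ⟨E'', M'', h1, h2, h3, h4, h5, h6⟩ := ih _ (hE.reflect i) hA hM' hI' hn'
    have e' : b ++ [i] ++ a = b ++ i :: a := by simp
    rw [e'] at h2 h3 h5
    exact ⟨E'', M'', h1, h2, h3, h4, h5, by
      rw [h6, hr, wordProd_cons, mul_inv_rev, simpleReflection_inv, LinearEquiv.mul_apply]⟩

/-- Gabriel's theorem: the dimension vector of an indecomposable representation is a positive root,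
and it determines the representation. As long as this fails for `M`, reflection functors can be
applied to `M`, and the powers of a Coxeter element keep its dimension vector positive. -/
theorem isRigidRoot (hE : IsOrientation E) (h : Adm E l) {M : GRep k Q} (hM : IsRep E l M)
    (hI : M.IsIndec) : IsRigidRoot E l M := by
  by_contra hn
  have key : ∀ n : ℕ, ∃ (E' : Q → Q → Prop) (M' : GRep k Q), IsOrientation E' ∧ Adm E' l ∧
      IsRep E' l M' ∧ M'.IsIndec ∧ ¬ IsRigidRoot E' l M' ∧
      M'.rdim = ((wordProd l)⁻¹ ^ n) M.rdim := by
    intro n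
    induction n with
    | zero => exact ⟨E, M, hE, h, hM, hI, hn, rfl⟩
    | succ n ih =>
      obtain ⟨E', M', h1, h2, h3, h4, h5, h6⟩ := ih
      obtain ⟨E'', M'', h1', h2', h3', h4', h5', h6'⟩ := exists_of_not_isRigidRoot l [] h1
        (by simpa using h2) (by simpa using h3) h4 (by simpa using h5)
      exact ⟨E'', M'', h1', h2', h3', h4', h5', by
        rw [h6', h6, pow_succ', LinearEquiv.mul_apply]⟩
  obtain ⟨n, hn⟩ := exists_wordProd_inv_pow_not_isNat h.nodup (x := M.rdim)
    (fun i hi => Nat.cast_eq_zero.2 (dim_eq_zero_iff.2 (hM.2 i hi))) (rdim_ne_zero hI.1)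
  obtain ⟨E', M', -, -, -, -, -, h6⟩ := key n
  exact hn (h6 ▸ isNat_rdim M')

end GRep

namespace GRep

/-! ### Torsion classes and reflections -/

section tors

variable {k : Type u} [Field k] {V : Type v}

/-- Torsion classes of representations of the orientation `E`, supported on the vertices in `l`.
Closure under extensions is stated for sequences that are exact in the middle and on the right; by
closure under quotients, injectivity on the left makes no difference. -/
structure IsTors (E : V → V → Prop) (l : List V) (P : GRep k V → Prop) : Prop where
  isRep : ∀ M, P M → IsRep E l M
  zero : ∀ M, M.IsZero → P M
  quot : ∀ {M N} (F : Hom M N), F.Surj → P M → P N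
  ext : ∀ {A B C} (F : Hom A B) (G : Hom B C), IsRep E l B → F.Exact G → G.Surj → P A → P C → P B

/-- The real dimension vectors of the indecomposable objects of a class. -/
def indSet (P : GRep k V → Prop) : Set (V → ℝ) := {α | ∃ M, P M ∧ M.IsIndec ∧ M.rdim = α}

/-- The kernel of a morphism. -/
def ker {M N : GRep k V} (F : Hom M N) : GRep k V where
  X a := LinearMap.ker (F.φ a)
  f a b := (M.f a b).restrict fun x hx => by
    rw [LinearMap.mem_ker] at hx ⊢
    rw [F.comm, hx, map_zero]

/-- The inclusion of the kernel. -/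
def kerι {M N : GRep k V} (F : Hom M N) : Hom (ker F) M where
  φ a := (LinearMap.ker (F.φ a)).subtype
  comm _ _ _ := rfl

theorem kerι_exact {M N : GRep k V} (F : Hom M N) : (kerι F).Exact F :=
  fun _ y => ⟨fun hy => ⟨⟨y, hy⟩, rfl⟩, fun ⟨x, hx⟩ => hx ▸ x.2⟩

theorem ker_isRep {E : V → V → Prop} {l : List V} {M N : GRep k V} (h : IsRep E l M)
    (F : Hom M N) : IsRep E l (ker F) :=
  ⟨fun a b hab x => Subtype.ext (h.1 a b hab x.1), fun a ha x => Subtype.ext (h.2 a ha x.1)⟩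

variable {E : V → V → Prop} {l l' : List V} {P P' : GRep k V → Prop}

theorem IsRep.mono (hl : ∀ a, a ∈ l → a ∈ l') {M : GRep k V} (h : IsRep E l M) : IsRep E l' M :=
  ⟨h.1, fun a ha => h.2 a fun h => ha (hl a h)⟩

theorem IsTors.iso (hP : IsTors E l P) {M N : GRep k V} (h : Iso M N) (hM : P M) : P N := by
  obtain ⟨F, G, -, h2⟩ := h
  exact hP.quot F (fun a x => ⟨G.φ a x, h2 a x⟩) hM

theorem IsTors.mono (hP : IsTors E l P) (hl : ∀ a, a ∈ l → a ∈ l') : IsTors E l' P where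
  isRep M hM := (hP.isRep M hM).mono hl
  zero := hP.zero
  quot := hP.quot
  ext {A B C} F G hB hFG hG hA hC := by
    refine hP.ext F G ⟨hB.1, fun a ha x => ?_⟩ hFG hG hA hC
    obtain ⟨y, rfl⟩ := (hFG a x).1 ((hP.isRep C hC).2 a ha _)
    rw [(hP.isRep A hA).2 a ha y, map_zero]

theorem IsTors.restrict (hP : IsTors E l P) (hl : ∀ a, a ∈ l' → a ∈ l)
    (h : ∀ M, P M → IsRep E l' M) : IsTors E l' P where
  isRep := h
  zero := hP.zero
  quot := hP.quot
  ext F G hB := hP.ext F G (hB.mono hl)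

theorem isTors_isZero (E : V → V → Prop) (l : List V) : IsTors E l (IsZero (k := k) (V := V)) where
  isRep M hM := hM.isRep E l
  zero _ h := h
  quot F hF hM a x := by
    obtain ⟨y, rfl⟩ := hF a x
    rw [hM a y, map_zero]
  ext F G _ hFG _ hA hC a x := by
    obtain ⟨y, rfl⟩ := (hFG a x).1 (hC a _)
    rw [hA a y, map_zero]

theorem indSet_isZero : indSet (IsZero (k := k) (V := V)) = ∅ :=
  Set.eq_empty_of_forall_notMem fun _ ⟨_, hM, hI, _⟩ => hI.1 hM

/-- A nonzero functional at `i` that vanishes on the images of all structure maps gives a morphism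
onto the simple representation. -/
theorem exists_surj_simple [DecidableEq V] {i : V} {M : GRep k V} (t : Module.Dual k (M.X i))
    (ht : t ≠ 0) (h : ∀ a x, t (M.f a i x) = 0) : ∃ F : Hom M (simple k i), F.Surj := by
  have hg : ∀ a, ∃ g : M.X a →ₗ[k] (Fin (if a = i then 1 else 0) → k), Function.Surjective g ∧
      ∀ b x, g (M.f b a x) = 0 := by
    intro a
    by_cases ha : a = i
    · subst ha
      refine ⟨LinearMap.pi fun _ => t, fun z => ?_, fun b x => funext fun _ => h b x⟩
      obtain ⟨y, hy⟩ := LinearMap.surjective ht (z ⟨0, by simp⟩)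
      refine ⟨y, funext fun m => ?_⟩
      rw [LinearMap.pi_apply, hy]
      congr 1
      apply Fin.ext
      have h1 := m.2
      have h2 : (if a = a then 1 else 0) = 1 := if_pos rfl
      change 0 = m.val
      omega
    · refine ⟨0, fun z => ⟨0, funext fun m => absurd m.2 (by simp [ha])⟩, fun b x => rfl⟩
  choose g hg1 hg2 using hg
  exact ⟨⟨g, fun a b x => hg2 b a x⟩, hg1⟩

/-- If a torsion class has an object that does not vanish at the source `i`, then it contains the
simple object at `i`, which is a quotient. -/
theorem IsTors.simple_mem_or [DecidableEq V] {i : V} (hP : IsTors E (i :: l) P)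
    (hA : Adm E (i :: l)) : P (simple k i) ∨ IsTors E l P := by
  by_cases h : ∀ M, P M → ∀ x : M.X i, x = 0
  · refine Or.inr (hP.restrict (fun a => List.mem_cons_of_mem _) fun M hM =>
      ⟨(hP.isRep M hM).1, fun a ha x => ?_⟩)
    by_cases hai : a = i
    · subst hai; exact h M hM x
    · exact (hP.isRep M hM).2 a (by simp [hai, ha]) x
  · push Not at h
    obtain ⟨M, hM, x, hx⟩ := h
    obtain ⟨t, ht⟩ := Module.Projective.exists_dual_eq_one k hx
    obtain ⟨F, hF⟩ := exists_surj_simple t (fun h0 => by simp [h0] at ht) fun a y => by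
      rw [(hP.isRep M hM).source_into_zero hA, map_zero]
    exact Or.inl (hP.quot F hF hM)

variable [Fintype V]

theorem sum_dim_coker_lt {M N : GRep k V} (F : Hom M N) (h : ¬ ∀ a x, F.φ a x = 0) :
    ∑ a, (coker F).dim a < ∑ a, N.dim a := by
  push Not at h
  obtain ⟨a, x, hx⟩ := h
  refine Finset.sum_lt_sum (fun b _ => dim_le_of_surj (toCoker_surj F) b) ⟨a, Finset.mem_univ a, ?_⟩
  have h1 := Submodule.finrank_quotient_add_finrank (LinearMap.range (F.φ a))
  have h2 : 0 < Module.finrank k (LinearMap.range (F.φ a)) :=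
    Module.finrank_pos_iff_exists_ne_zero.2 ⟨⟨_, x, rfl⟩, fun h => hx (congrArg Subtype.val h)⟩
  change Module.finrank k (N.X a ⧸ LinearMap.range (F.φ a)) < Module.finrank k (N.X a)
  omega

/-- A torsion class is contained in another one as soon as its indecomposable objects are. -/
theorem IsTors.le_of_indec (hP : IsTors E l P) (hP' : IsTors E l P')
    (h : ∀ M, P M → M.IsIndec → P' M) (M : GRep k V) (hM : P M) : P' M := by
  induction hn : ∑ a, M.dim a using Nat.strong_induction_on generalizing M with
  | _ n ih =>
    by_cases hz : M.IsZero
    · exact hP'.zero M hz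
    by_cases hI : M.IsIndec
    · exact h M hM hI
    obtain ⟨e, he, h0, h1⟩ : ∃ e : Hom M M, (∀ a x, e.φ a (e.φ a x) = e.φ a x) ∧
        (¬ ∀ a x, e.φ a x = 0) ∧ ¬ ∀ a x, e.φ a x = x := by
      by_contra hc
      push Not at hc
      refine hI ⟨hz, fun e he => or_iff_not_imp_left.2 fun h0 => ?_⟩
      push Not at h0
      exact hc e he h0
    have hA : P' (coker e) :=
      ih _ (hn ▸ sum_dim_coker_lt e h0) _ (hP.quot _ (toCoker_surj e) hM) rfl
    have h1' : ¬ ∀ a x, e.compl.φ a x = 0 := fun hc => h1 fun a x => by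
      have h2 : x - e.φ a x = 0 := hc a x
      exact (sub_eq_zero.1 h2).symm
    have hB : P' (coker e.compl) :=
      ih _ (hn ▸ sum_dim_coker_lt e.compl h1') _ (hP.quot _ (toCoker_surj _) hM) rfl
    -- `M / (1 - e)M` is the image of `e`, so that it is the kernel of `M ⟶ M / eM`.
    have h2 : ∀ a x, e.φ a (e.compl.φ a x) = 0 := fun a x => by
      change e.φ a (x - e.φ a x) = 0
      rw [map_sub, he, sub_self]
    refine hP'.ext (cokerDesc e.compl e h2) (toCoker e) (hP.isRep M hM) (fun a y => ?_)
      (toCoker_surj e) hB hA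
    rw [exact_toCoker e a y]
    constructor
    · rintro ⟨x, rfl⟩
      exact ⟨(toCoker e.compl).φ a x, rfl⟩
    · rintro ⟨x, rfl⟩
      obtain ⟨y, rfl⟩ := toCoker_surj e.compl a x
      exact ⟨y, rfl⟩

theorem Refl.restrict_surj {A : V → Prop} {i : V} {M M' N N' : GRep k V} {R : Refl A i M M'}
    {S : Refl A i N N'} {F : Hom M N} {F' : Hom M' N'} (h : Refl.Agree R S F F') (hF : F'.Surj)
    (a : V) (ha : a ≠ i) : Function.Surjective (F.φ a) := by
  intro z
  obtain ⟨x, hx⟩ := hF a (S.u a z)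
  exact ⟨R.v a x, by rw [h.v a ha, hx, S.vu a ha]⟩

variable [DecidableEq V] {i : V}

/-- The objects of a torsion class without the simple object at `i` have no summands that are simple
at `i`. -/
theorem IsTors.surjAt (hP : IsTors E l P) (hi : ¬ P (simple k i)) {M : GRep k V} (hM : P M) :
    M.SurjAt i := by
  by_contra hn
  let p : (∀ j, M.X j) →ₗ[k] M.X i := ∑ j, (M.f j i).comp (LinearMap.proj j)
  have hp : ∀ y, p y = ∑ j, M.f j i (y j) := fun y => by simp [p]
  have hlt : LinearMap.range p < ⊤ := by
    rw [lt_top_iff_ne_top]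
    intro h
    rw [LinearMap.range_eq_top] at h
    exact hn fun z => (h z).imp fun y hy => (hp y).symm.trans hy
  obtain ⟨t, ht, hle⟩ := Submodule.exists_le_ker_of_lt_top _ hlt
  obtain ⟨F, hF⟩ := exists_surj_simple t ht fun a x => by
    have h1 : p (Pi.single a x) = M.f a i x := by
      rw [hp, Finset.sum_eq_single a]
      · rw [Pi.single_eq_same]
      · intro b _ hb; rw [Pi.single_eq_of_ne hb, map_zero]
      · simp
    exact h1 ▸ hle ⟨_, rfl⟩
  exact hi (hP.quot F hF hM)

/-- A torsion class that contains the simple object at `i` contains all objects supported at `i`. -/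
theorem IsTors.of_supported (hP : IsTors E l P) (hE : ∀ a, ¬ E a a) (hS : P (simple k i))
    {M : GRep k V} (hM : IsRep E l M) (h : ∀ a, a ≠ i → ∀ x : M.X a, x = 0) : P M := by
  induction hn : ∑ a, M.dim a using Nat.strong_induction_on generalizing M with
  | _ n ih =>
    by_cases hz : M.IsZero
    · exact hP.zero M hz
    obtain ⟨x, hx⟩ : ∃ x : M.X i, x ≠ 0 := by
      by_contra! hc
      exact hz fun a x => by
        by_cases ha : a = i
        · subst ha; exact hc x
        · exact h a ha x
    obtain ⟨F, s, rfl⟩ := exists_hom_simple (M := M) (x := x) fun b => by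
      by_cases hb : b = i
      · subst hb; exact hM.1 _ _ (hE _) _
      · exact h b hb _
    have hlt := sum_dim_coker_lt F fun hc => hx (hc i s)
    refine hP.ext F (toCoker F) hM (exact_toCoker F) (toCoker_surj F) hS
      (ih _ (hn ▸ hlt) (hM.of_surj (toCoker_surj F)) (fun a ha y => ?_) rfl)
    obtain ⟨z, rfl⟩ := toCoker_surj F a y
    rw [h a ha z, map_zero]

/-- A torsion class that contains the simple object at `i` contains a representation if one of its
objects maps to it surjectively away from `i`. -/
theorem IsTors.of_surj_off (hP : IsTors E l P) (hE : ∀ a, ¬ E a a) (hS : P (simple k i))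
    {M N : GRep k V} (hM : P M) (hN : IsRep E l N) (F : Hom M N)
    (hF : ∀ a, a ≠ i → Function.Surjective (F.φ a)) : P N := by
  refine hP.ext F (toCoker F) hN (exact_toCoker F) (toCoker_surj F) hM
    (hP.of_supported hE hS (hN.of_surj (toCoker_surj F)) fun a ha y => ?_)
  obtain ⟨z, rfl⟩ := toCoker_surj F a y
  obtain ⟨x, rfl⟩ := hF a ha z
  exact (exact_toCoker F a _).2 ⟨x, rfl⟩

/-- A torsion class that contains the simple object at `i` contains a representation that maps onto
one of its objects, injectively away from `i`. -/
theorem IsTors.of_inj_off (hP : IsTors E l P) (hE : ∀ a, ¬ E a a) (hS : P (simple k i))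
    {M N : GRep k V} (hM : IsRep E l M) (hN : P N) (F : Hom M N) (hF : F.Surj)
    (hF' : ∀ a, a ≠ i → ∀ x, F.φ a x = 0 → x = 0) : P M :=
  hP.ext (kerι F) F hM (kerι_exact F) hF
    (hP.of_supported hE hS (ker_isRep hM F) fun a ha x => Subtype.ext (hF' a ha x.1 x.2)) hN

/-- The reflections of the objects of a class, at a source `i`. -/
def reflDown (E : V → V → Prop) (i : V) (l : List V) (P : GRep k V → Prop) (M' : GRep k V) : Prop :=
  IsRep (reflectAt E i) (l ++ [i]) M' ∧ ∃ M, P M ∧ Nonempty (Refl (E i) i M M')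

/-- The objects whose reflections at a source `i` belong to a class. -/
def reflUp (E : V → V → Prop) (i : V) (l : List V) (P' : GRep k V → Prop) (M : GRep k V) : Prop :=
  IsRep E (i :: l) M ∧ ∃ M', P' M' ∧ Nonempty (Refl (E i) i M M')

theorem Refl.lift_surj {A : V → Prop} {M M' N N' : GRep k V} {R : Refl A i M M'}
    {S : Refl A i N N'} {F : Hom M N} {F' : Hom M' N'} (h : Refl.Agree R S F F') (hF : F.Surj) :
    F'.Surj := by
  intro a z
  by_cases ha : a = i
  · subst ha
    obtain ⟨y, rfl⟩ := S.surj z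
    choose x hx using fun j => hF j (y j)
    refine ⟨_, (h.sum x).trans ?_⟩
    simp only [hx]
  · obtain ⟨x, hx⟩ := hF a (S.v a z)
    exact ⟨R.u a x, by rw [h a ha, hx, S.uv a ha]⟩

/-- Membership in a torsion class that contains the simple object at `i` depends only on the
reflection, among objects without simple summands at `i`. -/
theorem IsTors.mem_of_refl (hP : IsTors E (i :: l) P) (hA : Adm E (i :: l)) (hS : P (simple k i))
    {M N M' : GRep k V} (hM : P M) (R : Refl (E i) i M M') (hN : IsRep E (i :: l) N)
    (hi : N.InjAt i) (S : Refl (E i) i N M') : P N := by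
  obtain ⟨F, hF⟩ := R.exists_restrict S hi (Hom.id M')
  exact hP.of_surj_off hA.loopless hS hM hN F
    (Refl.restrict_surj hF fun a x => ⟨x, rfl⟩)

/-- Extensions and quotients of reflected objects are reflections of objects `N` without simple
summands at `i`; morphisms to such `N` restrict, and surjectivity and exactness survive away from
`i`. The defect at `i` is supported at `i`, so it is absorbed by the simple object. -/
theorem IsTors.reflDown (hP : IsTors E (i :: l) P) (hA : Adm E (i :: l)) (hS : P (simple k i)) :
    IsTors (reflectAt E i) (l ++ [i]) (reflDown E i l P) where
  isRep _ h := h.1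
  zero M' h := by
    have hs : M'.SurjAt i := fun z => ⟨0, by
      rw [h i z]; exact Finset.sum_eq_zero fun j _ => map_zero _⟩
    obtain ⟨M, hM, hi, ⟨R⟩⟩ := exists_refl_of_sink hA (h.isRep _ _) hs
    exact ⟨h.isRep _ _, M, hP.zero M ((R.isZero_iff hi).2 h), ⟨R⟩⟩
  quot {M' N'} F' hF' := by
    rintro ⟨hM', M, hM, ⟨R⟩⟩
    have hN' := hM'.of_surj hF'
    have hs : N'.SurjAt i := fun z => by
      obtain ⟨x, rfl⟩ := hF' i z
      obtain ⟨y, rfl⟩ := R.surjAt x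
      exact ⟨fun j => F'.φ j (y j), by rw [map_sum]; simp only [F'.comm]⟩
    obtain ⟨N, hN, hi, ⟨S⟩⟩ := exists_refl_of_sink hA hN' hs
    obtain ⟨F, hF⟩ := R.exists_restrict S hi F'
    exact ⟨hN', N, hP.of_surj_off hA.loopless hS hM hN F (Refl.restrict_surj hF hF'), ⟨S⟩⟩
  ext {A' B' C'} F' G' hB' hFG hG := by
    rintro ⟨hA', A, hAP, ⟨RA⟩⟩ ⟨hC', C₀, hC₀, ⟨RC₀⟩⟩
    obtain ⟨C, hC, hCi, ⟨RC⟩⟩ := exists_refl_of_sink hA hC' RC₀.surjAt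
    have hCP := hP.mem_of_refl hA hS hC₀ RC₀ hC hCi RC
    have hs : B'.SurjAt i := fun z => by
      obtain ⟨y, hy⟩ := RC.surjAt (G'.φ i z)
      choose y' hy' using fun j => hG j (y j)
      have h1 : G'.φ i (z - ∑ j, B'.f j i (y' j)) = 0 := by
        rw [map_sub, map_sum, ← hy, sub_eq_zero]
        exact Finset.sum_congr rfl fun j _ => by rw [G'.comm, hy']
      obtain ⟨x, hx⟩ := (hFG i _).1 h1
      obtain ⟨t, rfl⟩ := RA.surjAt x
      refine ⟨fun j => F'.φ j (t j) + y' j, ?_⟩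
      rw [map_sum] at hx
      simp only [map_add, Finset.sum_add_distrib, ← F'.comm, hx, sub_add_cancel]
    obtain ⟨B, hB, hBi, ⟨RB⟩⟩ := exists_refl_of_sink hA hB' hs
    obtain ⟨F, hF⟩ := RA.exists_restrict RB hBi F'
    obtain ⟨G, hGa⟩ := RB.exists_restrict RC hCi G'
    have hoff : ∀ a, a ≠ i → ∀ y, G.φ a y = 0 ↔ ∃ x, F.φ a x = y := by
      intro a ha y
      constructor
      · intro h
        obtain ⟨x, hx⟩ := (hFG a (RB.u a y)).1 (by rw [hGa a ha, h, map_zero])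
        exact ⟨RA.v a x, by rw [hF.v a ha, hx, RB.vu a ha]⟩
      · rintro ⟨x, rfl⟩
        rw [← RC.vu a ha (G.φ a _), ← hGa a ha, ← hF a ha, (hFG a _).2 ⟨_, rfl⟩, map_zero]
    have hGF : ∀ a x, G.φ a (F.φ a x) = 0 :=
      Refl.ext_of_injAt (F := F.comp G) (G := ⟨fun _ => 0, fun _ _ _ => by simp⟩) hCi
        (RC.into_zero i) fun a ha x => (hoff a ha _).2 ⟨x, rfl⟩
    refine ⟨hB', B, hP.ext F (toCoker F) hB (exact_toCoker F) (toCoker_surj F) hAP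
      (hP.of_inj_off hA.loopless hS (hB.of_surj (toCoker_surj F)) hCP (cokerDesc F G hGF) ?_ ?_),
      ⟨RB⟩⟩
    · have hGs : G.Surj := by
        intro a c
        by_cases ha : a = i
        · subst ha
          choose y hy using fun j => show ∃ y, j ≠ a → G.φ j y = C.f a j c from by
            by_cases hj : j = a
            · exact ⟨0, fun h => absurd hj h⟩
            · obtain ⟨y, hy⟩ := Refl.restrict_surj hGa hG j hj (C.f a j c)
              exact ⟨y, fun _ => hy⟩
          have h1 : G'.φ a (∑ j, B'.f j a (RB.u j (y j))) = 0 := by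
            rw [hGa.sum, ← RC.comp_zero c]
            refine Finset.sum_congr rfl fun j _ => ?_
            by_cases hj : j = a
            · subst hj; rw [RC.out_zero', RC.out_zero']
            · rw [hy j hj]
          obtain ⟨x, hx⟩ := (hFG a _).1 h1
          obtain ⟨t, rfl⟩ := RA.surj x
          rw [hF.sum] at hx
          obtain ⟨b, hb⟩ := RB.exact (fun j => y j - F.φ j (t j)) (by
            simp only [map_sub, Finset.sum_sub_distrib, hx, sub_self])
          refine ⟨b, ?_⟩
          rw [← sub_eq_zero]
          refine hCi _ fun j => ?_
          rw [map_sub, ← G.comm, sub_eq_zero]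
          by_cases hj : E a j
          · have hja : j ≠ a := fun h => hA.loopless a (h ▸ hj)
            rw [hb j hj, map_sub, hGF, sub_zero, hy j hja]
          · rw [RB.out_zero j hj, RC.out_zero j hj, map_zero]
        · exact Refl.restrict_surj hGa hG a ha c
      intro a c
      obtain ⟨b, rfl⟩ := hGs a c
      exact ⟨(toCoker F).φ a b, rfl⟩
    · intro a ha x hx
      obtain ⟨y, rfl⟩ := toCoker_surj F a x
      exact (exact_toCoker F a y).2 ((hoff a ha y).1 hx)

/-- The reflection functor at a source is right exact. -/
theorem IsTors.reflUp (hP : IsTors (reflectAt E i) (l ++ [i]) P') (hA : Adm E (i :: l)) :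
    IsTors E (i :: l) (reflUp E i l P') where
  isRep _ h := h.1
  zero M h := by
    obtain ⟨M', hM', ⟨R⟩⟩ := exists_refl_of_source hA (h.isRep _ _)
    exact ⟨h.isRep _ _, M', hP.zero M' ((R.isZero_iff fun x _ => h i x).1 h), ⟨R⟩⟩
  quot {M N} F hF := by
    rintro ⟨hM, M', hM', ⟨R⟩⟩
    have hN := hM.of_surj hF
    obtain ⟨N', hN', ⟨S⟩⟩ := exists_refl_of_source hA hN
    obtain ⟨F', hF'⟩ := R.exists_lift S F
    exact ⟨hN, N', hP.quot F' (Refl.lift_surj hF' hF) hM', ⟨S⟩⟩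
  ext {A B C} F G hB hFG hG := by
    rintro ⟨hAr, A', hA', ⟨RA⟩⟩ ⟨hC, C', hC', ⟨RC⟩⟩
    obtain ⟨B', hB', ⟨RB⟩⟩ := exists_refl_of_source hA hB
    obtain ⟨F', hF'⟩ := RA.exists_lift RB F
    obtain ⟨G', hG'⟩ := RB.exists_lift RC G
    refine ⟨hB, B', hP.ext F' G' hB' ?_ (Refl.lift_surj hG' hG) hA' hC', ⟨RB⟩⟩
    have hGF : ∀ a x, G'.φ a (F'.φ a x) = 0 :=
      RA.ext_of_agree (F := F'.comp G') (G := ⟨fun _ => 0, fun _ _ _ => by simp⟩) fun a ha x => by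
        change G'.φ a (F'.φ a x) = 0
        rw [← RA.uv a ha x, hF' a ha, hG' a ha, (hFG a _).2 ⟨_, rfl⟩, map_zero]
    intro a y
    refine ⟨fun h => ?_, fun ⟨x, hx⟩ => hx ▸ hGF a x⟩
    by_cases ha : a = i
    · subst ha
      obtain ⟨t, rfl⟩ := RB.surj y
      rw [hG'.sum] at h
      obtain ⟨c, hc⟩ := RC.exact _ h
      obtain ⟨b, rfl⟩ := hG a c
      choose x hx using fun j => show ∃ x, E a j → F.φ j x = t j - B.f a j b from by
        by_cases hj : E a j
        · obtain ⟨x, hx⟩ := (hFG j (t j - B.f a j b)).1 (by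
            rw [map_sub, G.comm, hc j hj, sub_self])
          exact ⟨x, fun _ => hx⟩
        · exact ⟨0, fun h => absurd h hj⟩
      refine ⟨∑ j, A'.f j a (RA.u j (x j)), ?_⟩
      rw [hF'.sum, ← sub_zero (∑ j, B'.f j a (RB.u j (t j))), ← RB.comp_zero b,
        ← Finset.sum_sub_distrib]
      refine Finset.sum_congr rfl fun j _ => ?_
      by_cases hj : E a j
      · rw [hx j hj, map_sub, map_sub]
      · rw [RB.into_zero' j hj, RB.into_zero' j hj, RB.into_zero' j hj, sub_zero]
    · obtain ⟨x, hx⟩ := (hFG a (RB.v a y)).1 (by rw [hG'.v a ha, h, map_zero])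
      exact ⟨RA.u a x, by rw [hF' a ha, hx, RB.uv a ha]⟩

/-- The map to the space at `i` of a reflected object is onto, so this object is not the simple one
at `i`. -/
theorem not_reflDown_simple : ¬ GRep.reflDown E i l P (simple k i) := by
  rintro ⟨-, M, -, ⟨R⟩⟩
  have h1 := congr_fun (dim_simple (k := k) i) i
  rw [Pi.single_eq_same] at h1
  refine one_ne_zero (h1.symm.trans (dim_eq_zero_iff.2 fun z => ?_))
  obtain ⟨y, rfl⟩ := R.surjAt z
  exact Finset.sum_eq_zero fun j _ => rfl

/-- The reflection functor takes the simple object at the source to zero. -/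
theorem IsTors.reflUp_simple (hP : IsTors (reflectAt E i) (l ++ [i]) P') (hA : Adm E (i :: l)) :
    GRep.reflUp E i l P' (simple k i) := by
  have hr : IsRep E (i :: l) (simple k i) := simple_isRep E List.mem_cons_self
  obtain ⟨M', hM', ⟨R⟩⟩ := exists_refl_of_source hA hr
  have h0 : ∀ a, a ≠ i → ∀ x : (simple k i).X a, x = 0 := fun a ha =>
    dim_eq_zero_iff.1 (by rw [dim_simple, Pi.single_eq_of_ne ha])
  refine ⟨hr, M', hP.zero M' fun a z => ?_, ⟨R⟩⟩
  by_cases ha : a = i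
  · subst ha
    obtain ⟨y, rfl⟩ := R.surj z
    refine Finset.sum_eq_zero fun j _ => ?_
    by_cases hj : j = a
    · subst hj; exact R.out_zero' _ _
    · rw [h0 j hj (y j), map_zero, map_zero]
  · rw [← R.uv a ha z, h0 a ha (R.v a z), map_zero]

end tors
end GRep

namespace GRep

/-! ### Torsion classes and sortable elements -/

section sortable

theorem IsTors.single_mem_indSet_iff {k : Type u} [Field k] {V : Type v} [DecidableEq V]
    {E : V → V → Prop} {i : V} {l : List V} {P : GRep k V → Prop} (hP : IsTors E l P)
    (hA : Adm E l) (hi : i ∈ l) :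
    Pi.single i 1 ∈ indSet P ↔ P (simple k i) := by
  constructor
  · rintro ⟨M, hM, hI, hd⟩
    rw [rdim_eq_single_iff] at hd
    have hs := simple_isRep (k := k) E hi
    exact hP.iso (iso_of_dim_eq_of_zero (dim_single_map_zero hA.loopless (hP.isRep M hM) hd)
      (dim_single_map_zero hA.loopless hs (dim_simple i)) (hd.trans (dim_simple i).symm)) hM
  · intro h
    exact ⟨_, h, isIndec_of_dim_eq_single (dim_simple i), rdim_eq_single_iff.2 (dim_simple i)⟩

/-- A vertex that is not adjacent to any vertex before it in a consistent ordering can be moved to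
the front. -/
theorem Adm.move_to_front {Q : Type v} [Quiver.{w} Q] {E : Q → Q → Prop} {i : Q} {a b : List Q}
    (hE : IsOrientation E) (h : Adm E (a ++ i :: b))
    (ha : ∀ j ∈ a, ¬ (underlyingGraph Q).Adj i j) : Adm E (i :: (a ++ b)) := by
  have hp := List.pairwise_append.1 h.pairwise
  have hp' := List.pairwise_cons.1 hp.2.1
  refine ⟨List.nodup_middle.1 h.nodup, List.pairwise_cons.2 ⟨fun j hj => ?_,
    List.pairwise_append.2 ⟨hp.1, hp'.2, fun x hx y hy => hp.2.2 x hx y (by simp [hy])⟩⟩,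
    h.loopless⟩
  rcases List.mem_append.1 hj with hj | hj
  · exact fun hji => ha j hj ((hE i j).2 (Or.inr hji))
  · exact hp'.1 j hj

variable {k : Type u} [Field k] {Q : Type v} [Quiver.{w} Q] [Fintype Q] [DecidableEq Q]
  [IsSimplyLacedDynkin Q] {E : Q → Q → Prop} {i : Q} {l : List Q} {P P' : GRep k Q → Prop}

local notation "ε" i:max => (Pi.single i (1 : ℝ) : _ → ℝ)

theorem IsTors.indSet_subset (hP : IsTors E l P) (hE : IsOrientation E) (hA : Adm E l) :
    indSet P ⊆ posRoots Q := by
  rintro _ ⟨M, hM, hI, rfl⟩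
  exact (isRigidRoot hE hA (hP.isRep M hM) hI).1

/-- Reflection is a bijection between the indecomposable objects other than the simple one at the
source and the indecomposable objects of the reflected torsion class. -/
theorem IsTors.indSet_reflDown (hP : IsTors E (i :: l) P) (hE : IsOrientation E)
    (hA : Adm E (i :: l)) (hS : P (simple k i)) :
    indSet P = insert (ε i) (simpleReflection i '' indSet (GRep.reflDown E i l P)) := by
  apply Set.Subset.antisymm
  · rintro _ ⟨M, hM, hI, rfl⟩
    have hr := hP.isRep M hM
    rcases hI.dim_eq_single_or_injAt (hr.source_into_zero hA) with hd | hi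
    · exact Or.inl (rdim_eq_single_iff.2 hd)
    · obtain ⟨M', hM', ⟨R⟩⟩ := exists_refl_of_source hA hr
      refine Or.inr ⟨M'.rdim, ⟨M', ⟨hM', M, hM, ⟨R⟩⟩, (R.isIndec_iff hi).1 hI, rfl⟩, ?_⟩
      rw [R.rdim_eq hE hA hr hi, simpleReflection_simpleReflection]
  · rintro _ (rfl | ⟨_, ⟨M', ⟨hM', M₀, hM₀, ⟨R₀⟩⟩, hI, rfl⟩, rfl⟩)
    · exact (hP.single_mem_indSet_iff hA List.mem_cons_self).2 hS
    · obtain ⟨M, hM, hi, ⟨R⟩⟩ := exists_refl_of_sink hA hM' R₀.surjAt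
      refine ⟨M, hP.mem_of_refl hA hS hM₀ R₀ hM hi R, (R.isIndec_iff hi).2 hI, ?_⟩
      rw [R.rdim_eq hE hA hM hi, simpleReflection_simpleReflection]

theorem IsTors.indSet_reflUp (hP : IsTors (reflectAt E i) (l ++ [i]) P') (hE : IsOrientation E)
    (hA : Adm E (i :: l)) (hS : ¬ P' (simple k i)) :
    indSet (GRep.reflUp E i l P') = insert (ε i) (simpleReflection i '' indSet P') := by
  apply Set.Subset.antisymm
  · rintro _ ⟨M, ⟨hr, M', hM', ⟨R⟩⟩, hI, rfl⟩
    rcases hI.dim_eq_single_or_injAt (hr.source_into_zero hA) with hd | hi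
    · exact Or.inl (rdim_eq_single_iff.2 hd)
    · refine Or.inr ⟨M'.rdim, ⟨M', hM', (R.isIndec_iff hi).1 hI, rfl⟩, ?_⟩
      rw [R.rdim_eq hE hA hr hi, simpleReflection_simpleReflection]
  · rintro _ (rfl | ⟨_, ⟨M', hM', hI, rfl⟩, rfl⟩)
    · exact ((hP.reflUp hA).single_mem_indSet_iff hA List.mem_cons_self).2 (hP.reflUp_simple hA)
    · obtain ⟨M, hM, hi, ⟨R⟩⟩ := exists_refl_of_sink hA (hP.isRep M' hM') (hP.surjAt hS hM')
      refine ⟨M, ⟨hM, M', hM', ⟨R⟩⟩, (R.isIndec_iff hi).2 hI, ?_⟩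
      rw [R.rdim_eq hE hA hM hi, simpleReflection_simpleReflection]

theorem wordProd_mem_closure {i : Q} {m : List Q} (h : i ∉ m) :
    wordProd m ∈ Subgroup.closure {g | ∃ j : Q, j ≠ i ∧ g = simpleReflection j} := by
  refine Subgroup.list_prod_mem _ fun g hg => ?_
  obtain ⟨j, hj, rfl⟩ := List.mem_map.1 hg
  exact Subgroup.subset_closure ⟨j, fun h' => h (h' ▸ hj), rfl⟩

/-- The dimension vectors of the indecomposable objects of a torsion class form the inversion set of
a sortable element. The induction follows the definition of sortable elements: a torsion class that
contains the simple object at the source is reflected; any other one is supported off the source. -/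
theorem IsTors.exists_sortable (hP : IsTors E l P) (hE : IsOrientation E) (hA : Adm E l) :
    ∃ m : List Q, (∀ j ∈ m, j ∈ l) ∧ inversionSet (wordProd m) = indSet P ∧
      IsSortable (wordProd l) (wordProd m) := by
  induction hn : (indSet P).ncard + l.length using Nat.strong_induction_on generalizing E l P with
  | _ n ih =>
  have hfin := (finite_posRoots Q).subset (hP.indSet_subset hE hA)
  cases l with
  | nil =>
    refine ⟨[], by simp, ?_, .one _⟩
    rw [wordProd_nil, inversionSet_one, eq_comm, Set.eq_empty_iff_forall_notMem]
    rintro _ ⟨M, hM, hI, -⟩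
    exact hI.1 fun a x => (hP.isRep M hM).2 a (by simp) x
  | cons i l =>
    have hil : i ∉ l := (List.nodup_cons.1 hA.nodup).1
    have hc : simpleReflection i * wordProd (i :: l) = wordProd l := by
      rw [wordProd_cons, ← mul_assoc, simpleReflection_mul_self, one_mul]
    rcases hP.simple_mem_or hA with hS | hP'
    · have hT := hP.reflDown hA hS
      have hind := hP.indSet_reflDown hE hA hS
      have hni : ε i ∉ indSet (GRep.reflDown E i l P) := fun h =>
        not_reflDown_simple ((hT.single_mem_indSet_iff hA.reflect (by simp)).1 h)
      have hfin' := (finite_posRoots Q).subset (hT.indSet_subset (hE.reflect i) hA.reflect)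
      have hni' : ε i ∉ simpleReflection i '' indSet (GRep.reflDown E i l P) := by
        rintro ⟨y, hy, h⟩
        have hy' : y = -ε i := by
          rw [← simpleReflection_simpleReflection i y, h, simpleReflection_single]
        exact single_ne_neg (hT.indSet_subset (hE.reflect i) hA.reflect hy) hy'
      have hcard : (indSet P).ncard = (indSet (GRep.reflDown E i l P)).ncard + 1 := by
        rw [hind, Set.ncard_insert_of_notMem hni' (hfin'.image _),
          Set.ncard_image_of_injective _ (simpleReflection i).injective]
      have hlen : (l ++ [i]).length = (i :: l).length := by simp
      obtain ⟨m, hm, hI, hsort⟩ := ih _ (by rw [← hn, hcard, hlen]; omega) hT (hE.reflect i)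
        hA.reflect rfl
      have hnot : ε i ∉ inversionSet (wordProd m) := hI ▸ hni
      have hsm : simpleReflection i * wordProd (i :: m) = wordProd m := by
        rw [wordProd_cons, ← mul_assoc, simpleReflection_mul_self, one_mul]
      refine ⟨i :: m, ?_, ?_, .descent _ _ i (isInitial_wordProd_cons hA.nodup) ?_ ?_⟩
      · intro j hj
        rcases List.mem_cons.1 hj with rfl | hj
        · exact List.mem_cons_self
        · exact mem_rotate_iff.1 (hm j hj)
      · rw [wordProd_cons, inversionSet_mul_of_notMem hnot, hI, hind]
      · rw [hsm, wordProd_cons]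
        exact (length_lt_length_mul_iff i m).2 hnot
      · rw [hsm, hc]
        simpa [wordProd_append] using hsort
    · obtain ⟨m, hm, hI, hsort⟩ := ih _ (by rw [← hn, List.length_cons]; omega) hP' hE hA.tail rfl
      have him : i ∉ m := fun h => hil (hm i h)
      refine ⟨m, fun j hj => List.mem_cons_of_mem _ (hm j hj), hI,
        .ascent _ _ i (isInitial_wordProd_cons hA.nodup) ?_ (wordProd_mem_closure him) ?_⟩
      · rw [length_lt_length_mul_iff, hI]
        rintro ⟨M, hM, hI, hd⟩
        have h1 := dim_eq_zero_iff.2 ((hP'.isRep M hM).2 i hil)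
        rw [rdim_eq_single_iff.1 hd, Pi.single_eq_same] at h1
        exact one_ne_zero h1
      · rwa [hc]

/-- The inversion set of a sortable element consists of the dimension vectors of the indecomposable
objects of a torsion class. -/
theorem exists_isTors_of_isSortable (k : Type u) [Field k] {c x : (Q → ℝ) ≃ₗ[ℝ] (Q → ℝ)}
    (h : IsSortable c x) {E : Q → Q → Prop} {l : List Q} (hc : c = wordProd l)
    (hx : ∃ m, wordProd m = x) (hE : IsOrientation E) (hA : Adm E l) :
    ∃ P : GRep k Q → Prop, IsTors E l P ∧ indSet P = inversionSet x := by
  induction h generalizing E l with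
  | one c => exact ⟨IsZero, isTors_isZero E l, by rw [indSet_isZero, inversionSet_one]⟩
  | ascent c x i hi hl hw h ih =>
    subst hc
    obtain ⟨a, b, rfl, hab⟩ := hi.exists_eq_append hA.nodup
    have hA' := hA.move_to_front hE hab
    obtain ⟨P, hP, hI⟩ := ih (E := E) (l := a ++ b) (by
      rw [wordProd_append_cons_comm hab, wordProd_cons, ← mul_assoc, simpleReflection_mul_self,
        one_mul]) hx hE hA'.tail
    exact ⟨P, hP.mono (by simp +contextual [or_imp]), hI⟩
  | descent c x i hi hl h ih =>
    subst hc
    obtain ⟨m, rfl⟩ := hx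
    obtain ⟨a, b, rfl, hab⟩ := hi.exists_eq_append hA.nodup
    have hA' := hA.move_to_front hE hab
    obtain ⟨P', hP', hI⟩ := ih (E := reflectAt E i) (l := a ++ b ++ [i]) (by
      rw [wordProd_append_cons_comm hab, wordProd_cons, ← mul_assoc, simpleReflection_mul_self,
        one_mul, wordProd_append _ [i], wordProd_cons, wordProd_nil, mul_one])
      ⟨i :: m, wordProd_cons i m⟩ (hE.reflect i) hA'.reflect
    rw [length_mul_lt_length_iff] at hl
    have hn : ε i ∉ inversionSet (simpleReflection i * wordProd m) := by
      rw [single_mem_inversionSet_mul_iff]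
      exact not_not.2 hl
    have hS : ¬ P' (simple k i) := fun h => by
      rw [← hI, hP'.single_mem_indSet_iff hA'.reflect (by simp)] at hn
      exact hn h
    refine ⟨GRep.reflUp E i (a ++ b) P', (hP'.reflUp hA').mono (by simp +contextual [or_imp]), ?_⟩
    rw [hP'.indSet_reflUp hE hA' hS, hI]
    have h1 := inversionSet_mul_of_notMem (l := i :: m) (by rwa [wordProd_cons])
    rw [wordProd_cons, ← mul_assoc, simpleReflection_mul_self, one_mul] at h1
    exact h1.symm

/-- By Gabriel's theorem, inclusion of torsion classes is inclusion of the sets of dimension vectors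
of their indecomposable objects. -/
theorem IsTors.le_iff (hP : IsTors E l P) (hP' : IsTors E l P') (hE : IsOrientation E)
    (hA : Adm E l) : (∀ M, P M → P' M) ↔ indSet P ⊆ indSet P' := by
  constructor
  · rintro h _ ⟨M, hM, hI, rfl⟩
    exact ⟨M, h M hM, hI, rfl⟩
  · intro h
    refine hP.le_of_indec hP' fun M hM hI => ?_
    obtain ⟨N, hN, hNI, hd⟩ := h ⟨M, hM, hI, rfl⟩
    have := (isRigidRoot hE hA (hP.isRep M hM) hI).2 N (hP'.isRep N hN) hNI (rdim_eq_iff.1 hd)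
    exact hP'.iso this.symm hN

end sortable
end GRep

namespace GRep

/-! ### Functors on the path category and families of linear maps -/

section functors

theorem Iso.isIndec {k : Type u} [Field k] {V : Type v} {M N : GRep k V} (h : Iso M N)
    (hM : M.IsIndec) : N.IsIndec := by
  obtain ⟨F, G, h1, h2⟩ := h
  refine ⟨fun hz => hM.1 fun a x => by
    rw [← h1 a x, hz a (F.φ a x), map_zero], fun e he => ?_⟩
  refine (hM.2 ((F.comp e).comp G) fun a x => ?_).imp (fun h a x => ?_) fun h a x => ?_
  · change G.φ a (e.φ a (F.φ a (G.φ a (e.φ a (F.φ a x))))) = G.φ a (e.φ a (F.φ a x))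
    rw [h2, he]
  · have h3 : G.φ a (e.φ a (F.φ a (G.φ a x))) = 0 := h a (G.φ a x)
    rw [← h2 a (e.φ a x), ← h2 a x, h3, map_zero]
  · have h3 : G.φ a (e.φ a (F.φ a (G.φ a x))) = G.φ a x := h a (G.φ a x)
    rw [h2] at h3
    rw [← h2 a (e.φ a x), h3, h2]

variable {k : Type u} [Field k] {Q : Type v} [Quiver.{w} Q]

open scoped Classical in
/-- The family of linear maps of a functor on the path category. It loses no information if there is
at most one arrow between two vertices. -/
def ofFunctor (F : Rep k Q) : GRep k Q where
  X a := F.obj ((Paths.of Q).obj a)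
  f a b := if h : Nonempty (a ⟶ b) then (F.map ((Paths.of Q).map h.some)).hom.hom else 0

theorem ofFunctor_f_of_nonempty (F : Rep k Q) {a b : Q} (h : Nonempty (a ⟶ b)) :
    (ofFunctor F).f a b = (F.map ((Paths.of Q).map h.some)).hom.hom :=
  dif_pos h

theorem ofFunctor_f_of_not (F : Rep k Q) {a b : Q} (h : ¬ Nonempty (a ⟶ b)) :
    (ofFunctor F).f a b = 0 :=
  dif_neg h

/-- The morphism of families of a natural transformation. -/
def ofNat {F G : Rep k Q} (η : F ⟶ G) : Hom (ofFunctor F) (ofFunctor G) where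
  φ a := (η.app ((Paths.of Q).obj a)).hom.hom
  comm a b x := by
    by_cases h : Nonempty (a ⟶ b)
    · rw [ofFunctor_f_of_nonempty F h, ofFunctor_f_of_nonempty G h]
      exact congrArg (fun t => t.hom.hom x) (η.naturality ((Paths.of Q).map h.some))
    · rw [ofFunctor_f_of_not F h, ofFunctor_f_of_not G h]
      exact map_zero _

theorem epi_iff_surj {F G : Rep k Q} (η : F ⟶ G) : Epi η ↔ (ofNat η).Surj := by
  rw [NatTrans.epi_iff_epi_app]
  refine forall_congr' fun X => ?_
  rw [← (forget₂ (FGModuleCat.{u} k) (ModuleCat.{u} k)).epi_map_iff_epi,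
    ModuleCat.epi_iff_surjective]
  rfl

theorem exact_iff (S : ShortComplex (Rep k Q)) : S.Exact ↔ (ofNat S.f).Exact (ofNat S.g) := by
  have h1 : S.Exact ↔ ∀ X, (S.map ((evaluation (Paths Q) (FGModuleCat.{u} k)).obj X)).Exact := by
    rw [ShortComplex.exact_iff_isZero_homology, Functor.isZero_iff]
    refine forall_congr' fun X => ?_
    rw [ShortComplex.exact_iff_isZero_homology]
    exact (S.mapHomologyIso ((evaluation (Paths Q) (FGModuleCat.{u} k)).obj X)).isZero_iff.symm
  rw [h1]
  refine forall_congr' fun X => ?_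
  rw [← ShortComplex.exact_map_iff_of_faithful _ (forget₂ (FGModuleCat.{u} k) (ModuleCat.{u} k)),
    ShortComplex.moduleCat_exact_iff]
  refine forall_congr' fun y => ⟨fun h => ⟨h, ?_⟩, fun h => h.1⟩
  rintro ⟨x, rfl⟩
  exact congrArg (fun t : S.X₁ ⟶ S.X₃ => (t.app X).hom.hom x) S.zero

theorem isZero_iff {F : Rep k Q} : Limits.IsZero F ↔ (ofFunctor F).IsZero := by
  rw [Functor.isZero_iff]
  refine forall_congr' fun X => ?_
  rw [Limits.IsZero.iff_id_eq_zero]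
  refine ⟨fun h x => congrArg (fun t => t.hom.hom x) h, fun h => ?_⟩
  ext x
  exact h x

variable [IsSimplyLacedDynkin Q]

theorem ofFunctor_f (F : Rep k Q) {a b : Q} (e : a ⟶ b) :
    (ofFunctor F).f a b = (F.map ((Paths.of Q).map e)).hom.hom := by
  have h : Nonempty (a ⟶ b) := ⟨e⟩
  have := IsSimplyLacedDynkin.simply_laced a b
  rw [Subsingleton.elim e h.some, ofFunctor_f_of_nonempty F h]

/-- The natural transformation of a morphism of families. -/
def toNat {F G : Rep k Q} (η : Hom (ofFunctor F) (ofFunctor G)) : F ⟶ G where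
  app X := FGModuleCat.ofHom (η.φ X)
  naturality X Y p := by
    induction p using Paths.induction with
    | id => simp
    | @comp a b c p q ih =>
      rw [F.map_comp, G.map_comp, Category.assoc, ← Category.assoc _ _ (G.map _), ← ih,
        Category.assoc]
      congr 1
      ext x
      have h1 := η.comm b c x
      rw [ofFunctor_f F q, ofFunctor_f G q] at h1
      exact h1

/-- Each family that is a representation comes from a functor, up to isomorphism. -/
theorem exists_ofFunctor_iso {M : GRep k Q} {l : List Q}
    (hM : IsRep (fun a b : Q => Nonempty (a ⟶ b)) l M) : ∃ F : Rep k Q, Iso (ofFunctor F) M := by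
  let F : Rep k Q := Paths.lift
    { obj := fun a => FGModuleCat.of k (M.X a)
      map := fun {a b} _ => FGModuleCat.ofHom (M.f a b) }
  have hf : ∀ a b x, (ofFunctor F).f a b x = M.f a b x := by
    intro a b x
    by_cases h : Nonempty (a ⟶ b)
    · rw [ofFunctor_f F h.some]
      have h1 : F.map ((Paths.of Q).map h.some) = FGModuleCat.ofHom (M.f a b) :=
        Paths.lift_toPath _ _
      rw [h1]
      rfl
    · exact (LinearMap.congr_fun (ofFunctor_f_of_not F h) x).trans (hM.1 a b h x).symm
  exact ⟨F, ⟨fun a => LinearMap.id, hf⟩, ⟨fun a => LinearMap.id, fun a b x => (hf a b x).symm⟩,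
    fun _ _ => rfl, fun _ _ => rfl⟩

end functors

/-- In an abelian category, idempotents split, so an object is indecomposable if and only if it is
nonzero and has no idempotents other than `0` and `1`. -/
theorem indecomposable_iff_idempotents {C : Type*} [Category C] [Abelian C] (X : C) :
    Indecomposable X ↔ ¬ Limits.IsZero X ∧ ∀ e : X ⟶ X, e ≫ e = e → e = 0 ∨ e = 𝟙 X := by
  refine and_congr_right fun _ => ⟨fun h e he => ?_, fun h Y Z a => ?_⟩
  · obtain ⟨Y, i, p, hip, hpi⟩ := IsIdempotentComplete.idempotents_split X e he
    obtain ⟨Z, j, q, hjq, hqj⟩ := IsIdempotentComplete.idempotents_split X (𝟙 X - e)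
      (by simp [he])
    have hiq : i ≫ q = 0 := by
      have : i ≫ q = (i ≫ p ≫ i) ≫ (q ≫ j) ≫ q := by simp [hjq, reassoc_of% hip]
      rw [this, hpi, hqj]
      simp [reassoc_of% he]
    have hjp : j ≫ p = 0 := by
      have : j ≫ p = (j ≫ q ≫ j) ≫ (p ≫ i) ≫ p := by simp [hip, reassoc_of% hjq]
      rw [this, hpi, hqj]
      simp [reassoc_of% he]
    let b : BinaryBicone Y Z :=
      { pt := X, fst := p, snd := q, inl := i, inr := j, inl_fst := hip, inl_snd := hiq,
        inr_fst := hjp, inr_snd := hjq }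
    have hb : b.IsBilimit := isBinaryBilimitOfTotal b (by simp [b, hpi, hqj])
    refine (h Y Z (biprod.uniqueUpToIso Y Z hb)).imp (fun hY => ?_) fun hZ => ?_
    · rw [← hpi, hY.eq_of_src i 0, comp_zero]
    · rw [hZ.eq_of_src j 0, comp_zero] at hqj
      exact (sub_eq_zero.1 hqj.symm).symm
  · refine (h (a.hom ≫ biprod.fst ≫ biprod.inl ≫ a.inv) (by simp)).imp (fun h0 => ?_) fun h1 => ?_
    · rw [IsZero.iff_id_eq_zero]
      have := congrArg (fun t => biprod.inl ≫ a.inv ≫ t ≫ a.hom ≫ biprod.fst) h0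
      simpa using this
    · rw [IsZero.iff_id_eq_zero]
      have := congrArg (fun t => biprod.inr ≫ a.inv ≫ t ≫ a.hom ≫ biprod.snd) h1
      simpa using this.symm

section functors

variable {k : Type u} [Field k] {Q : Type v} [Quiver.{w} Q] [IsSimplyLacedDynkin Q]

theorem indecomposable_iff_isIndec {F : Rep k Q} : Indecomposable F ↔ (ofFunctor F).IsIndec := by
  rw [indecomposable_iff_idempotents, IsIndec, isZero_iff]
  have hext : ∀ {η θ : F ⟶ F}, (∀ a x, (ofNat η).φ a x = (ofNat θ).φ a x) → η = θ := by
    intro η θ h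
    ext X x
    exact h X x
  refine and_congr_right fun _ => ⟨fun h e he => ?_, fun h e he => ?_⟩
  · refine (h (toNat e) (hext he)).imp (fun h0 a x => ?_) fun h0 a x => ?_
    · exact congrArg (fun η => (ofNat η).φ a x) h0
    · exact congrArg (fun η => (ofNat η).φ a x) h0
  · exact (h (ofNat e) fun a x => congrArg (fun η => (ofNat η).φ a x) he).imp
      (fun h0 => hext h0) fun h0 => hext h0

end functors

end GRep

/-! ### The two descriptions of torsion classes, and the lattice structure -/

section bridge

variable {k : Type u} [Field k] {Q : Type v} [Quiver.{w} Q]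

theorem IsTorsionClass.prop_of_iso {T : ObjectProperty (Rep k Q)} (hT : IsTorsionClass T)
    {F G : Rep k Q} (e : F ≅ G) (hF : T F) : T G :=
  have := hT.closedUnderQuotients
  ObjectProperty.IsClosedUnderQuotients.prop_of_epi e.hom hF

theorem IsTorsionClass.prop_of_isZero {T : ObjectProperty (Rep k Q)} (hT : IsTorsionClass T)
    {F : Rep k Q} (hF : IsZero F) : T F := by
  obtain ⟨Z, hZ, hTZ⟩ := hT.containsZero.exists_zero
  exact hT.prop_of_iso (hZ.iso hF) hTZ

/-- A torsion class contains the middle term of a sequence that is exact in the middle and on the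
right, and whose outer terms it contains. -/
theorem IsTorsionClass.prop_of_exact {T : ObjectProperty (Rep k Q)} (hT : IsTorsionClass T)
    {S : ShortComplex (Rep k Q)} (hS : S.Exact) (hg : Epi S.g) (h₁ : T S.X₁) (h₃ : T S.X₃) :
    T S.X₂ := by
  have := hT.closedUnderQuotients
  have := hT.closedUnderExtensions
  have hl : Epi (kernel.lift S.g S.f S.zero) := S.exact_iff_epi_kernel_lift.1 hS
  have hK : T (kernel S.g) :=
    ObjectProperty.IsClosedUnderQuotients.prop_of_epi (kernel.lift S.g S.f S.zero) h₁
  let S' : ShortComplex (Rep k Q) := ShortComplex.mk (kernel.ι S.g) S.g (kernel.condition S.g)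
  have hS' : S'.ShortExact :=
    { exact := S'.exact_of_f_is_kernel (kernelIsKernel S.g)
      mono_f := inferInstanceAs (Mono (kernel.ι S.g))
      epi_g := hg }
  exact (ObjectProperty.IsClosedUnderExtensions.prop_X₂_of_shortExact hS' hK h₃ : T S'.X₂)

theorem isTorsionClass_sInf (S : Set (TorsionClass k Q)) :
    IsTorsionClass (fun F : Rep k Q => ∀ T ∈ S, T.1 F) where
  containsZero := ⟨_, isZero_zero _, fun T _ => T.2.prop_of_isZero (isZero_zero _)⟩
  closedUnderQuotients := ⟨fun f _ hF T hT =>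
    have := T.2.closedUnderQuotients
    ObjectProperty.IsClosedUnderQuotients.prop_of_epi f (hF T hT)⟩
  closedUnderExtensions := ⟨fun hS h₁ h₃ T hT =>
    have := T.2.closedUnderExtensions
    ObjectProperty.IsClosedUnderExtensions.prop_X₂_of_shortExact hS (h₁ T hT) (h₃ T hT)⟩

variable (k Q) in
/-- The intersection of torsion classes is a torsion class, so the torsion classes form a complete
lattice. -/
theorem isLatticeOrder_torsionClass : IsLatticeOrder (TorsionClass k Q) := by
  have hglb : ∀ S : Set (TorsionClass k Q), ∃ m, IsGLB S m := fun S =>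
    ⟨⟨_, isTorsionClass_sInf S⟩, fun T hT F hF => hF T hT, fun _ hT _ hF _ hT' => hT hT' _ hF⟩
  refine ⟨fun x y hxy hyx => le_antisymm hxy hyx, fun x y => ⟨hglb _, ?_⟩⟩
  obtain ⟨m, hm⟩ := hglb (upperBounds {x, y})
  exact ⟨m, isGLB_upperBounds.1 hm⟩

theorem IsLatticeOrder.of_orderIso {α β : Type*} [Preorder α] [Preorder β] (e : α ≃o β)
    (h : IsLatticeOrder α) : IsLatticeOrder β := by
  refine ⟨fun x y hxy hyx => ?_, fun x y => ⟨?_, ?_⟩⟩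
  · exact e.symm.injective (h.1 _ _ (e.symm.monotone hxy) (e.symm.monotone hyx))
  all_goals
    have hpair : ({x, y} : Set β) = e '' {e.symm x, e.symm y} := by
      rw [Set.image_pair, e.apply_symm_apply, e.apply_symm_apply]
    rw [hpair]
  · obtain ⟨m, hm⟩ := (h.2 (e.symm x) (e.symm y)).1
    exact ⟨e m, e.isGLB_image'.2 hm⟩
  · obtain ⟨m, hm⟩ := (h.2 (e.symm x) (e.symm y)).2
    exact ⟨e m, e.isLUB_image'.2 hm⟩

/-- The class of families of linear maps of a class of functors. -/
def toClass (T : ObjectProperty (Rep k Q)) (M : GRep k Q) : Prop :=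
  ∃ F, T F ∧ GRep.Iso (GRep.ofFunctor F) M

/-- The class of functors of a class of families of linear maps. -/
def ofClass (P : GRep k Q → Prop) : ObjectProperty (Rep k Q) := fun F => P (GRep.ofFunctor F)

/-- The arrow relation of the quiver. -/
def Arrow (a b : Q) : Prop := Nonempty (a ⟶ b)

theorem ofFunctor_isRep {l : List Q} (hl : ∀ a, a ∈ l) (F : Rep k Q) :
    GRep.IsRep Arrow l (GRep.ofFunctor F) :=
  ⟨fun a b h x => by rw [GRep.ofFunctor_f_of_not F h, LinearMap.zero_apply],
    fun a ha => absurd (hl a) ha⟩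

theorem GRep.IsRep.of_iso {V : Type v} {E : V → V → Prop} {l : List V} {M N : GRep k V}
    (hM : GRep.IsRep E l M) (h : GRep.Iso M N) : GRep.IsRep E l N := by
  obtain ⟨F, G, -, h2⟩ := h
  exact hM.of_surj (F := F) fun a x => ⟨G.φ a x, h2 a x⟩

theorem isTorsionClass_ofClass {l : List Q} (hl : ∀ a, a ∈ l) {P : GRep k Q → Prop}
    (hP : GRep.IsTors Arrow l P) : IsTorsionClass (ofClass P) where
  containsZero := ⟨_, isZero_zero _, hP.zero _ (GRep.isZero_iff.1 (isZero_zero _))⟩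
  closedUnderQuotients := ⟨fun f hf hF => hP.quot _ ((GRep.epi_iff_surj f).1 hf) hF⟩
  closedUnderExtensions := ⟨fun hS h₁ h₃ => hP.ext _ _ (ofFunctor_isRep hl _)
    ((GRep.exact_iff _).1 hS.exact) ((GRep.epi_iff_surj _).1 hS.epi_g) h₁ h₃⟩

variable [IsSimplyLacedDynkin Q]

theorem IsTorsionClass.prop_of_surj {T : ObjectProperty (Rep k Q)} (hT : IsTorsionClass T)
    {F G : Rep k Q} (η : GRep.Hom (GRep.ofFunctor F) (GRep.ofFunctor G)) (h : η.Surj) (hF : T F) :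
    T G :=
  have := hT.closedUnderQuotients
  have : Epi (GRep.toNat η) := (GRep.epi_iff_surj _).2 h
  ObjectProperty.IsClosedUnderQuotients.prop_of_epi (GRep.toNat η) hF

theorem isTors_toClass {l : List Q} (hl : ∀ a, a ∈ l) {T : ObjectProperty (Rep k Q)}
    (hT : IsTorsionClass T) : GRep.IsTors Arrow l (toClass T) where
  isRep M := fun ⟨F, _, h⟩ => (ofFunctor_isRep hl F).of_iso h
  zero M hM := by
    obtain ⟨F, hF⟩ := GRep.exists_ofFunctor_iso (hM.isRep Arrow l)
    refine ⟨F, hT.prop_of_isZero (GRep.isZero_iff.2 ?_), hF⟩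
    obtain ⟨f, g, h1, -⟩ := hF
    exact fun a x => by rw [← h1 a x, hM a (f.φ a x), map_zero]
  quot {M N} η hη := by
    rintro ⟨F, hF, hFM⟩
    have hN := ((ofFunctor_isRep hl F).of_iso hFM).of_surj hη
    obtain ⟨G, hG⟩ := GRep.exists_ofFunctor_iso hN
    refine ⟨G, ?_, hG⟩
    obtain ⟨f, f', -, hf⟩ := hFM
    obtain ⟨g, g', hg, -⟩ := hG
    refine hT.prop_of_surj ((f.comp η).comp g') (fun a y => ?_) hF
    obtain ⟨x, hx⟩ := hη a (g.φ a y)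
    exact ⟨f'.φ a x, by
      change g'.φ a (η.φ a (f.φ a (f'.φ a x))) = y
      rw [hf, hx, hg]⟩
  ext {A B C} α β hB hαβ hβ := by
    rintro ⟨F, hF, hFA⟩ ⟨H, hH, hHC⟩
    obtain ⟨G, hG⟩ := GRep.exists_ofFunctor_iso hB
    refine ⟨G, ?_, hG⟩
    obtain ⟨f, f', -, hf⟩ := hFA
    obtain ⟨g, g', hg, hg'⟩ := hG
    obtain ⟨h, h', hh', hh⟩ := hHC
    -- The sequence `A ⟶ B ⟶ C`, transported to functors.
    have hex : GRep.Hom.Exact ((f.comp α).comp g') ((g.comp β).comp h') := by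
      intro a y
      change h'.φ a (β.φ a (g.φ a y)) = 0 ↔ ∃ x, g'.φ a (α.φ a (f.φ a x)) = y
      constructor
      · intro h0
        obtain ⟨x, hx⟩ := (hαβ a (g.φ a y)).1 (by rw [← hh a (β.φ a _), h0, map_zero])
        exact ⟨f'.φ a x, by rw [hf, hx, hg]⟩
      · rintro ⟨x, rfl⟩
        rw [hg', (hαβ a _).2 ⟨_, rfl⟩, map_zero]
    have hsurj : GRep.Hom.Surj ((g.comp β).comp h') := fun a y => by
      obtain ⟨x, hx⟩ := hβ a (h.φ a y)
      refine ⟨g'.φ a x, ?_⟩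
      change h'.φ a (β.φ a (g.φ a (g'.φ a x))) = y
      rw [hg', hx, hh']
    let S : ShortComplex (Rep k Q) := ShortComplex.mk (GRep.toNat ((f.comp α).comp g'))
      (GRep.toNat ((g.comp β).comp h')) (by
        ext X x
        exact (hex X _).2 ⟨x, rfl⟩)
    exact hT.prop_of_exact (S := S) ((GRep.exact_iff S).2 hex) ((GRep.epi_iff_surj S.g).2 hsurj)
      hF hH

theorem toClass_ofFunctor {T : ObjectProperty (Rep k Q)} (hT : IsTorsionClass T) {F : Rep k Q} :
    toClass T (GRep.ofFunctor F) ↔ T F := by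
  constructor
  · rintro ⟨G, hG, f, g, -, h⟩
    exact hT.prop_of_surj f (fun a x => ⟨g.φ a x, h a x⟩) hG
  · exact fun h => ⟨F, h, GRep.Hom.id _, GRep.Hom.id _, fun _ _ => rfl, fun _ _ => rfl⟩

theorem indSet_toClass {T : ObjectProperty (Rep k Q)} (hT : IsTorsionClass T) :
    GRep.indSet (toClass T) = Ind T := by
  ext α
  constructor
  · rintro ⟨M, ⟨F, hF, h⟩, hI, rfl⟩
    refine ⟨F, hF, GRep.indecomposable_iff_isIndec.2 (h.symm.isIndec hI), ?_⟩
    exact GRep.rdim_eq_iff.2 h.dim_eq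
  · rintro ⟨F, hF, hI, rfl⟩
    exact ⟨_, (toClass_ofFunctor hT).2 hF, GRep.indecomposable_iff_isIndec.1 hI, rfl⟩

theorem toClass_ofClass {l : List Q} {P : GRep k Q → Prop}
    (hP : GRep.IsTors Arrow l P) : toClass (ofClass P) = P := by
  funext M
  refine propext ⟨fun ⟨F, hF, h⟩ => hP.iso h hF, fun hM => ?_⟩
  obtain ⟨F, hF⟩ := GRep.exists_ofFunctor_iso (hP.isRep M hM)
  exact ⟨F, hP.iso hF.symm hM, hF⟩

theorem torsionClass_le_iff [Fintype Q] [DecidableEq Q] {l : List Q} (hl : ∀ a, a ∈ l)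
    (hA : GRep.Adm (Arrow (Q := Q)) l) (T T' : TorsionClass k Q) :
    T ≤ T' ↔ Ind T.1 ⊆ Ind T'.1 := by
  rw [← indSet_toClass T.2, ← indSet_toClass T'.2,
    ← (isTors_toClass hl T.2).le_iff (isTors_toClass hl T'.2) (fun a b => underlyingGraph_adj) hA]
  exact ⟨fun h M ⟨F, hF, hM⟩ => ⟨F, h F hF, hM⟩, fun h F hF =>
    (toClass_ofFunctor T'.2).1 (h _ ((toClass_ofFunctor T.2).2 hF))⟩

end bridge

end DynkinQuiver

end

theorem mainTheorem6 (k : Type u) [Field k] [IsAlgClosed k]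
    (Q : Type v) [Quiver.{w} Q] [Fintype Q] [DecidableEq Q] [DynkinQuiver.IsSimplyLacedDynkin Q]
    (c : (Q → ℝ) ≃ₗ[ℝ] (Q → ℝ)) (hc : DynkinQuiver.IsCox c) :
    ∃ φ : DynkinQuiver.TorsionClass k Q → DynkinQuiver.weylGroup Q,
      -- `φ T` is the one element of `W` whose inversion set is `Ind T`
      (∀ (T : DynkinQuiver.TorsionClass k Q) (w : DynkinQuiver.weylGroup Q),
        DynkinQuiver.Ind T.1 = DynkinQuiver.inversionSet w.1 ↔ w = φ T) ∧
      -- `φ` is a bijection from torsion classes to `cox(Q)`-sortable elements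
      Set.BijOn φ Set.univ {w | DynkinQuiver.IsSortable c w.1} ∧
      -- it is an isomorphism from the poset of torsion classes to the Cambrian lattice
      (∃ e : DynkinQuiver.TorsionClass k Q ≃o DynkinQuiver.Cambrian c, ∀ T, (e T).1 = φ T) ∧
      -- both of these are lattices
      DynkinQuiver.IsLatticeOrder (DynkinQuiver.TorsionClass k Q) ∧
      DynkinQuiver.IsLatticeOrder (DynkinQuiver.Cambrian c) := by
  open DynkinQuiver in
  obtain ⟨l, hnd, hl, hpair, rfl⟩ := hc
  have hA : GRep.Adm (Arrow (Q := Q)) l :=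
    ⟨hnd, hpair.imp fun h => not_nonempty_iff.2 h, fun a => not_nonempty_iff.2
      (IsSimplyLacedDynkin.no_loop a)⟩
  have hE : GRep.IsOrientation (Arrow (Q := Q)) := fun a b => underlyingGraph_adj
  have huniq : ∀ x y : weylGroup Q, inversionSet x.1 = inversionSet y.1 → x = y := by
    rintro ⟨x, hx⟩ ⟨y, hy⟩ h
    obtain ⟨a, rfl⟩ := mem_weylGroup_iff.1 hx
    obtain ⟨b, rfl⟩ := mem_weylGroup_iff.1 hy
    exact Subtype.ext (wordProd_eq_of_inversionSet_eq h)
  choose m _ hm hsort using fun T : TorsionClass k Q =>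
    (isTors_toClass hl T.2).exists_sortable hE hA
  let φ : TorsionClass k Q → weylGroup Q := fun T => ⟨wordProd (m T), wordProd_mem_weylGroup _⟩
  have hφ : ∀ T, inversionSet (φ T).1 = Ind T.1 := fun T => (hm T).trans (indSet_toClass T.2)
  have hle : ∀ T T', T ≤ T' ↔ inversionSet (φ T).1 ⊆ inversionSet (φ T').1 := fun T T' => by
    rw [hφ, hφ, torsionClass_le_iff hl hA]
  have hinj : Function.Injective φ := fun T T' h =>
    le_antisymm ((hle T T').2 (by rw [h])) ((hle T' T).2 (by rw [h]))
  have hsurj : ∀ x : weylGroup Q, IsSortable (wordProd l) x.1 → ∃ T, φ T = x := by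
    intro x hx
    obtain ⟨P, hP, hI⟩ := GRep.exists_isTors_of_isSortable k hx rfl (mem_weylGroup_iff.1 x.2) hE hA
    have hT := isTorsionClass_ofClass hl hP
    refine ⟨⟨_, hT⟩, huniq _ _ ?_⟩
    rw [hφ, ← indSet_toClass hT, toClass_ofClass hP, hI]
  let e : TorsionClass k Q ≃o Cambrian (wordProd l) :=
    { Equiv.ofBijective (fun T => (⟨φ T, hsort T⟩ : Cambrian (wordProd l)))
        ⟨fun T T' h => hinj (congrArg Subtype.val h), fun x =>
          (hsurj x.1 x.2).imp fun T hT => Subtype.ext hT⟩ with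
      map_rel_iff' := fun {T T'} => (hle T T').symm }
  exact ⟨φ, fun T x => ⟨fun h => huniq _ _ (by rw [hφ, h]), fun h => by rw [h, hφ]⟩,
    ⟨fun T _ => hsort T, hinj.injOn, fun x hx => (hsurj x hx).imp fun T hT => ⟨trivial, hT⟩⟩,
    ⟨e, fun T => rfl⟩, isLatticeOrder_torsionClass k Q,
    (isLatticeOrder_torsionClass k Q).of_orderIso e⟩
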